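/- Let $d\ge 1$ be a square-free integer with $d\ne 1,3$, let $K=\mathbb{Q}(\sqrt{-d})$, and let $D=d_K$ be its discriminant, so $D=-d$ if $-d\equiv 1 \pmod 4$ and $D=-4d$ otherwise. For a lattice $L\subset\mathbb{R}^2$ and a polynomial $P$ put $$\Theta_{L,P}=\sum_{x\in L}P(x)\,q^{(x,x)},\qquad q=e^{2\pi i z},\ \operatorname{Im} z>0,$$ and let $P_1=(x^2-y^2)/2$, $P_2=x^2-y^2$. Identify $\mathbb{R}^2$ with $\mathbb{C}$. Let $L_{\mathfrak o}$ be the ring of integers of $K$, with basis $1,\frac{-1+\sqrt{-d}}2$ if $-d\equiv1\pmod 4$ and $1,\sqrt{-d}$ otherwise. For a positive definite form $ax^2+bxy+cy^2$ of discriminant $b^2-4ac=D$ that is reduced (that is, $|b|\le a\le c$, and $b\ge 0$ if $|b|=a$ or $a=c$), let $L_{a,b}=\frac{1}{\sqrt a}\left(\mathbb{Z}a+\mathbb{Z}\frac{b+\sqrt{D}}{2}\right)$. When $K$ has class number $2$, $L_{\mathfrak a}$ denotes the lattice $L_{a,b}$ of the reduced form with $a\neq 1$, which represents the nonprincipal class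 $\mathfrak a$. Say that $f$ is a normalized CM Hecke eigenform for $K$ if $f$ is a cusp form of weight $3$ in $S_3(\Gamma_0(|D|),\chi)$, where $\chi$ is the Dirichlet character modulo $|D|$ with $\chi(p)=\left(\frac{D}{p}\right)$ (Kronecker symbol) for all primes $p$; its Fourier expansion $f=\sum_{m\ge1}a(m)q^m$ has $a(1)=1$; $f$ is an eigenvector of all Hecke operators $T_n$, $n\ge1$, of weight $3$ and character $\chi$; and $f$ has complex multiplication by $\chi\neq 1$, i.e. $\chi(p)a(p)=a(p)$ for all primes $p\nmid D$. 1. If $K$ has class number $1$, then $\Theta_{L_{\mathfrak o},P_1}$ is a normalized CM Hecke eigenform for $K$. 2. If $K$ has class number $2$, then $c_1\Theta_{L_{\mathfrak o},P_2}+c_2\Theta_{L_{\mathfrak a},P_2}$ is a normalized CM Hecke eigenform for $K$, where $c_1=\frac12$, and $c_2=\frac ab$ if the reduced form $ax^2+bxy+cy^2$ with $a\ne1$ has $a=c$, and $c_2=\frac12$ otherwise. 3. In particular, if $K$ has class number $2$, the conclusion of 2 holds with $c_1=\frac12$ and with $L_{\mathfrak a}=L_{a,b}$ and $c_2$ as follows.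 - $d=5,13,37$: $(a,b)=(2,2)$, $c_2=\frac12$. - $d=6,10,22,58$: $(a,b)=(2,0)$, $c_2=\frac12$. - $d=51,123,267$: $(a,b)=(3,3)$, $c_2=\frac12$. - $d=115,235$: $(a,b)=(5,5)$, $c_2=\frac12$. - $d=427$: $(a,b)=(7,7)$, $c_2=\frac12$. - $d=15$: $(a,b)=(2,1)$, $c_2=2$. - $d=35$: $(a,b)=(3,1)$, $c_2=3$. - $d=91$: $(a,b)=(5,3)$, $c_2=\frac53$. - $d=187$: $(a,b)=(7,3)$, $c_2=\frac73$. - $d=403$: $(a,b)=(11,9)$, $c_2=\frac{11}9$. -/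

import Mathlib

open UpperHalfPlane
open scoped MatrixGroups ModularForm

noncomputable section

namespace ToyLehmer

/-! ### Theta series of lattices -/

/-- The theta series `Θ_{Λ,P}(z) = ∑_{x ∈ Λ} P(x) e^{iπ z (x,x)}` of a lattice `Λ ⊆ ℝⁿ` weighted by
the polynomial `P`. -/
def thetaSeries {n : ℕ} (Λ : Submodule ℤ (EuclideanSpace ℝ (Fin n)))
    (P : MvPolynomial (Fin n) ℝ) (z : ℂ) : ℂ :=
  ∑' x : Λ, ((MvPolynomial.eval (fun i => (x : EuclideanSpace ℝ (Fin n)) i) P : ℝ) : ℂ) *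
    Complex.exp (Complex.I * (Real.pi : ℂ) * z *
      ((inner ℝ (x : EuclideanSpace ℝ (Fin n)) (x : EuclideanSpace ℝ (Fin n)) : ℝ) : ℂ))

/-- The `q`-series `Θ_{Λ,P}(q) = ∑_{x ∈ Λ} P(x) q^{(x,x)}` read with `q = e^{2πiz}`, as a function
on the upper half-plane; this is `Θ_{Λ,P}(2z)`. -/
def thetaQ {n : ℕ} (Λ : Submodule ℤ (EuclideanSpace ℝ (Fin n)))
    (P : MvPolynomial (Fin n) ℝ) : ℍ → ℂ :=
  fun z => thetaSeries Λ P (2 * (z : ℂ))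

/-- The harmonic polynomial `P₁ = (x² - y²)/2`. -/
def P₁ : MvPolynomial (Fin 2) ℝ :=
  MvPolynomial.C (1 / 2) * (MvPolynomial.X 0 ^ 2 - MvPolynomial.X 1 ^ 2)

/-- The harmonic polynomial `P₂ = x² - y²`. -/
def P₂ : MvPolynomial (Fin 2) ℝ :=
  MvPolynomial.X 0 ^ 2 - MvPolynomial.X 1 ^ 2

/-! ### The lattices attached to the ideal classes of `ℚ(√-d)` -/

/-- The discriminant of `ℚ(√-d)`, for `d` positive and square-free: `-d` if `-d ≡ 1 (mod 4)`, and
`-4d` otherwise. -/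
def fieldDisc (d : ℕ) : ℤ :=
  if d % 4 = 3 then -(d : ℤ) else -4 * (d : ℤ)

/-- The lattice `L_𝔬` of the principal class, that is the ring of integers of `ℚ(√-d)` placed in
`ℝ² = ℂ`: its basis is `1, (-1 + √-d)/2` if `-d ≡ 1 (mod 4)`, and `1, √-d` otherwise. -/
def principalLattice (d : ℕ) : Submodule ℤ (EuclideanSpace ℝ (Fin 2)) :=
  if d % 4 = 3 then Submodule.span ℤ {!₂[1, 0], !₂[-1 / 2, √(d : ℝ) / 2]}
  else Submodule.span ℤ {!₂[1, 0], !₂[0, √(d : ℝ)]}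

/-- `a x² + b x y + c y²` is a reduced positive definite form. -/
def IsReducedForm (a b c : ℤ) : Prop :=
  0 < a ∧ |b| ≤ a ∧ a ≤ c ∧ (|b| = a ∨ a = c → 0 ≤ b)

/-- The lattice of the form `a x² + b x y + c y²` of discriminant `D < 0`: the ideal
`ℤ a + ℤ (b + √D)/2`, of norm `a`, placed in `ℝ² = ℂ` and scaled by `1/√a`. -/
def formLattice (D a b : ℤ) : Submodule ℤ (EuclideanSpace ℝ (Fin 2)) :=
  Submodule.span ℤ
    {(√(a : ℝ))⁻¹ • !₂[(a : ℝ), 0], (√(a : ℝ))⁻¹ • !₂[(b : ℝ) / 2, √(-(D : ℝ)) / 2]}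

/-- The coefficient `c₂` for the reduced form `a x² + b x y + c y²` of the nonprincipal class of a
field of class number two. -/
def coeffTwo (a b c : ℤ) : ℚ :=
  if a = c then (a : ℚ) / b else 1 / 2

/-- The fields of class number two: the entries `(d, a, b, c₂)` list `d`, the reduced
representative `ℤ a + ℤ (b + √d_K)/2` of the nonprincipal class, and the coefficient `c₂`. -/
def classNumberTwoTable : List (ℕ × ℤ × ℤ × ℚ) :=
  [(5, 2, 2, 1 / 2), (6, 2, 0, 1 / 2), (10, 2, 0, 1 / 2), (13, 2, 2, 1 / 2), (15, 2, 1, 2),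
   (22, 2, 0, 1 / 2), (35, 3, 1, 3), (37, 2, 2, 1 / 2), (51, 3, 3, 1 / 2), (58, 2, 0, 1 / 2),
   (91, 5, 3, 5 / 3), (115, 5, 5, 1 / 2), (123, 3, 3, 1 / 2), (187, 7, 3, 7 / 3),
   (235, 5, 5, 1 / 2), (267, 3, 3, 1 / 2), (403, 11, 9, 11 / 9), (427, 7, 7, 1 / 2)]

/-! ### Cusp forms with character and Hecke operators -/

/-- The Hecke operator `T_n` of weight `k` and character `χ`:
`(T_n f)(z) = n^(k-1) ∑_{a e = n} χ(a) e^(-k) ∑_{0 ≤ b < e} f((a z + b) / e)`. -/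
def heckeOperator {N : ℕ} (k : ℤ) (χ : DirichletCharacter ℂ N) (n : ℕ) (f : ℍ → ℂ) : ℍ → ℂ :=
  fun z => (n : ℂ) ^ (k - 1) * ∑ p ∈ n.divisorsAntidiagonal,
    χ (p.1 : ZMod N) * (p.2 : ℂ) ^ (-k) *
      ∑ b ∈ Finset.range p.2, f (ofComplex (((p.1 : ℂ) * (z : ℂ) + (b : ℂ)) / (p.2 : ℂ)))

/-- `f ∈ S_k(Γ₀(N), χ)`: `f` is a cusp form of weight `k` for `Γ₁(N)`, and
`f((az+b)/(cz+d)) = χ(d) (cz+d)^k f(z)` for all matrices in `Γ₀(N)`. -/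
def IsCuspFormWithCharacter {N : ℕ} (k : ℤ) (χ : DirichletCharacter ℂ N) (f : ℍ → ℂ) : Prop :=
  (∃ F : CuspForm ((CongruenceSubgroup.Gamma1 N).map (Matrix.SpecialLinearGroup.mapGL ℝ)) k,
    ⇑F = f) ∧
  ∀ γ ∈ CongruenceSubgroup.Gamma0 N, f ∣[k] γ = χ ((γ 1 1 : ℤ) : ZMod N) • f

/-- The `m`-th Fourier coefficient of a function on the upper half-plane of period one. -/
def fourierCoeff (f : ℍ → ℂ) (m : ℕ) : ℂ :=
  (qExpansion 1 f).coeff m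

/-- A normalized Hecke eigenform in `S_k(Γ₀(N), χ)`: a cusp form with `a(1) = 1` that is an
eigenvector of all the Hecke operators `T_n`, `n ≥ 1`. -/
structure IsNormalizedHeckeEigenform {N : ℕ} (k : ℤ) (χ : DirichletCharacter ℂ N)
    (f : ℍ → ℂ) : Prop where
  cuspForm : IsCuspFormWithCharacter k χ f
  normalized : fourierCoeff f 1 = 1
  eigen : ∀ n : ℕ, 0 < n → ∃ l : ℂ, heckeOperator k χ n f = l • f

/-- `f` has complex multiplication by the nontrivial character `ψ`: `ψ(p) a(p) = a(p)` for all
primes `p` not dividing the modulus of `ψ`. -/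
def HasCMBy {M : ℕ} (ψ : DirichletCharacter ℂ M) (f : ℍ → ℂ) : Prop :=
  ψ ≠ 1 ∧ ∀ p : ℕ, p.Prime → ¬ p ∣ M → ψ (p : ZMod M) * fourierCoeff f p = fourierCoeff f p

/-- The Kronecker symbol `(D/p)` of a discriminant `D` at a prime `p`. -/
def kroneckerAtPrime (D : ℤ) (p : ℕ) : ℤ :=
  if p = 2 then (if D % 8 = 1 then 1 else if D % 8 = 5 then -1 else 0) else jacobiSym D p

/-- `f` is a normalized Hecke eigenform of weight `3` in `S_3(Γ₀(|d_K|), (d_K/·))`, for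
`K = ℚ(√-d)`, and it has complex multiplication by `(d_K/·)`. -/
def IsCMEigenformOfWeightThree (d : ℕ) (f : ℍ → ℂ) : Prop :=
  ∃ χ : DirichletCharacter ℂ (fieldDisc d).natAbs,
    (∀ p : ℕ, p.Prime → χ (p : ZMod (fieldDisc d).natAbs) = (kroneckerAtPrime (fieldDisc d) p : ℂ)) ∧
    IsNormalizedHeckeEigenform 3 χ f ∧ HasCMBy χ f

end ToyLehmer

end

/-!
The argument has an analytic half, which shows that the theta series are cusp forms, and an
arithmetic half, which identifies the given combination with the theta series of a Hecke character.

*Cusp forms.* Let `Q` be a positive definite binary form of discriminant `-N` and let `z` be the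
linear form with `|z|² = A Q`. Poisson summation (`tsum_expi_qf`) with a linear exponential `e^{sz}`
as weight, differentiated twice in `s`, describes `∑ z² q^Q` near every rational point `b/c` by a
dual series weighted by Gauss sums modulo `c` (`thetaForm_add_div`). The term `z = 0` drops out, so
the series vanishes at all cusps. Let `γ ∈ Γ₀(N)`. By periodicity and Dirichlet's theorem on primes
in progressions, its lower right entry may be taken to be an odd prime `p`; then completing the
square leaves the Gauss sum of `Q` modulo `p`, which is `(-N/p) p` (`sum_stdAddChar_qf`). So the
series lies in `S₃(Γ₀(N), χ)` for the Kronecker character `χ` of discriminant `-N`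
(`isCuspFormWithCharacter_thetaH`).

*Eigenforms.* The units of `K` are `±1`, as `d ≠ 1, 3`. Hence `ψ((x)) = x²` is well defined; if
there is a nonprincipal class, represented by `𝔞` with `𝔞² = (β)`, the choice `ψ(𝔞) = β` extends
`ψ` to all ideals multiplicatively (`heckeChar_mul`). For an ideal `𝔟`, the numbers `∑ γ²` over the
elements `γ ∈ 𝔟` of given norm count each ideal in the class of `𝔟⁻¹` twice (`sum_sq_eq`), so that
`½ Θ_𝔬 + (1/2β) Θ_𝔞` has the coefficients `a(n) = ∑_{N I = n} ψ(I)`, where the theta series are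
weighted by `z²`. The decomposition of primes in `K` (`decomposition`) gives
`a(pm) + χ(p) p² a(m/p) = a(p) a(m)` (`normSum_hecke`), which makes the form an eigenvector of all
`T_n` (`isNormalizedHeckeEigenform_of_hasSum`), and `a(p) = 0` for inert `p`, which is complex
multiplication.

*Real weights.* The lattice sums carry the weight `x² - y² = Re z²` in place of `z²`. If the class
number is two, the reduced form `(a, b, c)` with `a ≠ 1` is ambiguous, with `a = c` or `a ∣ b`
(`ambiguous_of_sq_principal`). In either case a symmetry of the form realizes complex conjugation up
to a factor, so that the sum over `Re z²` is a multiple of the sum over `z²` (`tsum_re_of_eq`,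
`tsum_re_of_dvd`). If `a ∣ b`, then `𝔞² = (a)`, and the coefficient becomes `1/2`. If `a = c`, then
`𝔞² = (ω)` for `ω = (b + √D)/2`, and it becomes `a/b`.
-/

namespace ToyLehmer

open scoped Real Manifold
open Filter Topology NumberField

/-! ### The additive character `x ↦ exp (2πix)` and binary quadratic forms -/

/-- The function `x ↦ e^{2πix}` on `ℂ`. -/
noncomputable def expi (x : ℂ) : ℂ := Complex.exp (2 * π * Complex.I * x)

lemma expi_add (x y : ℂ) : expi (x + y) = expi x * expi y := by
  simp [expi, mul_add, Complex.exp_add]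

@[simp] lemma expi_intCast (n : ℤ) : expi n = 1 := by
  rw [expi, mul_comm]
  exact Complex.exp_int_mul_two_pi_mul_I n

lemma expi_add_intCast (x : ℂ) (n : ℤ) : expi (x + n) = expi x := by
  rw [expi_add, expi_intCast, mul_one]

lemma expi_nat_mul (n : ℕ) (x : ℂ) : expi (n * x) = expi x ^ n := by
  rw [expi, expi, ← Complex.exp_nat_mul]; ring_nf

lemma norm_expi (x : ℂ) : ‖expi x‖ = Real.exp (-2 * π * x.im) := by
  rw [expi, Complex.norm_exp]
  congr 1
  simp

lemma norm_expi_ofReal (x : ℝ) : ‖expi x‖ = 1 := by simp [norm_expi]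

/-- The binary quadratic form `A m² + B m n + C n²`. -/
def qf (A B C : ℤ) (v : ℤ × ℤ) : ℤ := A * v.1 ^ 2 + B * v.1 * v.2 + C * v.2 ^ 2

/-- A positive definite binary form is bounded below by its determinant over its trace. -/
lemma qf_lower_bound {A B C : ℤ} (hA : 0 < A) (hD : B ^ 2 - 4 * A * C < 0) :
    ∃ δ : ℝ, 0 < δ ∧ ∀ v : ℤ × ℤ, δ * ((v.1 : ℝ) ^ 2 + (v.2 : ℝ) ^ 2) ≤ qf A B C v := by
  have hA' : (0 : ℝ) < A := by exact_mod_cast hA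
  have hD' : (B : ℝ) ^ 2 - 4 * A * C < 0 := by exact_mod_cast hD
  have hC : (0 : ℝ) < C := by
    by_contra h
    push Not at h
    nlinarith [sq_nonneg (B : ℝ), mul_nonneg hA'.le (neg_nonneg.2 h)]
  refine ⟨(4 * A * C - B ^ 2) / (4 * (A + C)), by apply div_pos <;> linarith, fun v => ?_⟩
  rw [div_mul_eq_mul_div, div_le_iff₀ (by linarith)]
  simp only [qf]
  push_cast
  nlinarith [sq_nonneg (2 * A * (v.1 : ℝ) + B * v.2), sq_nonneg (2 * C * (v.2 : ℝ) + B * v.1)]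

lemma qf_nonneg {A B C : ℤ} (hA : 0 < A) (hD : B ^ 2 - 4 * A * C < 0) (v : ℤ × ℤ) :
    0 ≤ qf A B C v := by
  obtain ⟨δ, hδ, h⟩ := qf_lower_bound hA hD
  have := h v
  have h2 : (0 : ℝ) ≤ qf A B C v := le_trans (by positivity) this
  exact_mod_cast h2

lemma qf_pos {A B C : ℤ} (hA : 0 < A) (hD : B ^ 2 - 4 * A * C < 0) {v : ℤ × ℤ} (hv : v ≠ 0) :
    0 < qf A B C v := by
  obtain ⟨δ, hδ, h⟩ := qf_lower_bound hA hD
  have h1 := h v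
  have h3 : (0 : ℝ) < (v.1 : ℝ) ^ 2 + (v.2 : ℝ) ^ 2 := by
    rcases eq_or_ne v.1 0 with h1 | h1
    · have h2 : v.2 ≠ 0 := fun h2 => hv (Prod.ext h1 h2)
      have : (v.2 : ℝ) ≠ 0 := by exact_mod_cast h2
      positivity
    · have : (v.1 : ℝ) ≠ 0 := by exact_mod_cast h1
      positivity
  have h2 : (0 : ℝ) < qf A B C v := lt_of_lt_of_le (by positivity) h1
  exact_mod_cast h2

/-! ### Summability of Gaussian sums over `ℤ²` -/

lemma summable_gaussian {ε : ℝ} (hε : 0 < ε) (L : ℝ) :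
    Summable fun v : ℤ × ℤ =>
      Real.exp (-ε * ((v.1 : ℝ) ^ 2 + (v.2 : ℝ) ^ 2) + L * (|(v.1 : ℝ)| + |(v.2 : ℝ)|)) := by
  have h1 : Summable fun n : ℤ => Real.exp (-ε * (n : ℝ) ^ 2 + L * |(n : ℝ)|) := by
    have := summable_pow_mul_jacobiTheta₂_term_bound (L / (2 * π)) (T := ε / π) (by positivity) 0
    refine this.congr fun n => ?_
    simp only [pow_zero, one_mul]
    congr 1
    push_cast
    field_simp
    ring
  have h2 := Summable.mul_of_nonneg h1 h1 (fun _ => (Real.exp_pos _).le)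
    (fun _ => (Real.exp_pos _).le)
  refine h2.congr fun v => ?_
  rw [← Real.exp_add]
  ring_nf

/-- Gaussian sums converge absolutely even with an additional exponential weight, which leaves room
for differentiation in a parameter. -/
lemma summable_expi_qf {A B C : ℤ} (hA : 0 < A) (hD : B ^ 2 - 4 * A * C < 0) {t : ℂ}
    (ht : 0 < t.im) (x₁ x₂ : ℂ) (R : ℝ) :
    Summable fun v : ℤ × ℤ => ‖expi (qf A B C v * t + v.1 * x₁ + v.2 * x₂)‖ *
      Real.exp (R * (|(v.1 : ℝ)| + |(v.2 : ℝ)|)) := by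
  obtain ⟨δ, hδ, h⟩ := qf_lower_bound hA hD
  refine Summable.of_nonneg_of_le (fun v => by positivity) (fun v => ?_)
    (summable_gaussian (ε := 2 * π * t.im * δ) (by positivity)
      (R + 2 * π * (|x₁.im| + |x₂.im|)))
  rw [norm_expi, ← Real.exp_add]
  apply Real.exp_le_exp.2
  have h1 := mul_le_mul_of_nonneg_left (h v) (show 0 ≤ 2 * π * t.im by positivity)
  have e : (qf A B C v * t + v.1 * x₁ + v.2 * x₂).im
      = qf A B C v * t.im + v.1 * x₁.im + v.2 * x₂.im := by
    simp
  rw [e]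
  have a1 : -(v.1 * x₁.im) ≤ |(v.1 : ℝ)| * |x₁.im| := by
    rw [← abs_mul]; exact neg_le_abs _
  have a2 : -(v.2 * x₂.im) ≤ |(v.2 : ℝ)| * |x₂.im| := by
    rw [← abs_mul]; exact neg_le_abs _
  have b1 : 0 ≤ |(v.1 : ℝ)| * |x₂.im| := by positivity
  have b2 : 0 ≤ |(v.2 : ℝ)| * |x₁.im| := by positivity
  have hp := Real.pi_pos
  have c : 0 ≤ 2 * π * ((|(v.1 : ℝ)| + |(v.2 : ℝ)|) * (|x₁.im| + |x₂.im|)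
      + v.1 * x₁.im + v.2 * x₂.im) := by
    apply mul_nonneg (by positivity)
    nlinarith
  nlinarith

lemma summable_expi_qf' {A B C : ℤ} (hA : 0 < A) (hD : B ^ 2 - 4 * A * C < 0) {t : ℂ}
    (ht : 0 < t.im) (x₁ x₂ : ℂ) :
    Summable fun v : ℤ × ℤ => expi (qf A B C v * t + v.1 * x₁ + v.2 * x₂) := by
  have := summable_expi_qf hA hD ht x₁ x₂ 0
  simp only [zero_mul, Real.exp_zero, mul_one] at this
  exact this.of_norm

/-! ### Poisson summation for binary Gaussians -/

lemma neg_inv_im_pos {τ : ℂ} (hτ : 0 < τ.im) : 0 < (-1 / τ).im := by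
  have h0 : τ ≠ 0 := by rintro rfl; simp at hτ
  rw [neg_div, one_div, Complex.neg_im, Complex.inv_im]
  have := Complex.normSq_pos.2 h0
  rw [neg_div, neg_neg]
  positivity

lemma jacobiTheta₂_term_eq_expi (n : ℤ) (z τ : ℂ) :
    jacobiTheta₂_term n z τ = expi (n * z + n ^ 2 * τ / 2) := by
  rw [jacobiTheta₂_term, expi]; ring_nf

/-- Poisson summation in one variable, as the functional equation of the Jacobi theta function with
the exponential factors moved into the series. -/
lemma hasSum_gaussian_one (ζ : ℂ) {τ : ℂ} (hτ : 0 < τ.im) :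
    HasSum (fun k : ℤ => expi (-(k - ζ) ^ 2 / (2 * τ)))
      ((-Complex.I * τ) ^ (1 / 2 : ℂ) * jacobiTheta₂ ζ τ) := by
  have h0 : τ ≠ 0 := by rintro rfl; simp at hτ
  have hs := (hasSum_jacobiTheta₂_term (ζ / τ) (neg_inv_im_pos hτ)).mul_left
    (Complex.exp (-π * Complex.I * ζ ^ 2 / τ))
  have hc : (-Complex.I * τ) ^ (1 / 2 : ℂ) ≠ 0 := by
    rw [Complex.cpow_ne_zero_iff]; left
    simp [h0]
  have e : (-Complex.I * τ) ^ (1 / 2 : ℂ) * jacobiTheta₂ ζ τ =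
      Complex.exp (-π * Complex.I * ζ ^ 2 / τ) * jacobiTheta₂ (ζ / τ) (-1 / τ) := by
    rw [jacobiTheta₂_functional_equation ζ τ]
    field_simp
  rw [e]
  refine hs.congr_fun fun k => ?_
  rw [jacobiTheta₂_term, expi, ← Complex.exp_add]
  congr 1
  field_simp
  ring

/-- A positive factor may be pulled out of the principal branch of the square root. -/
lemma ofReal_mul_cpow_half {r : ℝ} (hr : 0 < r) {x : ℂ} (hx : x ≠ 0) :
    ((r : ℂ) * x) ^ (1 / 2 : ℂ) = √r * x ^ (1 / 2 : ℂ) := by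
  rw [Complex.cpow_def_of_ne_zero (by simp [hr.ne', hx]), Complex.cpow_def_of_ne_zero hx,
    Complex.log_ofReal_mul hr hx, add_mul, Complex.exp_add, Real.sqrt_eq_rpow,
    Complex.ofReal_cpow hr.le, Complex.cpow_def_of_ne_zero (by simp [hr.ne']),
    Complex.ofReal_log hr.le]
  push_cast
  rfl

/-- Poisson summation in two variables, obtained by applying the functional equation of the
Jacobi theta function in each variable in turn. -/
theorem tsum_expi_qf {A B C : ℤ} (hA : 0 < A) (hD : B ^ 2 - 4 * A * C < 0) {τ : ℂ}
    (hτ : 0 < τ.im) (ζ₁ ζ₂ : ℂ) :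
    ∑' v : ℤ × ℤ, expi (qf A B C v * τ + v.1 * ζ₁ + v.2 * ζ₂) =
      Complex.I / (√(4 * A * C - B ^ 2 : ℝ) * τ) *
        ∑' w : ℤ × ℤ, expi (-(C * (w.1 - ζ₁) ^ 2 - B * (w.1 - ζ₁) * (w.2 - ζ₂)
          + A * (w.2 - ζ₂) ^ 2) / ((4 * A * C - B ^ 2) * τ)) := by
  have h0 : τ ≠ 0 := by rintro rfl; simp at hτ
  have hA' : (0 : ℝ) < A := by exact_mod_cast hA
  have hA0 : (A : ℂ) ≠ 0 := by exact_mod_cast hA.ne'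
  have hΔ : (0 : ℝ) < 4 * A * C - B ^ 2 := by
    have : (B : ℝ) ^ 2 - 4 * A * C < 0 := by exact_mod_cast hD
    linarith
  have hΔ0 : (4 * A * C - B ^ 2 : ℂ) ≠ 0 := by exact_mod_cast hΔ.ne'
  set τ₁ : ℂ := 2 * A * τ with hτ₁
  set τ₂ : ℂ := (4 * A * C - B ^ 2) / (2 * A) * τ with hτ₂
  have t₁ : τ₁ = ((2 * A : ℝ) : ℂ) * τ := by rw [hτ₁]; push_cast; ring
  have t₂ : τ₂ = (((4 * A * C - B ^ 2) / (2 * A) : ℝ) : ℂ) * τ := by rw [hτ₂]; push_cast; ring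
  have i₁ : 0 < τ₁.im := by rw [t₁, Complex.im_ofReal_mul]; positivity
  have i₂ : 0 < τ₂.im := by rw [t₂, Complex.im_ofReal_mul]; positivity
  have n₁ : τ₁ ≠ 0 := by rintro h; simp [h] at i₁
  have n₂ : τ₂ ≠ 0 := by rintro h; simp [h] at i₂
  set r₁ : ℂ := (-Complex.I * τ₁) ^ (1 / 2 : ℂ) with hr₁
  set r₂ : ℂ := (-Complex.I * τ₂) ^ (1 / 2 : ℂ) with hr₂
  have hx : -Complex.I * τ ≠ 0 := by simp [h0]
  have hr : r₁ * r₂ = √(4 * A * C - B ^ 2 : ℝ) * (-Complex.I * τ) := by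
    have e1 : -Complex.I * τ₁ = ((2 * A : ℝ) : ℂ) * (-Complex.I * τ) := by rw [t₁]; ring
    have e2 : -Complex.I * τ₂ = (((4 * A * C - B ^ 2) / (2 * A) : ℝ) : ℂ) * (-Complex.I * τ) := by
      rw [t₂]; ring
    rw [hr₁, hr₂, e1, e2, ofReal_mul_cpow_half (by positivity) hx,
      ofReal_mul_cpow_half (by positivity) hx]
    have e3 : (-Complex.I * τ) ^ (1 / 2 : ℂ) * (-Complex.I * τ) ^ (1 / 2 : ℂ) = -Complex.I * τ := by
      rw [← Complex.cpow_add _ _ hx]; norm_num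
    have e4 : √(4 * A * C - B ^ 2 : ℝ) = √(2 * A : ℝ) * √((4 * A * C - B ^ 2) / (2 * A) : ℝ) := by
      rw [← Real.sqrt_mul (by positivity)]
      congr 1
      field_simp
    rw [e4]
    push_cast
    linear_combination (√(2 * A : ℝ) * √((4 * A * C - B ^ 2) / (2 * A) : ℝ) : ℂ) * e3
  have hr0 : r₁ * r₂ ≠ 0 := by
    rw [hr]
    exact mul_ne_zero (by exact_mod_cast (Real.sqrt_pos.2 hΔ).ne') hx
  have hr₁0 := left_ne_zero_of_mul hr0
  have hr₂0 := right_ne_zero_of_mul hr0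
  set G : ℤ → ℤ → ℂ := fun n k =>
    expi (-(k - (B * n * τ + ζ₁)) ^ 2 / (2 * τ₁)) * expi (C * n ^ 2 * τ + n * ζ₂) with hG
  set H : ℤ → ℤ → ℂ := fun k l =>
    expi (-(k - ζ₁) ^ 2 / (2 * τ₁)) *
      expi (-(l - (ζ₂ + (k - ζ₁) * B / (2 * A))) ^ 2 / (2 * τ₂)) with hH
  -- the inner sum over the first variable
  have s1 (n : ℤ) : ∑' m : ℤ, expi (qf A B C (m, n) * τ + m * ζ₁ + n * ζ₂) =
      r₁⁻¹ * ∑' k : ℤ, G n k := by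
    rw [hG]
    simp only
    rw [tsum_mul_right, (hasSum_gaussian_one (B * n * τ + ζ₁) i₁).tsum_eq, ← hr₁, mul_assoc,
      inv_mul_cancel_left₀ hr₁0, jacobiTheta₂, ← tsum_mul_right]
    refine tsum_congr fun m => ?_
    rw [jacobiTheta₂_term_eq_expi, ← expi_add, hτ₁, qf]
    congr 1
    push_cast
    ring
  -- the same terms, arranged as a theta series in the second variable
  have g2 (n k : ℤ) : G n k = expi (-(k - ζ₁) ^ 2 / (2 * τ₁)) *
      jacobiTheta₂_term n (ζ₂ + (k - ζ₁) * B / (2 * A)) τ₂ := by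
    rw [hG, jacobiTheta₂_term_eq_expi]
    simp only
    rw [← expi_add, ← expi_add]
    congr 1
    rw [hτ₁, hτ₂]
    field_simp
    ring
  -- in absolute value the mixed factor disappears, so the double series converges absolutely
  have g3 (n k : ℤ) : ‖G n k‖ = ‖jacobiTheta₂_term n (ζ₂ - ζ₁ * B / (2 * A)) τ₂‖ *
      ‖expi (-(k - ζ₁) ^ 2 / (2 * τ₁))‖ := by
    have : G n k = jacobiTheta₂_term n (ζ₂ - ζ₁ * B / (2 * A)) τ₂ *
        expi (-(k - ζ₁) ^ 2 / (2 * τ₁)) * expi ((n * k * B / (2 * A) : ℝ)) := by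
      rw [g2, jacobiTheta₂_term_eq_expi, jacobiTheta₂_term_eq_expi, ← expi_add, ← expi_add,
        ← expi_add]
      congr 1
      push_cast
      ring
    rw [this, norm_mul, norm_mul, norm_expi_ofReal, mul_one]
  have sG : Summable (Function.uncurry G) := by
    apply Summable.of_norm
    refine ((((summable_jacobiTheta₂_term_iff (ζ₂ - ζ₁ * B / (2 * A)) _).2 i₂).norm).mul_of_nonneg
      (hasSum_gaussian_one ζ₁ i₁).summable.norm (fun _ => norm_nonneg _)
      (fun _ => norm_nonneg _)).congr fun v => ?_
    exact (g3 _ _).symm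
  have s2 (k : ℤ) : ∑' n : ℤ, G n k = r₂⁻¹ * ∑' l : ℤ, H k l := by
    rw [hH]
    simp only [g2]
    rw [tsum_mul_left, tsum_mul_left, (hasSum_gaussian_one _ i₂).tsum_eq, ← hr₂, jacobiTheta₂]
    field_simp
  have hHeq (k l : ℤ) : H k l = expi (-(C * (k - ζ₁) ^ 2 - B * (k - ζ₁) * (l - ζ₂)
          + A * (l - ζ₂) ^ 2) / ((4 * A * C - B ^ 2) * τ)) := by
    rw [hH]
    simp only
    rw [← expi_add]
    congr 1
    rw [hτ₁, hτ₂]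
    generalize hE : (4 * A * C - B ^ 2 : ℂ) = E at hΔ0
    have hC : (C : ℂ) = (E + B ^ 2) / (4 * A) := by
      rw [← hE]
      field_simp
      ring
    rw [hC]
    field_simp
    ring
  have sH : Summable (Function.uncurry H) := by
    have hC : 0 < C := by nlinarith [sq_nonneg B]
    have hi : 0 < (-1 / (((4 * A * C - B ^ 2 : ℝ) : ℂ) * τ)).im :=
      neg_inv_im_pos (by rw [Complex.im_ofReal_mul]; positivity)
    have := summable_expi_qf' (A := C) (B := -B) (C := A) hC (by nlinarith) hi
      ((2 * C * ζ₁ - B * ζ₂) / ((4 * A * C - B ^ 2) * τ))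
      ((2 * A * ζ₂ - B * ζ₁) / ((4 * A * C - B ^ 2) * τ))
    refine (this.mul_right (expi (-(C * ζ₁ ^ 2 - B * ζ₁ * ζ₂ + A * ζ₂ ^ 2) /
      ((4 * A * C - B ^ 2) * τ)))).congr fun v => ?_
    rw [Function.uncurry, hHeq, ← expi_add]
    congr 1
    simp only [qf]
    push_cast
    field_simp
    ring
  have sF := summable_expi_qf' hA hD hτ ζ₁ ζ₂
  calc _ = ∑' n : ℤ, ∑' m : ℤ, expi (qf A B C (m, n) * τ + m * ζ₁ + n * ζ₂) := by
        rw [← (Equiv.prodComm ℤ ℤ).tsum_eq]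
        exact ((Equiv.prodComm ℤ ℤ).summable_iff.2 sF).tsum_prod
    _ = r₁⁻¹ * ∑' n : ℤ, ∑' k : ℤ, G n k := by simp_rw [s1, tsum_mul_left]
    _ = r₁⁻¹ * ∑' k : ℤ, ∑' n : ℤ, G n k := by rw [sG.tsum_comm]
    _ = (r₁ * r₂)⁻¹ * ∑' k : ℤ, ∑' l : ℤ, H k l := by
        simp_rw [s2, tsum_mul_left]; rw [mul_inv, mul_assoc]
    _ = (r₁ * r₂)⁻¹ * ∑' w : ℤ × ℤ, H w.1 w.2 := by
        congr 1
        exact sH.tsum_prod.symm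
    _ = _ := by
        simp_rw [hHeq]
        congr 1
        rw [hr]
        have : (√(4 * A * C - B ^ 2 : ℝ) : ℂ) ≠ 0 := by exact_mod_cast (Real.sqrt_pos.2 hΔ).ne'
        field_simp
        simp

/-! ### Exponential generating sums -/

/-- A family of coefficients `a` with frequencies `α` is exponentially summable if
`∑ ‖a v‖ e^{R‖α v‖}` converges for every real `R`. -/
def ExpSummable {ι : Type*} (a α : ι → ℂ) : Prop :=
  ∀ R : ℝ, Summable fun v => ‖a v‖ * Real.exp (R * ‖α v‖)

/-- Exponential summability leaves room for powers of the frequencies, so that it is stable under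
differentiation of the generating sum. -/
lemma ExpSummable.mul_freq {ι : Type*} {a α : ι → ℂ} (h : ExpSummable a α) :
    ExpSummable (fun v => a v * α v) α := by
  intro R
  refine Summable.of_nonneg_of_le (fun v => by positivity) (fun v => ?_) (h (1 + R))
  rw [norm_mul, mul_assoc, add_mul, Real.exp_add, one_mul]
  gcongr
  exact (Real.add_one_le_exp _).trans' (by linarith)

lemma ExpSummable.summable {ι : Type*} {a α : ι → ℂ} (h : ExpSummable a α) : Summable a := by
  have := h 0
  simp only [zero_mul, Real.exp_zero, mul_one] at this
  exact this.of_norm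

lemma ExpSummable.hasDerivAt {ι : Type*} {a α : ι → ℂ} (h : ExpSummable a α) (s : ℂ) :
    HasDerivAt (fun s => ∑' v, a v * Complex.exp (s * α v))
      (∑' v, a v * α v * Complex.exp (s * α v)) s := by
  refine hasDerivAt_tsum_of_isPreconnected (t := Metric.ball (0 : ℂ) (‖s‖ + 1))
    (g := fun v s => a v * Complex.exp (s * α v))
    (g' := fun v s => a v * α v * Complex.exp (s * α v)) (y₀ := 0) (y := s)
    (h.mul_freq (‖s‖ + 1)) Metric.isOpen_ball
    (convex_ball (0 : ℂ) _).isPreconnected (fun v y _ => ?_) (fun v y hy => ?_) ?_ ?_ ?_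
  · have := (((hasDerivAt_id' y).mul_const (α v)).cexp.const_mul (a v)).congr_deriv
      (show _ = a v * α v * Complex.exp (y * α v) by ring)
    exact this
  · rw [norm_mul, Complex.norm_exp]
    gcongr
    refine (Complex.re_le_norm _).trans ?_
    rw [norm_mul]
    gcongr
    simpa using (Metric.mem_ball.1 hy).le
  · simp; positivity
  · simpa using h.summable
  · simp

/-- If two exponential generating sums agree identically, then so do their second moments. -/
lemma ExpSummable.tsum_mul_sq_eq {ι κ : Type*} {a α : ι → ℂ} {b β : κ → ℂ} (ha : ExpSummable a α)
    (hb : ExpSummable b β)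
    (h : ∀ s : ℂ, ∑' v, a v * Complex.exp (s * α v) = ∑' v, b v * Complex.exp (s * β v)) :
    ∑' v, a v * α v ^ 2 = ∑' v, b v * β v ^ 2 := by
  have h1 (s : ℂ) : ∑' v, a v * α v * Complex.exp (s * α v) =
      ∑' v, b v * β v * Complex.exp (s * β v) :=
    (ha.hasDerivAt s).unique (by simpa only [h] using hb.hasDerivAt s)
  have h2 := (ha.mul_freq.hasDerivAt 0).unique (by simpa only [h1] using hb.mul_freq.hasDerivAt 0)
  simpa [pow_two, mul_assoc] using h2

lemma ExpSummable.const_mul {ι : Type*} {a α : ι → ℂ} (h : ExpSummable a α) (k : ℂ) :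
    ExpSummable (fun v => k * a v) α := fun R => by
  simpa only [norm_mul, mul_assoc] using (h R).mul_left ‖k‖

lemma ExpSummable.freq_mul {ι : Type*} {a α : ι → ℂ} (h : ExpSummable a α) (k : ℂ) :
    ExpSummable a (fun v => k * α v) := fun R => by
  simpa only [norm_mul, mul_assoc] using h (R * ‖k‖)

lemma ExpSummable.comp_injective {ι κ : Type*} {a α : ι → ℂ} (h : ExpSummable a α) {f : κ → ι}
    (hf : Function.Injective f) : ExpSummable (a ∘ f) (α ∘ f) :=
  fun R => (h R).comp_injective hf

/-! ### Theta series of binary forms weighted by a square -/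

/-- The number `(B + i√N)/2` of the upper half-plane. -/
noncomputable def omega (B : ℤ) (N : ℕ) : ℂ := (B + Complex.I * √(N : ℝ)) / 2

/-- The embedding `(m, n) ↦ A m + n (B + i√N)/2` of `ℤ²` in `ℂ`; if `B² - 4AC = -N`, then
`A m² + B m n + C n²` is the square of its absolute value divided by `A`. -/
noncomputable def zf (A B : ℤ) (N : ℕ) (v : ℤ × ℤ) : ℂ := A * v.1 + omega B N * v.2

/-- The theta series `∑ z² q^Q` of the form `Q = A m² + B m n + C n²`, for `q = e^{2πiτ}` and
`z = A m + n (B + i√N)/2`. -/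
noncomputable def thetaForm (A B C : ℤ) (N : ℕ) (τ : ℂ) : ℂ :=
  ∑' v : ℤ × ℤ, zf A B N v ^ 2 * expi (qf A B C v * τ)

lemma sqrt_cast_sq (N : ℕ) : ((√(N : ℝ) : ℝ) : ℂ) ^ 2 = N := by
  rw [← Complex.ofReal_pow, Real.sq_sqrt (Nat.cast_nonneg N)]
  simp

lemma omega_sq {A B C : ℤ} {N : ℕ} (hN : B ^ 2 - 4 * A * C = -(N : ℤ)) :
    omega B N ^ 2 = B * omega B N - A * C := by
  have h : (B : ℂ) ^ 2 - 4 * A * C = -(N : ℂ) := by exact_mod_cast hN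
  rw [omega]
  linear_combination (1 / 4 : ℂ) * (Complex.I ^ 2 * sqrt_cast_sq N + N * Complex.I_sq) - h / 4

lemma norm_zf_sq {A B C : ℤ} {N : ℕ} (hN : B ^ 2 - 4 * A * C = -(N : ℤ)) (v : ℤ × ℤ) :
    ‖zf A B N v‖ ^ 2 = A * qf A B C v := by
  have h : (B : ℝ) ^ 2 - 4 * A * C = -(N : ℝ) := by exact_mod_cast hN
  have h1 : (zf A B N v).re = A * v.1 + B / 2 * v.2 := by
    simp [zf, omega]
  have h2 : (zf A B N v).im = √(N : ℝ) / 2 * v.2 := by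
    simp [zf, omega]
  rw [Complex.sq_norm, Complex.normSq_apply, h1, h2, qf]
  push_cast
  have h3 := Real.mul_self_sqrt (Nat.cast_nonneg (α := ℝ) N)
  linear_combination ((v.2 : ℝ) ^ 2 / 4) * h3 + ((v.2 : ℝ) ^ 2 / 4) * h

lemma norm_zf_le (A B : ℤ) (N : ℕ) (v : ℤ × ℤ) :
    ‖zf A B N v‖ ≤ (‖(A : ℂ)‖ + ‖omega B N‖) * (|(v.1 : ℝ)| + |(v.2 : ℝ)|) := by
  refine (norm_add_le _ _).trans ?_
  have h1 : ‖(v.1 : ℂ)‖ = |(v.1 : ℝ)| := Complex.norm_intCast _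
  have h2 : ‖(v.2 : ℂ)‖ = |(v.2 : ℝ)| := Complex.norm_intCast _
  rw [norm_mul, norm_mul, h1, h2]
  have := norm_nonneg (A : ℂ)
  have := norm_nonneg (omega B N)
  nlinarith [abs_nonneg (v.1 : ℝ), abs_nonneg (v.2 : ℝ)]

section

variable {A B C : ℤ} {N : ℕ}

lemma disc_neg [NeZero N] (hN : B ^ 2 - 4 * A * C = -(N : ℤ)) : B ^ 2 - 4 * A * C < 0 := by
  have := NeZero.pos N
  omega

lemma expSummable_expi_qf [NeZero N] (hA : 0 < A) (hN : B ^ 2 - 4 * A * C = -(N : ℤ)) {t : ℂ}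
    (ht : 0 < t.im) (x₁ x₂ : ℂ) :
    ExpSummable (fun v : ℤ × ℤ => expi (qf A B C v * t + v.1 * x₁ + v.2 * x₂)) (zf A B N) := by
  intro R
  refine Summable.of_nonneg_of_le (fun v => by positivity) (fun v => ?_)
    (summable_expi_qf hA (disc_neg hN) ht x₁ x₂ (|R| * (‖(A : ℂ)‖ + ‖omega B N‖)))
  refine mul_le_mul_of_nonneg_left (Real.exp_le_exp.2 ?_) (norm_nonneg _)
  rw [mul_assoc]
  exact (mul_le_mul_of_nonneg_right (le_abs_self R) (norm_nonneg _)).trans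
    (mul_le_mul_of_nonneg_left (norm_zf_le A B N v) (abs_nonneg R))

lemma expSummable_expi_qf' [NeZero N] (hA : 0 < A) (hN : B ^ 2 - 4 * A * C = -(N : ℤ)) {t : ℂ}
    (ht : 0 < t.im) :
    ExpSummable (fun v : ℤ × ℤ => expi (qf A B C v * t)) (zf A B N) := by
  simpa using expSummable_expi_qf hA hN ht 0 0

lemma ExpSummable.summable_sq {ι : Type*} {a α : ι → ℂ} (h : ExpSummable a α) :
    Summable fun v => α v ^ 2 * a v := by
  refine h.mul_freq.mul_freq.summable.congr fun v => ?_
  ring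

lemma summable_thetaForm [NeZero N] (hA : 0 < A) (hN : B ^ 2 - 4 * A * C = -(N : ℤ)) {t : ℂ}
    (ht : 0 < t.im) : Summable fun v : ℤ × ℤ => zf A B N v ^ 2 * expi (qf A B C v * t) :=
  (expSummable_expi_qf' hA hN ht).summable_sq

lemma exp_eq_expi (x : ℂ) : Complex.exp x = expi (x / (2 * π * Complex.I)) := by
  rw [expi]
  congr 1
  have := Complex.two_pi_I_ne_zero
  field_simp

/-- The identity between exponents behind `tsum_coset`. The vector `(A, (B + E)/2)` is isotropic
for the dual form, so the right-hand side is linear in `S`. -/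
lemma poisson_exponent {A B C E h₁ h₂ m n w c S : ℂ} (hA : A ≠ 0) (hE : E ≠ 0) (hw : w ≠ 0)
    (hc : c ≠ 0) (h : E ^ 2 = B ^ 2 - 4 * A * C) :
    (A * h₁ ^ 2 + B * h₁ * h₂ + C * h₂ ^ 2) * w + S * (A * h₁ + (B + E) / 2 * h₂) +
      -(C * (-n - (c * w * (2 * A * h₁ + B * h₂) + S * c * A)) ^ 2
        - B * (-n - (c * w * (2 * A * h₁ + B * h₂) + S * c * A)) *
          (m - (c * w * (B * h₁ + 2 * C * h₂) + S * c * ((B + E) / 2)))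
        + A * (m - (c * w * (B * h₁ + 2 * C * h₂) + S * c * ((B + E) / 2))) ^ 2) /
          (-E ^ 2 * (c ^ 2 * w)) =
    (h₂ * m - h₁ * n) / c - (A * m ^ 2 + B * m * n + C * n ^ 2) / (-E ^ 2 * (c ^ 2 * w))
      + S * (-E⁻¹ / (c * w) * (A * m + (B + E) / 2 * n)) := by
  have hC : C = (B ^ 2 - E ^ 2) / (4 * A) := by rw [h]; field_simp; ring
  subst hC
  field_simp
  ring

/-- Poisson summation for the theta series of a coset of `c ℤ²`. The weight `z²` is produced by two
derivatives at `s = 0` of the sum with the factor `e^{sz}`, for which Poisson summation only shifts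
the arguments; the frequency of the dual term `μ` is `z(μ)` times a constant. -/
theorem tsum_coset [NeZero N] (hA : 0 < A) (hN : B ^ 2 - 4 * A * C = -(N : ℤ)) (h : ℤ × ℤ) {c : ℕ}
    (hc : c ≠ 0) {w : ℂ} (hw : 0 < w.im) :
    ∑' v : ℤ × ℤ, zf A B N (h.1 + c * v.1, h.2 + c * v.2) ^ 2 *
        expi (qf A B C (h.1 + c * v.1, h.2 + c * v.2) * w) =
      -Complex.I / (√(N : ℝ) * N * c ^ 4 * w ^ 3) *
        ∑' μ : ℤ × ℤ, zf A B N μ ^ 2 *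
          (expi ((h.2 * μ.1 - h.1 * μ.2) / c) * expi (-qf A B C μ / (N * c ^ 2 * w))) := by
  have hD := disc_neg hN
  have w0 : w ≠ 0 := by rintro rfl; simp at hw
  have hc0 : (c : ℂ) ≠ 0 := by exact_mod_cast hc
  have hNpos : (0 : ℝ) < N := by exact_mod_cast NeZero.pos N
  have hN0 : (N : ℂ) ≠ 0 := by exact_mod_cast hNpos.ne'
  have hs0 : (√(N : ℝ) : ℂ) ≠ 0 := by exact_mod_cast (Real.sqrt_pos.2 hNpos).ne'
  have hA0 : (A : ℂ) ≠ 0 := by exact_mod_cast hA.ne'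
  have hNR : (4 * A * C - B ^ 2 : ℝ) = N := by
    have : (B : ℝ) ^ 2 - 4 * A * C = -(N : ℝ) := by exact_mod_cast hN
    linarith
  have hNC : (4 * A * C - B ^ 2 : ℂ) = N := by exact_mod_cast hNR
  set E : ℂ := Complex.I * √(N : ℝ) with hE
  have hE0 : E ≠ 0 := mul_ne_zero Complex.I_ne_zero hs0
  have hE2 : E ^ 2 = -N := by rw [hE, mul_pow, Complex.I_sq, sqrt_cast_sq]; ring
  have hcw : 0 < ((c : ℂ) ^ 2 * w).im := by
    have : ((c : ℂ) ^ 2 * w) = ((c ^ 2 : ℝ) : ℂ) * w := by push_cast; ring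
    rw [this, Complex.im_ofReal_mul]
    have : (0 : ℝ) < c := by exact_mod_cast Nat.pos_of_ne_zero hc
    positivity
  have hdual : 0 < (-1 / (N * (c ^ 2 * w) : ℂ)).im := by
    apply neg_inv_im_pos
    have : (N * ((c : ℂ) ^ 2 * w)) = ((N : ℝ) : ℂ) * (c ^ 2 * w) := by push_cast; ring
    rw [this, Complex.im_ofReal_mul]
    positivity
  have hinj : Function.Injective fun v : ℤ × ℤ => (h.1 + c * v.1, h.2 + c * v.2) := by
    intro v v' hv
    have hc' : (c : ℤ) ≠ 0 := by exact_mod_cast hc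
    simp only [Prod.mk.injEq, add_right_inj, mul_eq_mul_left_iff, hc', or_false] at hv
    exact Prod.ext hv.1 hv.2
  have key := ExpSummable.tsum_mul_sq_eq
    ((expSummable_expi_qf' hA hN hw).comp_injective hinj)
    (((expSummable_expi_qf hA hN hdual (h.2 / c) (-h.1 / c)).const_mul
      (Complex.I / (√(N : ℝ) * (c ^ 2 * w)))).freq_mul (-E⁻¹ / (c * w))) ?_
  · -- the constant `-E⁻¹ / (c w)` of the dual frequencies enters squared
    simp only [Function.comp_def] at key
    calc _ = _ := tsum_congr fun v => mul_comm _ _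
      _ = _ := key
      _ = _ := by
        rw [← tsum_mul_left]
        refine tsum_congr fun μ => ?_
        rw [← expi_add]
        have e1 : (qf A B C μ * (-1 / (N * (c ^ 2 * w))) + μ.1 * (h.2 / c) + μ.2 * (-h.1 / c) : ℂ)
          = (h.2 * μ.1 - h.1 * μ.2) / c + -qf A B C μ / (N * c ^ 2 * w) := by
          field_simp
          ring
        rw [e1, mul_pow, div_pow, neg_sq, inv_pow, hE2]
        field_simp
  · intro s
    simp only [Function.comp_def]
    set S : ℂ := s / (2 * π * Complex.I) with hS
    have e2 (x : ℂ) : Complex.exp (s * x) = expi (S * x) := by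
      rw [exp_eq_expi, hS]; congr 1; ring
    simp only [e2]
    have lhs : ∑' v : ℤ × ℤ, expi (qf A B C (h.1 + c * v.1, h.2 + c * v.2) * w) *
          expi (S * zf A B N (h.1 + c * v.1, h.2 + c * v.2)) =
        expi (qf A B C h * w + S * zf A B N h) * ∑' v : ℤ × ℤ, expi (qf A B C v * (c ^ 2 * w) +
          v.1 * (c * w * (2 * A * h.1 + B * h.2) + S * c * A) +
          v.2 * (c * w * (B * h.1 + 2 * C * h.2) + S * c * ((B + E) / 2))) := by
      rw [← tsum_mul_left]
      refine tsum_congr fun v => ?_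
      rw [← expi_add, ← expi_add]
      congr 1
      simp only [qf, zf, omega, ← hE]
      push_cast
      ring
    rw [lhs, tsum_expi_qf hA hD hcw, hNR, hNC, ← tsum_mul_left, ← tsum_mul_left]
    -- a quarter turn brings the dual form `(C, -B, A)` back to `(A, B, C)`
    let σ : ℤ × ℤ ≃ ℤ × ℤ :=
      ⟨fun μ => (-μ.2, μ.1), fun v => (v.2, -v.1), fun μ => by simp, fun v => by simp⟩
    rw [← σ.tsum_eq]
    refine tsum_congr fun μ => ?_
    simp only [σ, Equiv.coe_fn_mk]
    refine (mul_left_comm (expi _) _ _).trans ?_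
    rw [← expi_add]
    refine Eq.trans ?_ (mul_assoc _ _ _).symm
    rw [← expi_add]
    congr 2
    have := poisson_exponent (A := A) (B := B) (C := C) (E := E) (h₁ := h.1) (h₂ := h.2)
      (m := μ.1) (n := μ.2) (w := w) (c := c) (S := S) hA0 hE0 w0 hc0
      (by rw [hE2, ← hNC]; ring)
    rw [hE2, neg_neg] at this
    simp only [qf, zf, omega, ← hE]
    push_cast
    rw [this]
    field_simp
    ring

/-- Integers correspond to pairs of a quotient and a residue modulo `c`. -/
def residueEquiv (c : ℕ) [NeZero c] : ZMod c × ℤ ≃ ℤ where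
  toFun p := p.1.val + c * p.2
  invFun x := (x, x / c)
  left_inv p := by
    have hc : (c : ℤ) ≠ 0 := by exact_mod_cast NeZero.ne c
    ext1
    · simp
    · simp only
      rw [Int.add_mul_ediv_left _ _ hc, Int.ediv_eq_zero_of_lt (by positivity)
        (by exact_mod_cast ZMod.val_lt p.1), zero_add]
  right_inv x := by
    simp only [ZMod.val_intCast]
    exact Int.emod_add_mul_ediv x c

lemma tsum_residues {f : ℤ × ℤ → ℂ} (hf : Summable f) (c : ℕ) [NeZero c] :
    ∑' x, f x = ∑ h : ZMod c × ZMod c,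
      ∑' v : ℤ × ℤ, f (h.1.val + c * v.1, h.2.val + c * v.2) := by
  let e : (ZMod c × ZMod c) × (ℤ × ℤ) ≃ ℤ × ℤ :=
    (Equiv.prodProdProdComm _ _ _ _).trans ((residueEquiv c).prodCongr (residueEquiv c))
  rw [← e.tsum_eq]
  exact (e.summable_iff.2 hf).tsum_prod.trans (tsum_fintype _)

/-- The exponential sum `∑ e((b Q(h) + h₂ m - h₁ n)/c)` over `h` modulo `c`. -/
noncomputable def quadSum (A B C b : ℤ) (c : ℕ) [NeZero c] (μ : ℤ × ℤ) : ℂ :=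
  ∑ h : ZMod c × ZMod c, ZMod.stdAddChar
    (b * (A * h.1 ^ 2 + B * h.1 * h.2 + C * h.2 ^ 2) + (h.2 * μ.1 - h.1 * μ.2) : ZMod c)

lemma stdAddChar_intCast (c : ℕ) [NeZero c] (n : ℤ) :
    ZMod.stdAddChar (n : ZMod c) = expi (n / c) := by
  rw [ZMod.stdAddChar_coe, expi]
  ring_nf

/-- The behaviour of the theta series near the rational point `b / c`: split the sum into residue
classes modulo `c`, on which `e(b Q / c)` is constant, and apply Poisson summation to each. -/
theorem thetaForm_add_div [NeZero N] (hA : 0 < A) (hN : B ^ 2 - 4 * A * C = -(N : ℤ)) (b : ℤ)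
    (c : ℕ) [NeZero c] {w : ℂ} (hw : 0 < w.im) :
    thetaForm A B C N (b / c + w) = -Complex.I / (√(N : ℝ) * N * c ^ 4 * w ^ 3) *
      ∑' μ : ℤ × ℤ, zf A B N μ ^ 2 * quadSum A B C b c μ *
        expi (-qf A B C μ / (N * c ^ 2 * w)) := by
  have hc : c ≠ 0 := NeZero.ne c
  have hc0 : (c : ℂ) ≠ 0 := by exact_mod_cast hc
  have him : ((b / c + w : ℂ)).im = w.im := by
    have : (b / c : ℂ) = ((b / c : ℝ) : ℂ) := by push_cast; ring
    rw [Complex.add_im, this, Complex.ofReal_im, zero_add]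
  have hdual : 0 < (-1 / (N * (c ^ 2 * w) : ℂ)).im := by
    apply neg_inv_im_pos
    have : (N * ((c : ℂ) ^ 2 * w)) = ((N * c ^ 2 : ℝ) : ℂ) * w := by push_cast; ring
    rw [this, Complex.im_ofReal_mul]
    have h1 : (0 : ℝ) < N := by exact_mod_cast NeZero.pos N
    have h2 : (0 : ℝ) < c := by exact_mod_cast NeZero.pos c
    positivity
  rw [thetaForm, tsum_residues (summable_thetaForm hA hN (him ▸ hw)) c]
  have h1 (h : ZMod c × ZMod c) : ∑' v : ℤ × ℤ,
      zf A B N ((h.1.val : ℤ) + c * v.1, (h.2.val : ℤ) + c * v.2) ^ 2 *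
        expi (qf A B C ((h.1.val : ℤ) + c * v.1, (h.2.val : ℤ) + c * v.2) * (b / c + w)) =
      -Complex.I / (√(N : ℝ) * N * c ^ 4 * w ^ 3) *
        ∑' μ : ℤ × ℤ, zf A B N μ ^ 2 * ZMod.stdAddChar
          (b * (A * h.1 ^ 2 + B * h.1 * h.2 + C * h.2 ^ 2) + (h.2 * μ.1 - h.1 * μ.2) : ZMod c) *
          expi (-qf A B C μ / (N * c ^ 2 * w)) := by
    have e1 (v : ℤ × ℤ) : expi (qf A B C ((h.1.val : ℤ) + c * v.1, (h.2.val : ℤ) + c * v.2)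
          * (b / c + w)) = expi ((b * qf A B C (h.1.val, h.2.val) : ℤ) / c) *
        expi (qf A B C ((h.1.val : ℤ) + c * v.1, (h.2.val : ℤ) + c * v.2) * w) := by
      rw [mul_add, expi_add]
      congr 1
      rw [← expi_add_intCast ((b * qf A B C (h.1.val, h.2.val) : ℤ) / c)
        (b * (2 * A * h.1.val * v.1 + B * h.1.val * v.2 + B * h.2.val * v.1
          + 2 * C * h.2.val * v.2 + c * qf A B C v))]
      congr 1
      simp only [qf]
      push_cast
      field_simp
      ring
    simp_rw [e1, mul_left_comm _ (expi ((b * qf A B C (h.1.val, h.2.val) : ℤ) / c))]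
    rw [tsum_mul_left, tsum_coset hA hN (h.1.val, h.2.val) hc hw, mul_left_comm, ← tsum_mul_left]
    congr 1
    refine tsum_congr fun μ => ?_
    have e2 : (b * (A * h.1 ^ 2 + B * h.1 * h.2 + C * h.2 ^ 2) + (h.2 * μ.1 - h.1 * μ.2) : ZMod c)
        = ((b * qf A B C (h.1.val, h.2.val) + (h.2.val * μ.1 - h.1.val * μ.2) : ℤ) : ZMod c) := by
      simp [qf]
    rw [e2, stdAddChar_intCast, Int.cast_add, add_div, expi_add]
    push_cast
    ring
  simp_rw [h1]
  rw [← Finset.mul_sum]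
  congr 1
  rw [← Summable.tsum_finsetSum]
  · refine tsum_congr fun μ => ?_
    rw [quadSum, Finset.mul_sum, Finset.sum_mul]
  · intro h _
    refine Summable.of_norm_bounded (summable_thetaForm hA hN hdual).norm fun μ => ?_
    rw [norm_mul, norm_mul, norm_mul, AddChar.norm_apply, mul_one]
    apply le_of_eq
    congr 3
    ring

/-! ### Quadratic Gauss sums -/

section GaussSum

variable {p : ℕ} [Fact p.Prime]

lemma ringChar_zmod_ne_two (hp : p ≠ 2) : ringChar (ZMod p) ≠ 2 := by
  rwa [ZMod.ringChar_zmod_n]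

/-- The quadratic character modulo `p`, with values in `ℂ`. -/
noncomputable def quadCharC (p : ℕ) [Fact p.Prime] : MulChar (ZMod p) ℂ :=
  (quadraticChar (ZMod p)).ringHomComp (Int.castRingHom ℂ)

lemma quadCharC_apply (x : ZMod p) : quadCharC p x = (quadraticChar (ZMod p) x : ℂ) := rfl

lemma quadCharC_mul_self {x : ZMod p} (hx : x ≠ 0) : quadCharC p x * quadCharC p x = 1 := by
  rw [quadCharC_apply, ← pow_two]
  exact_mod_cast quadraticChar_sq_one hx

lemma quadCharC_ne_one (hp : p ≠ 2) : quadCharC p ≠ 1 := by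
  obtain ⟨a, ha⟩ := quadraticChar_exists_neg_one' (ringChar_zmod_ne_two hp)
  intro h
  have h1 : quadCharC p a = 1 := by rw [h, MulChar.one_apply_coe]
  rw [quadCharC_apply, ha] at h1
  norm_num at h1

lemma quadCharC_isQuadratic : (quadCharC p).IsQuadratic :=
  (quadraticChar_isQuadratic (ZMod p)).comp _

/-- The quadratic exponential sum is a Gauss sum, as `t` has `1 + (t/p)` square roots modulo `p`. -/
lemma sum_stdAddChar_mul_sq (hp : p ≠ 2) {e : ZMod p} (he : e ≠ 0) :
    ∑ x : ZMod p, (ZMod.stdAddChar (e * x ^ 2) : ℂ) =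
      quadCharC p e * gaussSum (quadCharC p) ZMod.stdAddChar := by
  classical
  have h1 : ∑ x : ZMod p, (ZMod.stdAddChar (e * x ^ 2) : ℂ) =
      ∑ t : ZMod p, (quadCharC p t + 1) * ZMod.stdAddChar (e * t) := by
    rw [← Finset.sum_fiberwise (s := Finset.univ) (g := fun x : ZMod p => x ^ 2)]
    refine Finset.sum_congr rfl fun t _ => ?_
    have h2 : ∀ x ∈ Finset.univ.filter (fun x : ZMod p => x ^ 2 = t),
        (ZMod.stdAddChar (e * x ^ 2) : ℂ) = ZMod.stdAddChar (e * t) := by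
      intro x hx
      rw [(Finset.mem_filter.1 hx).2]
    rw [Finset.sum_congr rfl h2, Finset.sum_const, nsmul_eq_mul, quadCharC_apply]
    congr 1
    have h3 := quadraticChar_card_sqrts (ringChar_zmod_ne_two hp) t
    rw [Set.toFinset_ofPred] at h3
    exact_mod_cast h3
  have h4 : ∑ t : ZMod p, (ZMod.stdAddChar (e * t) : ℂ) = 0 := by
    refine (Equiv.sum_comp (Equiv.mulLeft₀ e he) fun t => (ZMod.stdAddChar t : ℂ)).trans ?_
    rw [AddChar.sum_eq_zero_iff_ne_zero]
    exact fun h0 => ZMod.isPrimitive_stdAddChar p one_ne_zero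
      ((AddChar.mulShift_one _).trans h0)
  rw [h1]
  simp_rw [add_mul, one_mul]
  rw [Finset.sum_add_distrib, h4, add_zero]
  have h5 := gaussSum_mulShift (quadCharC p) ZMod.stdAddChar (Units.mk0 e he)
  rw [Units.val_mk0] at h5
  rw [← h5, ← mul_assoc, quadCharC_mul_self he, one_mul, gaussSum]
  rfl

/-- The Gauss sum of a binary quadratic form of discriminant `D` modulo `p` is `(D/p) p`: completing
the square turns it into the product of two one-variable Gauss sums. -/
theorem sum_stdAddChar_qf (hp : p ≠ 2) {A B C b : ZMod p} (hA : A ≠ 0) (hb : b ≠ 0)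
    (hD : B ^ 2 - 4 * A * C ≠ 0) :
    ∑ h : ZMod p × ZMod p,
        (ZMod.stdAddChar (b * (A * h.1 ^ 2 + B * h.1 * h.2 + C * h.2 ^ 2)) : ℂ) =
      quadraticChar (ZMod p) (B ^ 2 - 4 * A * C) * p := by
  have h2 : (2 : ZMod p) ≠ 0 := Ring.two_ne_zero (ringChar_zmod_ne_two hp)
  set D := B ^ 2 - 4 * A * C with hDdef
  set e : ZMod p := b / (4 * A) with he
  have h4 : (4 : ZMod p) ≠ 0 := by
    have : (4 : ZMod p) = 2 * 2 := by norm_num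
    rw [this]; exact mul_ne_zero h2 h2
  have he0 : e ≠ 0 := div_ne_zero hb (mul_ne_zero h4 hA)
  have h2A : 2 * A ≠ 0 := mul_ne_zero h2 hA
  have step (y : ZMod p) : ∑ x : ZMod p,
      (ZMod.stdAddChar (b * (A * x ^ 2 + B * x * y + C * y ^ 2)) : ℂ) =
      (∑ x : ZMod p, (ZMod.stdAddChar (e * x ^ 2) : ℂ)) * ZMod.stdAddChar (-(e * D) * y ^ 2) := by
    rw [← ((Equiv.mulLeft₀ (2 * A) h2A).trans (Equiv.addRight (B * y))).sum_comp
      (fun x => (ZMod.stdAddChar (e * x ^ 2) : ℂ)), Finset.sum_mul]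
    refine Finset.sum_congr rfl fun x _ => ?_
    rw [← AddChar.map_add_eq_mul]
    congr 1
    simp only [Equiv.trans_apply, Equiv.mulLeft₀_apply, Equiv.coe_addRight]
    rw [he, hDdef]
    field_simp
    ring
  rw [Fintype.sum_prod_type_right]
  simp_rw [step]
  rw [← Finset.mul_sum, sum_stdAddChar_mul_sq hp he0,
    sum_stdAddChar_mul_sq hp (neg_ne_zero.2 (mul_ne_zero he0 hD))]
  have hsq : gaussSum (quadCharC p) ZMod.stdAddChar ^ 2 = quadCharC p (-1) * p := by
    refine (gaussSum_sq (quadCharC_ne_one hp) quadCharC_isQuadratic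
      (ZMod.isPrimitive_stdAddChar p)).trans ?_
    rw [ZMod.card]
    rfl
  have h5 : -(e * D) = (-1) * e * D := by ring
  have h6 : quadCharC p (-1) * quadCharC p (-1) = 1 := quadCharC_mul_self (by simp)
  rw [h5, map_mul, map_mul, ← quadCharC_apply]
  linear_combination (quadCharC p e * quadCharC p e * quadCharC p (-1) * quadCharC p D) * hsq +
    (quadCharC p (-1) * quadCharC p (-1) * quadCharC p D * p) * quadCharC_mul_self he0 +
    (quadCharC p D * p) * h6

end GaussSum

/-! ### The transformation law under `Γ₀(N)` -/

/-- Completing the square in `quadSum`: if `N c' b ≡ -1`, then the linear term is absorbed by a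
translation. -/
lemma quadSum_mul_expi (hN : B ^ 2 - 4 * A * C = -(N : ℤ)) {b c' : ℤ} {c : ℕ} [NeZero c]
    (hbc : ((b * (N * c') : ℤ) : ZMod c) = -1) (μ : ℤ × ℤ) :
    quadSum A B C b c μ * expi (-(c' * qf A B C μ) / c) = ∑ h : ZMod c × ZMod c,
      (ZMod.stdAddChar (b * (A * h.1 ^ 2 + B * h.1 * h.2 + C * h.2 ^ 2) : ZMod c) : ℂ) := by
  have h1 : expi (-(c' * qf A B C μ) / c) =
      ZMod.stdAddChar (((-(c' * qf A B C μ) : ℤ)) : ZMod c) := by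
    rw [stdAddChar_intCast]; push_cast; rfl
  have hNz : (B : ZMod c) ^ 2 - 4 * A * C = -N := by
    have := congrArg (Int.cast : ℤ → ZMod c) hN
    push_cast at this
    exact this
  push_cast at hbc
  set k : ZMod c × ZMod c := (c' * (2 * C * μ.2 + B * μ.1), -(c' * (B * μ.2 + 2 * A * μ.1))) with hk
  rw [h1, quadSum, Finset.sum_mul]
  refine Eq.trans ?_ (Equiv.sum_comp (Equiv.addRight k) _)
  refine Finset.sum_congr rfl fun h _ => ?_
  rw [← AddChar.map_add_eq_mul]
  congr 1
  simp only [Equiv.coe_addRight, hk, Prod.fst_add, Prod.snd_add, qf]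
  push_cast
  linear_combination
    (-(h.1 * μ.2 - h.2 * μ.1) - c' * (A * μ.1 ^ 2 + B * μ.1 * μ.2 + C * μ.2 ^ 2)) * hbc
    + b * c' * ((h.1 * μ.2 - h.2 * μ.1) + c' * (A * μ.1 ^ 2 + B * μ.1 * μ.2 + C * μ.2 ^ 2)) * hNz

/-- The case `b / c = 0 / 1` of `thetaForm_add_div`, where the exponential sum is trivial. -/
lemma thetaForm_inversion [NeZero N] (hA : 0 < A) (hN : B ^ 2 - 4 * A * C = -(N : ℤ)) {τ : ℂ}
    (hτ : 0 < τ.im) :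
    thetaForm A B C N τ = -Complex.I / (√(N : ℝ) * N * τ ^ 3) *
      ∑' μ : ℤ × ℤ, zf A B N μ ^ 2 * expi (-qf A B C μ / (N * τ)) := by
  have := thetaForm_add_div hA hN 0 1 hτ
  have h1 (μ : ℤ × ℤ) : quadSum A B C 0 1 μ = 1 := by
    have : Subsingleton (ZMod 1) := inferInstanceAs (Subsingleton (Fin 1))
    rw [quadSum, Fintype.sum_subsingleton _ (0 : ZMod 1 × ZMod 1)]
    simp
  simpa [h1] using this

/-- The transformation law for a matrix of `Γ₀(N)` whose lower right entry is an odd prime `p`. The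
image of `τ` is expanded around `b / p` and `τ` around `0`; the two dual series agree up to the
Gauss sum modulo `p`. -/
theorem thetaForm_smul_prime [NeZero N] (hA : 0 < A) (hN : B ^ 2 - 4 * A * C = -(N : ℤ))
    {p : ℕ} [Fact p.Prime] (hp : p ≠ 2) (hpA : ¬ (p : ℤ) ∣ A) (hpN : ¬ p ∣ N) {a b c' : ℤ}
    (hdet : a * p - b * (N * c') = 1) {τ : ℂ} (hτ : 0 < τ.im) :
    thetaForm A B C N ((a * τ + b) / (N * c' * τ + p)) =
      quadraticChar (ZMod p) (-N : ZMod p) * (N * c' * τ + p) ^ 3 * thetaForm A B C N τ := by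
  have hp0 : (p : ℂ) ≠ 0 := by exact_mod_cast (Fact.out : p.Prime).ne_zero
  have hN0 : (N : ℂ) ≠ 0 := by exact_mod_cast NeZero.ne N
  have τ0 : τ ≠ 0 := by rintro rfl; simp at hτ
  have hdetC : (a * p - b * (N * c') : ℂ) = 1 := by exact_mod_cast hdet
  have hden : (N * c' * τ + p : ℂ) ≠ 0 := by
    intro h
    have him := congrArg Complex.im h
    have e : (N * c' : ℂ) = ((N * c' : ℝ) : ℂ) := by push_cast; ring
    rw [e, Complex.add_im, Complex.im_ofReal_mul, Complex.natCast_im, add_zero, Complex.zero_im,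
      mul_eq_zero] at him
    rcases him with him | him
    · rw [e, him] at h
      simp at h
      exact hp0 (by exact_mod_cast h)
    · exact hτ.ne' him
  set w : ℂ := τ / (p * (N * c' * τ + p)) with hw
  have hwim : 0 < w.im := by
    have e : w = -1 / (-1 / τ * p ^ 2 - p * N * c') := by
      rw [hw, div_eq_div_iff (mul_ne_zero hp0 hden)]
      · field_simp
        ring
      · have : (-1 / τ * p ^ 2 - p * N * c' : ℂ) = - p * (N * c' * τ + p) / τ := by
          field_simp
          ring
        rw [this]
        exact div_ne_zero (mul_ne_zero (neg_ne_zero.2 hp0) hden) τ0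
    rw [e]
    apply neg_inv_im_pos
    have e2 : (-1 / τ * p ^ 2 - p * N * c' : ℂ) = ((p ^ 2 : ℝ) : ℂ) * (-1 / τ) -
        ((p * N * c' : ℝ) : ℂ) := by push_cast; ring
    rw [e2, Complex.sub_im, Complex.im_ofReal_mul, Complex.ofReal_im, sub_zero]
    have : (0 : ℝ) < p := by exact_mod_cast (Fact.out : p.Prime).pos
    have := neg_inv_im_pos hτ
    positivity
  have hγ : (a * τ + b) / (N * c' * τ + p) = b / p + w := by
    rw [hw, div_add_div _ _ hp0 (mul_ne_zero hp0 hden),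
      div_eq_div_iff hden (mul_ne_zero hp0 (mul_ne_zero hp0 hden))]
    linear_combination (p * (N * c' * τ + p) * τ) * hdetC
  have hbc : ((b * (N * c') : ℤ) : ZMod p) = -1 := by
    have : (b * (N * c') : ℤ) = a * p - 1 := by linarith
    rw [this]
    simp
  have hb : (b : ZMod p) ≠ 0 := by
    intro h
    rw [Int.cast_mul, h, zero_mul] at hbc
    simp at hbc
  have hNz : (B : ZMod p) ^ 2 - 4 * A * C = -N := by
    have := congrArg (Int.cast : ℤ → ZMod p) hN
    push_cast at this
    exact this
  have hNz0 : (N : ZMod p) ≠ 0 := by rwa [Ne, ZMod.natCast_eq_zero_iff]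
  have hAz : (A : ZMod p) ≠ 0 := by rwa [Ne, ZMod.intCast_zmod_eq_zero_iff_dvd]
  rw [hγ, thetaForm_add_div hA hN b p hwim, thetaForm_inversion hA hN hτ]
  have e3 (μ : ℤ × ℤ) : zf A B N μ ^ 2 * quadSum A B C b p μ *
      expi (-qf A B C μ / (N * p ^ 2 * w)) = (quadraticChar (ZMod p) (-N : ZMod p) * p) *
        (zf A B N μ ^ 2 * expi (-qf A B C μ / (N * τ))) := by
    have e4 : (-qf A B C μ / (N * p ^ 2 * w) : ℂ) =
        -(c' * qf A B C μ) / p + -qf A B C μ / (N * τ) := by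
      rw [hw]
      field_simp
      ring
    rw [e4, expi_add, mul_assoc, ← mul_assoc (quadSum A B C b p μ), quadSum_mul_expi hN hbc,
      sum_stdAddChar_qf hp hAz hb (by rw [hNz]; exact neg_ne_zero.2 hNz0), hNz]
    ring
  simp_rw [e3]
  rw [tsum_mul_left, hw]
  field_simp

/-! ### Behaviour at the cusps and holomorphy -/

/-- Theta series with bounded coefficients tend to zero at `i∞`, because the weight `z²` vanishes at
the origin, the only vector on which the form is zero. -/
lemma tendsto_tsum_zf_atImInfty [NeZero N] (hA : 0 < A) (hN : B ^ 2 - 4 * A * C = -(N : ℤ))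
    {s : ℤ × ℤ → ℂ} {M : ℝ} (hs : ∀ μ, ‖s μ‖ ≤ M) {r : ℝ} (hr : 0 < r) (x : ℝ) :
    Tendsto (fun τ : ℍ => ∑' μ : ℤ × ℤ, zf A B N μ ^ 2 * s μ * expi (qf A B C μ * (r * τ + x)))
      atImInfty (𝓝 0) := by
  have him (τ : ℍ) (μ : ℤ × ℤ) : ‖expi (qf A B C μ * (r * τ + x))‖ =
      Real.exp (-(2 * π * qf A B C μ * r) * τ.im) := by
    have : (qf A B C μ * (r * τ + x) : ℂ) = ((qf A B C μ * r : ℝ) : ℂ) * τ +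
      ((qf A B C μ * x : ℝ) : ℂ) := by push_cast; ring
    rw [norm_expi, this, Complex.add_im, Complex.im_ofReal_mul, Complex.ofReal_im, coe_im]
    congr 1
    ring
  have hM : 0 ≤ M := (norm_nonneg _).trans (hs 0)
  have hsum : Summable fun μ : ℤ × ℤ =>
      M * ‖zf A B N μ ^ 2 * expi (qf A B C μ * (r * Complex.I))‖ :=
    (summable_thetaForm hA hN (t := r * Complex.I) (by simpa using hr)).norm.mul_left M
  rw [← tsum_zero (α := ℂ) (β := ℤ × ℤ)]
  refine tendsto_tsum_of_dominated_convergence hsum (fun μ => ?_) ?_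
  · rcases eq_or_ne μ 0 with rfl | hμ
    · simp [zf]
    · rw [tendsto_zero_iff_norm_tendsto_zero]
      simp_rw [norm_mul _ (expi _), him]
      rw [← mul_zero ‖zf A B N μ ^ 2 * s μ‖]
      refine Tendsto.const_mul _ (Real.tendsto_exp_atBot.comp ?_)
      refine Tendsto.const_mul_atTop_of_neg ?_ tendsto_comap
      have h1 : (0 : ℝ) < qf A B C μ := by exact_mod_cast qf_pos hA (disc_neg hN) hμ
      have : 0 < 2 * π * qf A B C μ * r := by positivity
      linarith
  · have : ∀ᶠ τ : ℍ in atImInfty, 1 ≤ τ.im :=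
      (eventually_ge_atTop (1 : ℝ)).comap UpperHalfPlane.im
    filter_upwards [this] with τ hτ μ
    have h0 : (0 : ℝ) ≤ qf A B C μ := by exact_mod_cast qf_nonneg hA (disc_neg hN) μ
    have h2 : ‖expi (qf A B C μ * (r * Complex.I))‖ = Real.exp (-(2 * π * qf A B C μ * r)) := by
      rw [norm_expi]
      congr 1
      simp
      ring
    rw [norm_mul, norm_mul, norm_mul, him, h2]
    have h3 : -(2 * π * qf A B C μ * r) * τ.im ≤ -(2 * π * qf A B C μ * r) := by
      have : 0 ≤ 2 * π * qf A B C μ * r := by positivity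
      nlinarith
    calc _ ≤ ‖zf A B N μ ^ 2‖ * M * Real.exp (-(2 * π * qf A B C μ * r)) := by
          gcongr
          exact hs μ
      _ = _ := by ring

lemma differentiableOn_thetaForm [NeZero N] (hA : 0 < A) (hN : B ^ 2 - 4 * A * C = -(N : ℤ)) :
    DifferentiableOn ℂ (thetaForm A B C N) {z | 0 < z.im} := by
  intro z hz
  have hz' : 0 < z.im / 2 := half_pos hz
  have hopen : IsOpen {u : ℂ | z.im / 2 < u.im} := isOpen_lt continuous_const Complex.continuous_im
  have hd : DifferentiableOn ℂ (thetaForm A B C N) {u : ℂ | z.im / 2 < u.im} := by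
    refine Complex.differentiableOn_tsum_of_summable_norm
      (summable_thetaForm hA hN (t := (z.im / 2 : ℝ) * Complex.I) (by simpa using hz')).norm
      (fun μ => ?_) hopen (fun μ u hu => ?_)
    · unfold expi
      fun_prop
    · rw [norm_mul, norm_mul, norm_expi, norm_expi]
      have h0 : (0 : ℝ) ≤ qf A B C μ := by exact_mod_cast qf_nonneg hA (disc_neg hN) μ
      have e (t : ℂ) : (qf A B C μ * t : ℂ).im = qf A B C μ * t.im := by simp
      rw [e, e]
      gcongr ?_ * Real.exp ?_
      simp only [Set.mem_ofPred_eq] at hu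
      have h4 : ((z.im / 2 : ℝ) * Complex.I : ℂ).im = z.im / 2 := by simp
      rw [h4]
      have : 0 ≤ 2 * π * qf A B C μ := by positivity
      nlinarith
  have hmem : z ∈ {u : ℂ | z.im / 2 < u.im} := by
    simp only [Set.mem_ofPred_eq]
    linarith [show 0 < z.im from hz]
  exact ((hd z hmem).differentiableAt (hopen.mem_nhds hmem)).differentiableWithinAt

/-! ### Theta series as cusp forms -/

/-- The theta series `thetaForm` as a function on the upper half-plane. -/
noncomputable def thetaH (A B C : ℤ) (N : ℕ) : ℍ → ℂ := fun τ => thetaForm A B C N τ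

lemma thetaForm_add_intCast (τ : ℂ) (n : ℤ) :
    thetaForm A B C N (τ + n) = thetaForm A B C N τ := by
  refine tsum_congr fun v => ?_
  rw [mul_add, ← Int.cast_mul, expi_add_intCast]

lemma SL_det (γ : SL(2, ℤ)) : γ 0 0 * γ 1 1 - γ 0 1 * γ 1 0 = 1 := by
  have := γ.det_coe
  rwa [Matrix.det_fin_two] at this

lemma thetaH_slash_apply (γ : SL(2, ℤ)) (τ : ℍ) : (thetaH A B C N ∣[(3 : ℤ)] γ) τ =
    thetaForm A B C N ((γ 0 0 * τ + γ 0 1) / (γ 1 0 * τ + γ 1 1)) *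
      (γ 1 0 * τ + γ 1 1 : ℂ) ^ (-3 : ℤ) := by
  rw [ModularForm.SL_slash_apply, thetaH, UpperHalfPlane.specialLinearGroup_apply]
  simp [UpperHalfPlane.denom]

lemma thetaH_slash_T_zpow (j : ℤ) : thetaH A B C N ∣[(3 : ℤ)] (ModularGroup.T ^ j) =
    thetaH A B C N := by
  ext τ
  rw [thetaH_slash_apply, ModularGroup.coe_T_zpow]
  simp [thetaH, thetaForm_add_intCast]

lemma SL_denom_ne_zero (γ : SL(2, ℤ)) (τ : ℍ) : (γ 1 0 * τ + γ 1 1 : ℂ) ≠ 0 := by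
  have := UpperHalfPlane.denom_ne_zero γ τ
  simpa [UpperHalfPlane.denom] using this

/-- Theta series of forms of discriminant `-N` transform under `Γ₀(N)` by the character
attached to `-N`. By periodicity and Dirichlet's theorem on primes in arithmetic progressions, the
lower right entry may be taken to be a large prime. -/
theorem thetaH_slash_Gamma0 [NeZero N] (hA : 0 < A) (hN : B ^ 2 - 4 * A * C = -(N : ℤ))
    {χ : DirichletCharacter ℂ N}
    (hχ : ∀ p : ℕ, p.Prime → p ≠ 2 → χ (p : ZMod N) = (jacobiSym (-N) p : ℂ)) (hχ1 : χ (-1) = -1)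
    {γ : SL(2, ℤ)} (hγ : γ ∈ CongruenceSubgroup.Gamma0 N) :
    thetaH A B C N ∣[(3 : ℤ)] γ = χ ((γ 1 1 : ℤ) : ZMod N) • thetaH A B C N := by
  have hdet := SL_det γ
  rcases eq_or_ne (γ 1 0) 0 with hc | hc
  · rw [hc, mul_zero, sub_zero] at hdet
    have hd : γ 1 1 = 1 ∨ γ 1 1 = -1 := Int.isUnit_iff.1 (IsUnit.of_mul_eq_one_right _ hdet)
    ext τ
    rw [thetaH_slash_apply, hc]
    rcases hd with hd | hd
    · have ha : γ 0 0 = 1 := by rw [hd] at hdet; linarith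
      simp [ha, hd, thetaH, thetaForm_add_intCast]
    · have ha : γ 0 0 = -1 := by rw [hd] at hdet; linarith
      have e : ((-1 : ℤ) * τ + γ 0 1 : ℂ) / ((0 : ℤ) * τ + (-1 : ℤ)) = τ + ((-γ 0 1 : ℤ) : ℂ) := by
        push_cast
        field_simp
        ring
      rw [ha, hd, e, thetaForm_add_intCast]
      push_cast
      rw [Pi.smul_apply, hχ1, smul_eq_mul, thetaH]
      norm_num
  · obtain ⟨c', hc'⟩ : (N : ℤ) ∣ γ 1 0 := by
      rw [CongruenceSubgroup.Gamma0_mem] at hγ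
      rwa [← ZMod.intCast_zmod_eq_zero_iff_dvd]
    have hcop : IsCoprime (γ 1 1) ((γ 1 0).natAbs : ℤ) := by
      have h : IsCoprime (γ 1 1) (γ 1 0) := ⟨γ 0 0, -γ 0 1, by linarith⟩
      rw [Int.natCast_natAbs]
      rcases abs_choice (γ 1 0) with h1 | h1 <;> rw [h1]
      · exact h
      · exact h.neg_right
    obtain ⟨p, hpgt, hpp, hpd⟩ := Nat.forall_exists_prime_gt_and_zmodEq (A.natAbs + N + 2)
      (Int.natAbs_ne_zero.2 hc) hcop
    have : Fact p.Prime := ⟨hpp⟩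
    obtain ⟨j, hj⟩ : γ 1 0 ∣ p - γ 1 1 := by
      have := hpd.symm.dvd
      rwa [Int.natCast_natAbs, abs_dvd] at this
    have hp2 : p ≠ 2 := by omega
    have hpA : ¬ (p : ℤ) ∣ A := by
      intro h
      have := Int.le_of_dvd hA h
      omega
    have hpN : ¬ p ∣ N := by
      intro h
      have := Nat.le_of_dvd (NeZero.pos N) h
      omega
    have hχp : χ ((γ 1 1 : ℤ) : ZMod N) = (quadraticChar (ZMod p) (-N : ZMod p) : ℂ) := by
      have h1 : ((γ 1 1 : ℤ) : ZMod N) = (p : ZMod N) := by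
        have h2 : (p : ℤ) = γ 1 1 + N * (c' * j) := by rw [hc'] at hj; linarith
        have h3 := congrArg (Int.cast : ℤ → ZMod N) h2
        push_cast at h3
        rw [h3]
        simp
      rw [h1, hχ p hpp hp2, ← jacobiSym.legendreSym.to_jacobiSym, legendreSym]
      push_cast
      rfl
    -- the lower right entry of `γ Tʲ` is `p`
    have key : thetaH A B C N ∣[(3 : ℤ)] (γ * ModularGroup.T ^ j) =
        χ ((γ 1 1 : ℤ) : ZMod N) • thetaH A B C N := by
      have g00 : (γ * ModularGroup.T ^ j) 0 0 = γ 0 0 := by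
        simp [Matrix.SpecialLinearGroup.coe_mul, ModularGroup.coe_T_zpow, Matrix.mul_apply]
      have g01 : (γ * ModularGroup.T ^ j) 0 1 = γ 0 0 * j + γ 0 1 := by
        simp [Matrix.SpecialLinearGroup.coe_mul, ModularGroup.coe_T_zpow, Matrix.mul_apply]
      have g10 : (γ * ModularGroup.T ^ j) 1 0 = N * c' := by
        rw [← hc']
        simp [Matrix.SpecialLinearGroup.coe_mul, ModularGroup.coe_T_zpow, Matrix.mul_apply]
      have g11 : (γ * ModularGroup.T ^ j) 1 1 = p := by
        have : (γ * ModularGroup.T ^ j) 1 1 = γ 1 0 * j + γ 1 1 := by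
          simp [Matrix.SpecialLinearGroup.coe_mul, ModularGroup.coe_T_zpow, Matrix.mul_apply]
        rw [this]
        linarith
      have hdet' := SL_det (γ * ModularGroup.T ^ j)
      ext τ
      have hden := SL_denom_ne_zero (γ * ModularGroup.T ^ j) τ
      rw [thetaH_slash_apply]
      rw [g10, g11] at hden hdet' ⊢
      have := thetaForm_smul_prime (C := C) hA hN hp2 hpA hpN hdet' τ.im_pos
      push_cast at hden ⊢
      rw [this, Pi.smul_apply, hχp, smul_eq_mul, thetaH, zpow_neg]
      field_simp
    have h4 : γ = γ * ModularGroup.T ^ j * ModularGroup.T ^ (-j) := by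
      rw [mul_assoc, ← zpow_add]; simp
    rw [h4, SlashAction.slash_mul, key, ModularForm.SL_smul_slash, thetaH_slash_T_zpow, ← h4]

lemma quadSum_norm_le (A B C b : ℤ) (c : ℕ) [NeZero c] (μ : ℤ × ℤ) :
    ‖quadSum A B C b c μ‖ ≤ Fintype.card (ZMod c × ZMod c) := by
  refine (norm_sum_le _ _).trans ?_
  simp [AddChar.norm_apply]

lemma isZeroAtImInfty_thetaH [NeZero N] (hA : 0 < A) (hN : B ^ 2 - 4 * A * C = -(N : ℤ)) :
    IsZeroAtImInfty (thetaH A B C N) := by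
  have := tendsto_tsum_zf_atImInfty hA hN (s := fun _ => 1) (M := 1) (by simp) one_pos 0
  refine this.congr fun τ => ?_
  simp [thetaH, thetaForm]

/-- At the cusp `γ(i∞) = a / c` with `c > 0`, the dual series of `thetaForm_add_div` is a theta
series with bounded coefficients in `(τ + d / c) / N`. -/
lemma isZeroAtImInfty_thetaH_slash_of_pos [NeZero N] (hA : 0 < A)
    (hN : B ^ 2 - 4 * A * C = -(N : ℤ)) {γ : SL(2, ℤ)} (hγ : 0 < γ 1 0) :
    IsZeroAtImInfty (thetaH A B C N ∣[(3 : ℤ)] γ) := by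
  obtain ⟨c, hc⟩ := Int.eq_ofNat_of_zero_le hγ.le
  have hcpos : 0 < c := by rw [hc] at hγ; exact_mod_cast hγ
  have : NeZero c := ⟨hcpos.ne'⟩
  have hc0 : (c : ℂ) ≠ 0 := by exact_mod_cast hcpos.ne'
  have hNpos : (0 : ℝ) < N := by exact_mod_cast NeZero.pos N
  have hN0 : (N : ℂ) ≠ 0 := by exact_mod_cast hNpos.ne'
  have hs0 : (√(N : ℝ) : ℂ) ≠ 0 := by exact_mod_cast (Real.sqrt_pos.2 hNpos).ne'
  have key := (tendsto_tsum_zf_atImInfty hA hN (quadSum_norm_le A B C (γ 0 0) c)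
    (r := 1 / N) (by positivity) (γ 1 1 / (N * c))).const_mul (Complex.I / (√(N : ℝ) * N * c))
  rw [mul_zero] at key
  refine key.congr fun τ => ?_
  have hden := SL_denom_ne_zero γ τ
  have hdet : (γ 0 0 * γ 1 1 - γ 0 1 * γ 1 0 : ℂ) = 1 := by exact_mod_cast SL_det γ
  rw [thetaH_slash_apply]
  rw [hc] at hden hdet ⊢
  push_cast at hden hdet ⊢
  set w : ℂ := -1 / (c * (c * τ + γ 1 1)) with hw
  have hwim : 0 < w.im := by
    apply neg_inv_im_pos
    have : (c * (c * τ + γ 1 1) : ℂ) = ((c ^ 2 : ℝ) : ℂ) * τ + ((c * γ 1 1 : ℝ) : ℂ) := by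
      push_cast; ring
    rw [this, Complex.add_im, Complex.im_ofReal_mul, Complex.ofReal_im, add_zero]
    have h1 : (0 : ℝ) < c := by exact_mod_cast hcpos
    have := τ.im_pos
    positivity
  have e1 : (γ 0 0 * τ + γ 0 1 : ℂ) / (c * τ + γ 1 1) = γ 0 0 / c + w := by
    rw [hw, div_add_div _ _ hc0 (mul_ne_zero hc0 hden),
      div_eq_div_iff hden (mul_ne_zero hc0 (mul_ne_zero hc0 hden))]
    linear_combination (-(c * (c * τ + γ 1 1) : ℂ)) * hdet
  rw [e1, thetaForm_add_div hA hN _ c hwim]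
  have e2 (μ : ℤ × ℤ) : (-qf A B C μ / (N * c ^ 2 * w) : ℂ) =
      qf A B C μ * (((1 / N : ℝ) : ℂ) * τ + ((γ 1 1 / (N * c) : ℝ) : ℂ)) := by
    rw [hw]
    push_cast
    field_simp
  simp_rw [e2]
  refine Eq.trans ?_ (mul_right_comm _ _ _)
  push_cast
  congr 1
  rw [hw, zpow_neg]
  field_simp

theorem isZeroAtImInfty_thetaH_slash [NeZero N] (hA : 0 < A)
    (hN : B ^ 2 - 4 * A * C = -(N : ℤ)) (γ : SL(2, ℤ)) :
    IsZeroAtImInfty (thetaH A B C N ∣[(3 : ℤ)] γ) := by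
  rcases lt_trichotomy (γ 1 0) 0 with h | h | h
  · -- the weight is odd, so `-γ` differs from `γ` by a sign
    have h1 := isZeroAtImInfty_thetaH_slash_of_pos hA hN (γ := -γ) (by simpa using h)
    have h2 := h1.neg
    refine h2.congr fun τ => ?_
    rw [Pi.neg_apply, thetaH_slash_apply, thetaH_slash_apply]
    have e1 : (((-γ) 1 0 : ℤ) * τ + ((-γ) 1 1 : ℤ) : ℂ) = -(γ 1 0 * τ + γ 1 1) := by
      simp; ring
    have e2 : (((-γ) 0 0 : ℤ) * τ + ((-γ) 0 1 : ℤ) : ℂ) = -(γ 0 0 * τ + γ 0 1) := by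
      simp; ring
    rw [e1, e2, neg_div_neg_eq, zpow_neg, zpow_neg, Odd.neg_zpow (by decide), inv_neg, mul_neg,
      neg_neg]
  · have hz := isZeroAtImInfty_thetaH hA hN
    have := hz.slash 3 (g := (γ : GL (Fin 2) ℝ)) (by simpa using h)
    exact this
  · exact isZeroAtImInfty_thetaH_slash_of_pos hA hN h

lemma mdifferentiable_thetaH [NeZero N] (hA : 0 < A) (hN : B ^ 2 - 4 * A * C = -(N : ℤ)) :
    MDiff (thetaH A B C N) := by
  rw [UpperHalfPlane.mdifferentiable_iff]
  refine (differentiableOn_thetaForm hA hN).congr fun z hz => ?_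
  simp only [Function.comp_apply, thetaH]
  rw [ofComplex_apply_of_im_pos hz]

/-- The theta series of a form of discriminant `-N` lies in `S₃(Γ₀(N), χ)`. -/
theorem isCuspFormWithCharacter_thetaH [NeZero N] (hA : 0 < A)
    (hN : B ^ 2 - 4 * A * C = -(N : ℤ)) {χ : DirichletCharacter ℂ N}
    (hχ : ∀ p : ℕ, p.Prime → p ≠ 2 → χ (p : ZMod N) = (jacobiSym (-N) p : ℂ)) (hχ1 : χ (-1) = -1) :
    IsCuspFormWithCharacter 3 χ (thetaH A B C N) := by
  refine ⟨⟨⟨⟨thetaH A B C N, ?_⟩, mdifferentiable_thetaH hA hN, ?_⟩, rfl⟩,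
    fun γ hγ => thetaH_slash_Gamma0 hA hN hχ hχ1 hγ⟩
  · rintro _ ⟨γ, hγ, rfl⟩
    have h := thetaH_slash_Gamma0 (C := C) hA hN hχ hχ1
      (CongruenceSubgroup.Gamma1_in_Gamma0 N hγ)
    have hd : ((γ 1 1 : ℤ) : ZMod N) = 1 := ((CongruenceSubgroup.Gamma1_mem N γ).1 hγ).2.1
    rw [hd, map_one, one_smul] at h
    exact h
  · intro c hc
    rw [OnePoint.isZeroAt_iff_forall_SL2Z
      ((Subgroup.IsArithmetic.isCusp_iff_isCusp_SL2Z _).1 hc)]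
    intro γ _
    exact isZeroAtImInfty_thetaH_slash hA hN γ

lemma IsCuspFormWithCharacter.add {k : ℤ} {χ : DirichletCharacter ℂ N} {f g : ℍ → ℂ}
    (hf : IsCuspFormWithCharacter k χ f) (hg : IsCuspFormWithCharacter k χ g) :
    IsCuspFormWithCharacter k χ (f + g) := by
  obtain ⟨⟨F, rfl⟩, hf⟩ := hf
  obtain ⟨⟨G, rfl⟩, hg⟩ := hg
  refine ⟨⟨F + G, rfl⟩, fun γ hγ => ?_⟩
  rw [SlashAction.add_slash, hf γ hγ, hg γ hγ, smul_add]

lemma IsCuspFormWithCharacter.const_smul {k : ℤ} {χ : DirichletCharacter ℂ N} {f : ℍ → ℂ}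
    (hf : IsCuspFormWithCharacter k χ f) (a : ℂ) :
    IsCuspFormWithCharacter k χ (a • f) := by
  obtain ⟨⟨F, rfl⟩, hf⟩ := hf
  refine ⟨⟨a • F, rfl⟩, fun γ hγ => ?_⟩
  rw [ModularForm.SL_smul_slash, hf γ hγ, smul_comm]

end

/-! ### The Kronecker character -/

open scoped NumberTheorySymbols in
/-- The product of an integer-valued character modulo `k` and the Jacobi symbol modulo `e`, as a
Dirichlet character modulo `k * e`. -/
lemma exists_dirichletCharacter_mul_jacobiSym {N k e : ℕ} [NeZero k] [NeZero e] (hN : N = k * e)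
    (ε : MulChar (ZMod k) ℤ) :
    ∃ χ : DirichletCharacter ℂ N, ∀ x : ℤ,
      χ (x : ZMod N) = ((ε (x : ZMod k) * J(x | e) : ℤ) : ℂ) := by
  have : NeZero N := ⟨by rw [hN]; exact mul_ne_zero (NeZero.ne k) (NeZero.ne e)⟩
  let f : ℤ → ℤ := fun x => ε (x : ZMod k) * J(x | e)
  have hper : ∀ x y : ℤ, (x : ZMod N) = y → f x = f y := by
    intro x y h
    rw [ZMod.intCast_eq_intCast_iff] at h
    have h1 : (x : ZMod k) = y := by
      rw [ZMod.intCast_eq_intCast_iff]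
      exact h.of_dvd (by rw [hN]; push_cast; exact dvd_mul_right _ _)
    have h2 : x ≡ y [ZMOD e] := h.of_dvd (by rw [hN]; push_cast; exact dvd_mul_left _ _)
    simp only [f]
    rw [h1, jacobiSym.mod_left' h2]
  have hval : ∀ z : ZMod N, ((z.val : ℤ) : ZMod N) = z := fun z => by simp
  have hmul : ∀ x y, f (x * y) = f x * f y := by
    intro x y
    simp only [f]
    rw [jacobiSym.mul_left]; push_cast; rw [map_mul]; ring
  refine ⟨{ toFun := fun z => (f (z.val : ℤ) : ℂ), map_one' := ?_, map_mul' := ?_,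
            map_nonunit' := ?_ }, fun x => ?_⟩
  · rw [hper (((1 : ZMod N).val : ℤ)) 1 (by rw [hval]; simp)]
    simp [f]
  · intro x y
    rw [hper (((x * y : ZMod N).val : ℤ)) ((x.val : ℤ) * (y.val : ℤ))
      (by rw [hval]; push_cast; simp), hmul]
    push_cast; rfl
  · intro z hz
    have hz' : ¬ Nat.Coprime z.val N := by
      rwa [← ZMod.isUnit_iff_coprime, ZMod.natCast_zmod_val]
    simp only [f]
    have hz'' : ¬ (Nat.Coprime z.val k ∧ Nat.Coprime z.val e) := fun h =>
      hz' ((congrArg (Nat.Coprime z.val) hN).mpr (Nat.Coprime.mul_right h.1 h.2))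
    rw [not_and_or] at hz''
    rcases hz'' with h | h
    · rw [MulChar.map_nonunit ε]
      · simp
      · rwa [Int.cast_natCast, ZMod.isUnit_iff_coprime]
    · rw [(jacobiSym.eq_zero_iff_not_coprime (a := (z.val : ℤ)) (b := e)).2]
      · simp
      · rwa [Int.gcd_natCast_natCast]
  · change ((f (((x : ZMod N).val : ℤ)) : ℤ) : ℂ) = _
    rw [hper _ x (hval _)]

lemma mod_four_ne_zero_of_squarefree {d : ℕ} (hd : Squarefree d) : d % 4 ≠ 0 := fun h => by
  have := hd 2 (Nat.dvd_of_mod_eq_zero h)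
  simp at this

lemma kroneckerAtPrime_of_ne_two {D : ℤ} {p : ℕ} (hp : p ≠ 2) :
    kroneckerAtPrime D p = jacobiSym D p := by
  simp [kroneckerAtPrime, hp]

open scoped NumberTheorySymbols in
open ZMod in
/-- The Kronecker symbol of the discriminant of `ℚ(√-d)` is an odd Dirichlet character. -/
lemma exists_kronecker_character {d : ℕ} (hd : Squarefree d) :
    ∃ χ : DirichletCharacter ℂ (fieldDisc d).natAbs,
      (∀ p : ℕ, p.Prime →
        χ (p : ZMod (fieldDisc d).natAbs) = (kroneckerAtPrime (fieldDisc d) p : ℂ)) ∧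
      χ (-1) = -1 := by
  have hd0 : d ≠ 0 := hd.ne_zero
  have : NeZero d := ⟨hd0⟩
  have h4 := mod_four_ne_zero_of_squarefree hd
  -- it suffices to write the symbol as a character modulo `k` times `J(· | e)`
  have key : ∀ (k e : ℕ) [NeZero k] [NeZero e] (ε : MulChar (ZMod k) ℤ),
      (fieldDisc d).natAbs = k * e →
      (∀ p : ℕ, p.Prime → ε (p : ZMod k) * J((p : ℤ) | e) = kroneckerAtPrime (fieldDisc d) p) →
      ε (-1) * J(-1 | e) = -1 →
      ∃ χ : DirichletCharacter ℂ (fieldDisc d).natAbs,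
      (∀ p : ℕ, p.Prime →
        χ (p : ZMod (fieldDisc d).natAbs) = (kroneckerAtPrime (fieldDisc d) p : ℂ)) ∧
      χ (-1) = -1 := by
    intro k e _ _ ε hN h1 h2
    obtain ⟨χ, hχ⟩ := exists_dirichletCharacter_mul_jacobiSym hN ε
    refine ⟨χ, fun p hp => ?_, ?_⟩
    · have := hχ p
      push_cast at this
      rw [this, ← h1 p hp]; push_cast; rfl
    · have := hχ (-1)
      push_cast at this
      rw [this]
      exact_mod_cast congrArg (Int.cast : ℤ → ℂ) h2
  -- reciprocity in the form `J(e | p) = ± J(p | e)`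
  have hrec1 : ∀ {e p : ℕ}, e % 4 = 1 → Odd p → J(e | p) = J(p | e) := fun he hp =>
    jacobiSym.quadratic_reciprocity_one_mod_four he hp
  have hrec3 : ∀ {e p : ℕ}, e % 4 = 3 → Odd p → J(e | p) = χ₄ p * J(p | e) := by
    intro e p he hp
    rcases Nat.odd_mod_four_iff.1 (Nat.odd_iff.1 hp) with h | h
    · rw [χ₄_nat_one_mod_four h, one_mul]
      exact jacobiSym.quadratic_reciprocity_one_mod_four' (Nat.odd_iff.2 (by omega)) h
    · rw [χ₄_nat_three_mod_four h, neg_one_mul]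
      exact jacobiSym.quadratic_reciprocity_three_mod_four he h
  have hsq : ∀ {p : ℕ}, Odd p → χ₄ (p : ZMod 4) * χ₄ (p : ZMod 4) = 1 := by
    intro p hp
    rcases Nat.odd_mod_four_iff.1 (Nat.odd_iff.1 hp) with h | h
    · rw [χ₄_nat_one_mod_four h, one_mul]
    · rw [χ₄_nat_three_mod_four h]; norm_num
  rcases Nat.even_or_odd d with hev | hodd
  · obtain ⟨e, he⟩ := hev
    have hde : d = 2 * e := by omega
    have he2 : Odd e := Nat.odd_iff.2 (by omega)
    have : NeZero e := ⟨by omega⟩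
    have hD : fieldDisc d = -8 * (e : ℤ) := by
      unfold fieldDisc; rw [if_neg (by omega), hde]; push_cast; ring
    have hNe : (fieldDisc d).natAbs = 8 * e := by rw [hD]; omega
    have hJ : ∀ {p : ℕ}, Odd p → J(-8 * (e : ℤ) | p) = χ₈' p * J(e | p) := by
      intro p hp
      rw [show (-8 * (e : ℤ)) = 4 * (-2 * e) by ring, jacobiSym.mul_left, jacobiSym.at_four hp,
        one_mul, jacobiSym.mul_left, jacobiSym.at_neg_two hp]
    rcases Nat.odd_mod_four_iff.1 (Nat.odd_iff.1 he2) with h | h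
    · refine key 8 e χ₈' hNe (fun p hp => ?_) ?_
      · by_cases hp2 : p = 2
        · subst hp2
          rw [show (((2 : ℕ) : ZMod 8)) = 2 from rfl, show χ₈' 2 = 0 from rfl, zero_mul]
          simp only [kroneckerAtPrime, if_true, hD]
          rw [if_neg (by omega), if_neg (by omega)]
        · have ho := hp.odd_of_ne_two hp2
          rw [kroneckerAtPrime_of_ne_two hp2, hD, hJ ho, hrec1 h ho]
      · rw [jacobiSym.at_neg_one he2, χ₄_nat_one_mod_four h]; decide
    · refine key 8 e χ₈ hNe (fun p hp => ?_) ?_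
      · by_cases hp2 : p = 2
        · subst hp2
          rw [show (((2 : ℕ) : ZMod 8)) = 2 from rfl, show χ₈ 2 = 0 from rfl, zero_mul]
          simp only [kroneckerAtPrime, if_true, hD]
          rw [if_neg (by omega), if_neg (by omega)]
        · have ho := hp.odd_of_ne_two hp2
          have h8 := χ₈'_int_eq_χ₄_mul_χ₈ (p : ℤ)
          push_cast at h8
          rw [kroneckerAtPrime_of_ne_two hp2, hD, hJ ho, hrec3 h ho, h8]
          linear_combination (-χ₈ (p : ZMod 8) * J((p : ℤ) | e)) * hsq ho
      · rw [jacobiSym.at_neg_one he2, χ₄_nat_three_mod_four h]; decide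
  · rcases Nat.odd_mod_four_iff.1 (Nat.odd_iff.1 hodd) with h | h
    · have hD : fieldDisc d = -4 * (d : ℤ) := by
        unfold fieldDisc; rw [if_neg (by omega)]
      refine key 4 d χ₄ (by rw [hD]; omega) (fun p hp => ?_) ?_
      · by_cases hp2 : p = 2
        · subst hp2
          rw [show (((2 : ℕ) : ZMod 4)) = 2 from rfl, show χ₄ 2 = 0 from rfl, zero_mul]
          simp only [kroneckerAtPrime, if_true, hD]
          rw [if_neg (by omega), if_neg (by omega)]
        · have ho := hp.odd_of_ne_two hp2
          rw [kroneckerAtPrime_of_ne_two hp2, hD, show (-4 * (d : ℤ)) = 4 * (-d) by ring,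
            jacobiSym.mul_left, jacobiSym.at_four ho, one_mul, jacobiSym.neg _ ho, hrec1 h ho]
      · rw [jacobiSym.at_neg_one hodd, χ₄_nat_one_mod_four h]; decide
    · have hD : fieldDisc d = -(d : ℤ) := by
        unfold fieldDisc; rw [if_pos h]
      refine key 1 d 1 (by rw [hD]; omega) (fun p hp => ?_) ?_
      · rw [MulChar.one_apply (isUnit_of_subsingleton _), one_mul]
        by_cases hp2 : p = 2
        · subst hp2
          simp only [kroneckerAtPrime, if_true, hD]
          push_cast
          rw [jacobiSym.at_two hodd, χ₈_nat_eq_if_mod_eight]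
          split_ifs <;> first | rfl | omega
        · have ho := hp.odd_of_ne_two hp2
          rw [kroneckerAtPrime_of_ne_two hp2, hD, jacobiSym.neg _ ho, hrec3 h ho]
          linear_combination (-J((p : ℤ) | d)) * hsq ho
      · rw [jacobiSym.at_neg_one hodd, χ₄_nat_three_mod_four h,
          MulChar.one_apply (isUnit_of_subsingleton _)]; norm_num

/-! ### Hecke operators on `q`-expansions -/

/-- The `m`-th coefficient of the image under the `n`-th Hecke operator of the series with
coefficients `a`, where `g e` stands for `χ(e) e^(k-1)`. -/
def heckeCoeff (g a : ℕ → ℂ) (n m : ℕ) : ℂ :=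
  ∑ e ∈ n.divisors, if e ∣ m then g e * a ((n / e) * (m / e)) else 0

lemma sum_divisors_mul_left {p k : ℕ} (hp : p ≠ 0) (F : ℕ → ℂ) :
    ∑ e ∈ k.divisors, F (p * e) = ∑ e ∈ (p * k).divisors, if p ∣ e then F e else 0 := by
  rw [← Finset.sum_filter]
  refine Finset.sum_nbij' (fun e => p * e) (fun e => e / p) ?_ ?_ ?_ ?_ ?_
  · intro e he
    simp only [Nat.mem_divisors, Finset.mem_filter] at he ⊢
    exact ⟨⟨mul_dvd_mul_left p he.1, mul_ne_zero hp he.2⟩, dvd_mul_right _ _⟩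
  · intro e he
    simp only [Nat.mem_divisors, Finset.mem_filter] at he ⊢
    obtain ⟨⟨h1, h2⟩, e', rfl⟩ := he
    rw [Nat.mul_div_cancel_left _ (Nat.pos_of_ne_zero hp)]
    exact ⟨Nat.dvd_of_mul_dvd_mul_left (Nat.pos_of_ne_zero hp) h1, right_ne_zero_of_mul h2⟩
  · intro e _
    exact Nat.mul_div_cancel_left _ (Nat.pos_of_ne_zero hp)
  · intro e he
    simp only [Finset.mem_filter] at he
    exact Nat.mul_div_cancel' he.2
  · intro e _; rfl

lemma div_mul_div_eq {n m e : ℕ} (h1 : e ∣ n) (h2 : e ∣ m) (he : e ≠ 0) :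
    (n / e) * (m / e) = n * m / (e * e) := by
  obtain ⟨x, rfl⟩ := h1
  obtain ⟨y, rfl⟩ := h2
  have he' := Nat.pos_of_ne_zero he
  rw [Nat.mul_div_cancel_left _ he', Nat.mul_div_cancel_left _ he',
    show e * x * (e * y) = e * e * (x * y) by ring, Nat.mul_div_cancel_left _ (by positivity)]

lemma heckeCoeff_eq (g a : ℕ → ℂ) (n m : ℕ) :
    heckeCoeff g a n m = ∑ e ∈ n.divisors, if e ∣ m then g e * a (n * m / (e * e)) else 0 := by
  refine Finset.sum_congr rfl fun e he => ?_
  split_ifs with h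
  · rw [div_mul_div_eq (Nat.dvd_of_mem_divisors he) h (Nat.pos_of_mem_divisors he).ne']
  · rfl

lemma mul_heckeCoeff_eq {g : ℕ → ℂ} (hg : ∀ x y, g (x * y) = g x * g y) (a : ℕ → ℂ) {p : ℕ}
    (hp : p ≠ 0) (n m : ℕ) :
    g p * heckeCoeff g a n m =
      ∑ e ∈ (p * n).divisors,
        if p ∣ e then (if e ∣ p * m then g e * a ((p * n) * (p * m) / (e * e)) else 0) else 0 := by
  have h := sum_divisors_mul_left (k := n) hp
    (fun e => if e ∣ p * m then g e * a ((p * n) * (p * m) / (e * e)) else 0)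
  rw [← h, heckeCoeff_eq, Finset.mul_sum]
  refine Finset.sum_congr rfl fun e he => ?_
  have hp' := Nat.pos_of_ne_zero hp
  by_cases h : e ∣ m
  on_goal 1 => rw [if_pos h, if_pos (mul_dvd_mul_left p h)]
  on_goal 2 => rw [if_neg h, if_neg (by rwa [mul_dvd_mul_iff_left hp])]
  on_goal 2 => simp
  rw [hg, show p * n * (p * m) = (p * p) * (n * m) by ring,
    show p * e * (p * e) = (p * p) * (e * e) by ring,
    Nat.mul_div_mul_left _ _ (by positivity)]
  ring

/-- The relation between Hecke operators of index `p * n`, `n` and `n / p`, on coefficients. It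
says that a divisor `e` of both numbers either contains the factor `p` or is already a divisor
before `p` is moved from one number to the other. -/
lemma heckeCoeff_prime_mul {g : ℕ → ℂ} (hg : ∀ x y, g (x * y) = g x * g y) (a : ℕ → ℂ) {p : ℕ}
    (hp : p.Prime) (n m : ℕ) (hn : n ≠ 0) :
    heckeCoeff g a (p * n) m + (if p ∣ n then g p * heckeCoeff g a (n / p) m else 0) =
      heckeCoeff g a n (p * m) + (if p ∣ m then g p * heckeCoeff g a n (m / p) else 0) := by
  set w : ℕ → ℂ := fun e => g e * a (p * (n * m) / (e * e)) with hw
  have h1 : heckeCoeff g a (p * n) m = ∑ e ∈ (p * n).divisors, if e ∣ m then w e else 0 := by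
    rw [heckeCoeff_eq, mul_assoc]
  have h3 : heckeCoeff g a n (p * m) = ∑ e ∈ n.divisors, if e ∣ p * m then w e else 0 := by
    rw [heckeCoeff_eq, show n * (p * m) = p * (n * m) by ring]
  have h2 : (if p ∣ n then g p * heckeCoeff g a (n / p) m else 0) =
      ∑ e ∈ n.divisors, if p ∣ e then (if e ∣ p * m then w e else 0) else 0 := by
    split_ifs with h
    · obtain ⟨k, rfl⟩ := h
      rw [Nat.mul_div_cancel_left _ hp.pos, mul_heckeCoeff_eq hg a hp.ne_zero]
      simp only [hw]
      rw [show p * (p * k * m) = p * k * (p * m) by ring]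
    · refine (Finset.sum_eq_zero fun e he => ?_).symm
      rw [if_neg fun h' => h (h'.trans (Nat.dvd_of_mem_divisors he))]
  have h4 : (if p ∣ m then g p * heckeCoeff g a n (m / p) else 0) =
      ∑ e ∈ (p * n).divisors, if p ∣ e then (if e ∣ m then w e else 0) else 0 := by
    split_ifs with h
    · obtain ⟨k, rfl⟩ := h
      rw [Nat.mul_div_cancel_left _ hp.pos, mul_heckeCoeff_eq hg a hp.ne_zero]
      simp only [hw]
      rw [show p * (n * (p * k)) = p * n * (p * k) by ring]
    · refine (Finset.sum_eq_zero fun e he => ?_).symm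
      split_ifs with h1 h2
      · exact absurd (h1.trans h2) h
      · rfl
      · rfl
  have hsub : n.divisors ⊆ (p * n).divisors :=
    Nat.divisors_subset_of_dvd (mul_ne_zero hp.ne_zero hn) (dvd_mul_left n p)
  -- for `e` prime to `p` the conditions before and after moving `p` are the same
  have h5 : ∑ e ∈ n.divisors, (if p ∣ e then 0 else if e ∣ p * m then w e else 0) =
      ∑ e ∈ (p * n).divisors, (if p ∣ e then 0 else if e ∣ m then w e else 0) := by
    have : ∑ e ∈ n.divisors, (if p ∣ e then 0 else if e ∣ p * m then w e else 0) =
        ∑ e ∈ n.divisors, (if p ∣ e then 0 else if e ∣ m then w e else 0) := by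
      refine Finset.sum_congr rfl fun e _ => ?_
      by_cases hpe : p ∣ e
      · simp [hpe]
      · have hco : Nat.Coprime e p := ((Nat.Prime.coprime_iff_not_dvd hp).2 hpe).symm
        simp only [if_neg hpe, hco.dvd_mul_left]
    rw [this]
    refine Finset.sum_subset hsub fun e he hne => ?_
    by_cases hpe : p ∣ e
    · simp [hpe]
    · have hco : Nat.Coprime e p := ((Nat.Prime.coprime_iff_not_dvd hp).2 hpe).symm
      exact absurd (Nat.mem_divisors.2
        ⟨hco.dvd_of_dvd_mul_left (Nat.dvd_of_mem_divisors he), hn⟩) hne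
  have hsplit : ∀ (s : Finset ℕ) (F : ℕ → ℂ), ∑ e ∈ s, F e =
      ∑ e ∈ s, (if p ∣ e then F e else 0) + ∑ e ∈ s, (if p ∣ e then 0 else F e) := by
    intro s F
    rw [← Finset.sum_add_distrib]
    refine Finset.sum_congr rfl fun e _ => ?_
    split_ifs <;> simp
  rw [h1, h2, h3, h4, hsplit (p * n).divisors,
    hsplit n.divisors (fun e => if e ∣ p * m then w e else 0)]
  rw [h5]
  ring

/-- The Hecke relation at primes makes the coefficients an eigenvector of all Hecke operators, with
eigenvalues the coefficients themselves; prime factors of `n` are moved to `m` one at a time. -/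
lemma heckeCoeff_eq_mul {g a : ℕ → ℂ} (hg1 : g 1 = 1) (hg : ∀ x y, g (x * y) = g x * g y)
    (ha1 : a 1 = 1)
    (hrel : ∀ p m : ℕ, p.Prime → a (p * m) + (if p ∣ m then g p * a (m / p) else 0) = a p * a m) :
    ∀ n : ℕ, n ≠ 0 → ∀ m, heckeCoeff g a n m = a n * a m := by
  intro n
  induction n using Nat.strong_induction_on with
  | _ n ih =>
    intro hn m
    by_cases h1 : n = 1
    · subst h1
      simp [heckeCoeff, hg1, ha1]
    · obtain ⟨p, hp, k, rfl⟩ := Nat.exists_prime_and_dvd h1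
      have hk : k ≠ 0 := right_ne_zero_of_mul hn
      have hlt : k < p * k := by
        have := hp.two_le; have := Nat.pos_of_ne_zero hk; nlinarith
      have h := heckeCoeff_prime_mul hg a hp k m hk
      have e1 := ih k hlt hk (p * m)
      have e2 := hrel p k hp
      have e3 := hrel p m hp
      have e4 : (if p ∣ k then g p * heckeCoeff g a (k / p) m else 0) =
          (if p ∣ k then g p * a (k / p) else 0) * a m := by
        split_ifs with hpk
        · rw [ih (k / p) ((Nat.div_le_self _ _).trans_lt hlt)
            (Nat.div_pos (Nat.le_of_dvd (Nat.pos_of_ne_zero hk) hpk) hp.pos).ne']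
          ring
        · simp
      have e5 : (if p ∣ m then g p * heckeCoeff g a k (m / p) else 0) =
          a k * (if p ∣ m then g p * a (m / p) else 0) := by
        split_ifs with hpm
        · rw [ih k hlt hk]; ring
        · simp
      rw [e1, e4, e5] at h
      linear_combination h - a m * e2 + a k * e3

lemma hasSum_comp_mul_iff {u : ℕ} (hu : u ≠ 0) (F : ℕ → ℂ) (s : ℂ) :
    HasSum (fun m => F (u * m)) s ↔ HasSum (fun m => if u ∣ m then F m else 0) s := by
  have hinj : Function.Injective (fun m : ℕ => u * m) := fun x y h =>
    Nat.eq_of_mul_eq_mul_left (Nat.pos_of_ne_zero hu) h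
  rw [← hinj.hasSum_iff (f := fun m => if u ∣ m then F m else 0)]
  · have : (fun m => if u ∣ m then F m else 0) ∘ (fun m : ℕ => u * m) = fun m => F (u * m) := by
      funext m; simp
    rw [this]
  · intro m hm
    rw [if_neg]
    rintro ⟨k, rfl⟩
    exact hm ⟨k, rfl⟩

lemma sum_range_expi {e : ℕ} (he : e ≠ 0) (m : ℕ) :
    ∑ b ∈ Finset.range e, expi ((m : ℂ) * b / e) = if e ∣ m then (e : ℂ) else 0 := by
  have hec : (e : ℂ) ≠ 0 := Nat.cast_ne_zero.2 he
  have hb : ∀ b : ℕ, expi ((m : ℂ) * b / e) = expi (m / e) ^ b := by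
    intro b
    rw [← expi_nat_mul]; congr 1; ring
  simp_rw [hb]
  split_ifs with h
  · obtain ⟨k, rfl⟩ := h
    have : expi (((e * k : ℕ) : ℂ) / e) = 1 := by
      rw [show (((e * k : ℕ) : ℂ) / e) = ((k : ℤ) : ℂ) by push_cast; field_simp]
      exact expi_intCast _
    simp_rw [this]
    simp
  · have hne : expi ((m : ℂ) / e) ≠ 1 := by
      intro h1
      unfold expi at h1
      rw [Complex.exp_eq_one_iff] at h1
      obtain ⟨n, hn⟩ := h1
      have h2 : (m : ℂ) / e = n := by
        have : (2 * (π : ℂ) * Complex.I) ≠ 0 := Complex.two_pi_I_ne_zero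
        apply mul_left_cancel₀ this
        linear_combination hn
      rw [div_eq_iff hec] at h2
      have h3 : (m : ℤ) = n * e := by exact_mod_cast h2
      exact h (Int.natCast_dvd_natCast.1 ⟨n, by rw [h3]; ring⟩)
    have hpow : expi ((m : ℂ) / e) ^ e = 1 := by
      rw [← expi_nat_mul, show (e : ℂ) * (m / e) = ((m : ℤ) : ℂ) by push_cast; field_simp]
      exact expi_intCast _
    rw [geom_sum_eq hne, hpow, sub_self, zero_div]

/-- The sum over `b` modulo `e` keeps the coefficients whose index is divisible by `e`. -/
lemma hasSum_heckeOperator_term {a : ℕ → ℂ} {f : ℍ → ℂ}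
    (hf : ∀ τ : ℍ, HasSum (fun m : ℕ => a m * expi (m * τ)) (f τ)) {u e : ℕ} (hu : u ≠ 0)
    (he : e ≠ 0) (τ : ℍ) :
    HasSum (fun m : ℕ => if u ∣ m then (e : ℂ) * a (e * (m / u)) * expi (m * τ) else 0)
      (∑ b ∈ Finset.range e, f (ofComplex (((u : ℂ) * (τ : ℂ) + (b : ℂ)) / (e : ℂ)))) := by
  have hec : (e : ℂ) ≠ 0 := Nat.cast_ne_zero.2 he
  have hb : ∀ b ∈ Finset.range e,
      HasSum (fun m : ℕ => a m * expi (m * (u * τ / e)) * expi ((m : ℂ) * b / e))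
        (f (ofComplex (((u : ℂ) * (τ : ℂ) + (b : ℂ)) / (e : ℂ)))) := by
    intro b _
    have him : 0 < (((u : ℂ) * (τ : ℂ) + (b : ℂ)) / (e : ℂ)).im := by
      rw [Complex.div_natCast_im]
      have h1 := τ.im_pos
      have h2 : (0 : ℝ) < u := Nat.cast_pos.2 (Nat.pos_of_ne_zero hu)
      have h3 : (0 : ℝ) < e := Nat.cast_pos.2 (Nat.pos_of_ne_zero he)
      have : ((u : ℂ) * (τ : ℂ) + (b : ℂ)).im = u * τ.im := by simp
      rw [this]; positivity
    have h := hf (ofComplex (((u : ℂ) * (τ : ℂ) + (b : ℂ)) / (e : ℂ)))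
    have hc : ((ofComplex (((u : ℂ) * (τ : ℂ) + (b : ℂ)) / (e : ℂ)) : ℍ) : ℂ) =
        ((u : ℂ) * (τ : ℂ) + (b : ℂ)) / (e : ℂ) := by
      rw [ofComplex_apply_of_im_pos him]
    refine h.congr_fun ?_
    intro m
    rw [hc, mul_assoc, ← expi_add]
    congr 2
    field_simp
  have h1 := hasSum_sum hb
  simp_rw [← Finset.mul_sum, sum_range_expi he] at h1
  have h2 : HasSum (fun m : ℕ => if e ∣ m then a m * expi (m * (u * τ / e)) * (e : ℂ) else 0)
      (∑ b ∈ Finset.range e, f (ofComplex (((u : ℂ) * (τ : ℂ) + (b : ℂ)) / (e : ℂ)))) := by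
    refine h1.congr_fun fun m => ?_
    split_ifs <;> simp
  rw [← hasSum_comp_mul_iff he (fun m : ℕ => a m * expi (m * (u * τ / e)) * (e : ℂ))] at h2
  have h3 : HasSum (fun m : ℕ => (e : ℂ) * a (e * ((u * m) / u)) * expi ((u * m : ℕ) * τ))
      (∑ b ∈ Finset.range e, f (ofComplex (((u : ℂ) * (τ : ℂ) + (b : ℂ)) / (e : ℂ)))) := by
    refine h2.congr_fun fun m => ?_
    rw [Nat.mul_div_cancel_left _ (Nat.pos_of_ne_zero hu)]
    have : ((e * m : ℕ) : ℂ) * (u * τ / e) = (u * m : ℕ) * τ := by push_cast; field_simp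
    rw [this]; ring
  exact (hasSum_comp_mul_iff hu (fun m : ℕ => (e : ℂ) * a (e * (m / u)) * expi (m * τ)) _).1 h3

/-- The `q`-expansion of the image under a Hecke operator of weight three. -/
lemma hasSum_heckeOperator {N : ℕ} (χ : DirichletCharacter ℂ N) {a : ℕ → ℂ} {f : ℍ → ℂ}
    (hf : ∀ τ : ℍ, HasSum (fun m : ℕ => a m * expi (m * τ)) (f τ)) {n : ℕ} (hn : n ≠ 0) (τ : ℍ) :
    HasSum (fun m : ℕ =>
        heckeCoeff (fun e => χ (e : ZMod N) * (e : ℂ) ^ 2) a n m * expi (m * τ))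
      (heckeOperator 3 χ n f τ) := by
  unfold heckeOperator
  rw [Nat.sum_divisorsAntidiagonal (fun u e : ℕ => χ (u : ZMod N) * (e : ℂ) ^ (-3 : ℤ) *
      ∑ b ∈ Finset.range e, f (ofComplex (((u : ℂ) * (τ : ℂ) + (b : ℂ)) / (e : ℂ)))),
    Finset.mul_sum]
  simp_rw [heckeCoeff, Finset.sum_mul]
  refine hasSum_sum fun u hu => ?_
  obtain ⟨e, rfl⟩ := Nat.dvd_of_mem_divisors hu
  have hu0 : u ≠ 0 := left_ne_zero_of_mul hn
  have he0 : e ≠ 0 := right_ne_zero_of_mul hn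
  rw [Nat.mul_div_cancel_left _ (Nat.pos_of_ne_zero hu0)]
  have h := (hasSum_heckeOperator_term hf hu0 he0 τ).mul_left
    (((u * e : ℕ) : ℂ) ^ (3 - 1 : ℤ) * (χ (u : ZMod N) * (e : ℂ) ^ (-3 : ℤ)))
  rw [mul_assoc] at h
  refine h.congr_fun fun m => ?_
  have hec : (e : ℂ) ≠ 0 := Nat.cast_ne_zero.2 he0
  split_ifs
  · have e1 : ((u * e : ℕ) : ℂ) ^ (3 - 1 : ℤ) = (u : ℂ) ^ 2 * (e : ℂ) ^ 2 := by
      rw [show (3 - 1 : ℤ) = ((2 : ℕ) : ℤ) by norm_num, zpow_natCast]; push_cast; ring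
    have e2 : (e : ℂ) ^ (-3 : ℤ) = ((e : ℂ) ^ 3)⁻¹ := by
      rw [zpow_neg]; norm_cast
    rw [e1, e2]
    field_simp
  · simp

/-- The coefficients of a convergent expansion in `e^{2πiτ}` are the Fourier coefficients. -/
lemma fourierCoeff_eq {N : ℕ} {χ : DirichletCharacter ℂ N} {k : ℤ} {f : ℍ → ℂ}
    (hcusp : IsCuspFormWithCharacter k χ f) {a : ℕ → ℂ}
    (hf : ∀ τ : ℍ, HasSum (fun m : ℕ => a m * expi (m * τ)) (f τ)) (m : ℕ) :
    fourierCoeff f m = a m := by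
  obtain ⟨⟨F, rfl⟩, -⟩ := hcusp
  refine (ModularFormClass.qExpansion_coeff_unique (h := 1) (k := k) one_pos ?_ (f := F) ?_ m).symm
  · have := CongruenceSubgroup.strictPeriods_Gamma1 N
    rw [this]
    exact AddSubgroup.mem_zmultiples 1
  · intro τ
    refine (hf τ).congr_fun fun m => ?_
    rw [smul_eq_mul, expi_nat_mul, expi, Function.Periodic.qParam]
    simp

/-- A cusp form whose Fourier coefficients obey the relation of the Hecke operators of prime index
is an eigenform. -/
lemma isNormalizedHeckeEigenform_of_hasSum {N : ℕ} {χ : DirichletCharacter ℂ N} {f : ℍ → ℂ}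
    (hcusp : IsCuspFormWithCharacter 3 χ f) {a : ℕ → ℂ}
    (hf : ∀ τ : ℍ, HasSum (fun m : ℕ => a m * expi (m * τ)) (f τ)) (ha1 : a 1 = 1)
    (hrel : ∀ p m : ℕ, p.Prime →
      a (p * m) + (if p ∣ m then χ (p : ZMod N) * (p : ℂ) ^ 2 * a (m / p) else 0) = a p * a m) :
    IsNormalizedHeckeEigenform 3 χ f where
  cuspForm := hcusp
  normalized := by rw [fourierCoeff_eq hcusp hf, ha1]
  eigen n hn := by
    refine ⟨a n, funext fun τ => ?_⟩
    have h1 := hasSum_heckeOperator χ hf hn.ne' τ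
    have h2 := (hf τ).mul_left (a n)
    refine h1.unique (h2.congr_fun fun m => ?_)
    rw [heckeCoeff_eq_mul (by simp) (by intro x y; push_cast; rw [map_mul]; ring) ha1 hrel n hn.ne']
    ring

/-! ### The ring of integers of an imaginary quadratic field -/

/-- A concrete description of the ring of integers of the imaginary quadratic field of discriminant
`-N`: a complex embedding, an element `δ` with `δ² = -N`, and the fact that the integers are the
`(t + w δ) / 2` with `t ≡ w N` modulo two. -/
structure IntegerModel (K : Type*) [Field K] [NumberField K] (N : ℕ) where
  /-- The complex embedding. -/
  σ : 𝓞 K →+* ℂ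
  /-- The square root of the discriminant. -/
  δ : 𝓞 K
  injective : Function.Injective σ
  δ_sq : δ ^ 2 = -(N : 𝓞 K)
  σ_δ : σ δ = Complex.I * (√(N : ℝ) : ℂ)
  exists_int : ∀ x : 𝓞 K, ∃ t w : ℤ, 2 * x = t + w * δ ∧ 2 ∣ t + w * N
  exists_half : ∀ b : ℤ, 2 ∣ b + N → ∃ ω : 𝓞 K, 2 * ω = b + δ
  absNorm_span : ∀ x : 𝓞 K, (Ideal.absNorm (Ideal.span {x}) : ℝ) = Complex.normSq (σ x)

lemma exists_int_of_isIntegral_ratCast {q : ℚ} (h : IsIntegral ℤ (q : ℂ)) : ∃ n : ℤ, q = n := by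
  have h' : IsIntegral ℤ (algebraMap ℚ ℂ q) := by simpa using h
  rw [isIntegral_algebraMap_iff (algebraMap ℚ ℂ).injective, IsIntegrallyClosed.isIntegral_iff] at h'
  obtain ⟨n, hn⟩ := h'
  exact ⟨n, by simpa using hn.symm⟩

lemma exists_int_of_sq_mul_squarefree {d : ℕ} (hd : Squarefree d) {q : ℚ} {k : ℤ}
    (h : q ^ 2 * d = k) : ∃ n : ℤ, q = n := by
  have hden : (q.den : ℚ) ≠ 0 := Nat.cast_ne_zero.2 q.den_nz
  have h1 : (q.num ^ 2 * d : ℤ) = k * (q.den : ℤ) ^ 2 := by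
    have : (q.num : ℚ) ^ 2 * d = k * (q.den : ℚ) ^ 2 := by
      rw [← h]; nth_rw 2 [← Rat.num_div_den q]; field_simp
    exact_mod_cast this
  have h2 : (q.den ^ 2 : ℕ) ∣ q.num.natAbs ^ 2 * d := by
    have : ((q.den ^ 2 : ℕ) : ℤ) ∣ q.num ^ 2 * d := ⟨k, by rw [h1]; push_cast; ring⟩
    have := Int.natAbs_dvd_natAbs.2 this
    simpa [Int.natAbs_mul, Int.natAbs_pow] using this
  have h3 : q.den ^ 2 ∣ d :=
    (Nat.Coprime.pow 2 2 q.reduced.symm).dvd_of_dvd_mul_left h2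
  have h4 := Nat.isUnit_iff.1 (hd q.den (by rwa [← sq]))
  exact ⟨q.num, by rw [← Rat.num_div_den q, h4]; simp⟩

lemma natAbs_fieldDisc (d : ℕ) :
    ((fieldDisc d).natAbs : ℤ) = if d % 4 = 3 then (d : ℤ) else 4 * (d : ℤ) := by
  unfold fieldDisc; split_ifs <;> omega

/-- An imaginary quadratic field has an embedding that sends `√-d` to the upper half-plane. -/
lemma exists_embedding_sqrt {K : Type*} [Field K] [NumberField K] {d : ℕ}
    (hsqrt : ∃ s : K, s ^ 2 = -(d : K)) :
    ∃ (σ : K →ₐ[ℚ] ℂ) (s : K), s ^ 2 = -(d : K) ∧ σ s = Complex.I * (√(d : ℝ) : ℂ) := by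
  obtain ⟨s, hs⟩ := hsqrt
  obtain ⟨σ⟩ : Nonempty (K →+* ℂ) := inferInstance
  let σ' : K →ₐ[ℚ] ℂ := σ.toRatAlgHom
  have h1 : (σ' s) ^ 2 = (Complex.I * (√(d : ℝ) : ℂ)) ^ 2 := by
    rw [← map_pow, hs, mul_pow, Complex.I_sq, ← Complex.ofReal_pow,
      Real.sq_sqrt (Nat.cast_nonneg _)]
    simp
  rcases sq_eq_sq_iff_eq_or_eq_neg.1 h1 with h | h
  · exact ⟨σ', s, hs, h⟩
  · exact ⟨σ', -s, by rw [neg_sq, hs], by rw [map_neg, h, neg_neg]⟩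

lemma exists_rat_coords {K : Type*} [Field K] [NumberField K] {d : ℕ} (hd : d ≠ 0)
    (hdeg : Module.finrank ℚ K = 2) {σ : K →ₐ[ℚ] ℂ} {s : K}
    (hσ : σ s = Complex.I * (√(d : ℝ) : ℂ)) (x : K) :
    ∃ u v : ℚ, x = u + v * s := by
  have hpos : 0 < √(d : ℝ) := Real.sqrt_pos.2 (Nat.cast_pos.2 (Nat.pos_of_ne_zero hd))
  have hli : LinearIndependent ℚ ![(1 : K), s] := by
    rw [LinearIndependent.pair_iff]
    intro a b hab
    have h := congrArg σ hab
    rw [Algebra.smul_def, Algebra.smul_def, map_add, map_mul, map_mul, map_one, hσ, map_zero,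
      AlgHom.commutes, AlgHom.commutes] at h
    have him := congrArg Complex.im h
    have hre := congrArg Complex.re h
    simp at him hre
    exact ⟨hre, him.resolve_right (by simpa using hd)⟩
  have htop := hli.span_eq_top_of_card_eq_finrank' (by simp [hdeg])
  have hx : x ∈ Submodule.span ℚ (Set.range ![(1 : K), s]) := htop ▸ Submodule.mem_top
  rw [Matrix.range_cons, Matrix.range_cons, Matrix.range_empty, Set.union_empty,
    Set.singleton_union, Submodule.mem_span_pair] at hx
  obtain ⟨u, v, h⟩ := hx
  exact ⟨u, v, by rw [← h]; simp [Algebra.smul_def]⟩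

/-- The norm is the product over the two conjugate complex embeddings. -/
lemma absNorm_span_eq_normSq {K : Type*} [Field K] [NumberField K] {d : ℕ} (hd : d ≠ 0)
    (hdeg : Module.finrank ℚ K = 2) {σ : K →ₐ[ℚ] ℂ} {s : K}
    (hσ : σ s = Complex.I * (√(d : ℝ) : ℂ)) (x : 𝓞 K) :
    (Ideal.absNorm (Ideal.span {x}) : ℝ) = Complex.normSq (σ (x : K)) := by
  classical
  have hpos : 0 < √(d : ℝ) := Real.sqrt_pos.2 (Nat.cast_pos.2 (Nat.pos_of_ne_zero hd))
  let cσ : K →ₐ[ℚ] ℂ := ((starRingEnd ℂ).comp (σ : K →+* ℂ)).toRatAlgHom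
  have hcσ : ∀ y, cσ y = starRingEnd ℂ (σ y) := fun y => rfl
  have hne : σ ≠ cσ := by
    intro h
    have h1 := congrArg (fun f : K →ₐ[ℚ] ℂ => (f s).im) h
    simp only [hcσ, hσ] at h1
    simp at h1
    have : √(d : ℝ) = 0 := by linarith
    exact hpos.ne' this
  have huniv : (Finset.univ : Finset (K →ₐ[ℚ] ℂ)) = {σ, cσ} := by
    symm
    apply Finset.eq_univ_of_card
    rw [Finset.card_pair hne, AlgHom.card, hdeg]
  have h := Algebra.norm_eq_prod_embeddings ℚ ℂ (x : K)
  rw [huniv, Finset.prod_pair hne, hcσ, Complex.mul_conj, ← Algebra.coe_norm_int] at h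
  have h' : ((Algebra.norm ℤ x : ℤ) : ℝ) = Complex.normSq (σ (x : K)) := by
    have : (((Algebra.norm ℤ x : ℤ) : ℝ) : ℂ) = ((Complex.normSq (σ (x : K)) : ℝ) : ℂ) := by
      rw [← h]; simp
    exact_mod_cast this
  rw [Ideal.absNorm_span_singleton, ← h']
  have hnn : 0 ≤ Algebra.norm ℤ x := by
    have : (0 : ℝ) ≤ ((Algebra.norm ℤ x : ℤ) : ℝ) := by rw [h']; exact Complex.normSq_nonneg _
    exact_mod_cast this
  rw [← Int.cast_natCast, Int.natAbs_of_nonneg hnn]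

/-- Trace and norm of an integer `u + v √-d` are rational integers. -/
lemma trace_norm_int {K : Type*} [Field K] [NumberField K] {d : ℕ} {σ : K →ₐ[ℚ] ℂ} {s : K}
    (hσ : σ s = Complex.I * (√(d : ℝ) : ℂ)) (x : 𝓞 K) {u v : ℚ} (hx : (x : K) = u + v * s) :
    (∃ t : ℤ, 2 * u = t) ∧ ∃ k : ℤ, u ^ 2 + v ^ 2 * d = k := by
  have h1 : IsIntegral ℤ (σ (x : K)) :=
    (RingOfIntegers.isIntegral_coe x).map (σ : K →+* ℂ).toIntAlgHom
  have h2 : IsIntegral ℤ (starRingEnd ℂ (σ (x : K))) := h1.map (starRingEnd ℂ).toIntAlgHom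
  have hσx : σ (x : K) = u + v * (Complex.I * (√(d : ℝ) : ℂ)) := by
    rw [hx, map_add, map_mul, hσ]; simp
  have hcx : starRingEnd ℂ (σ (x : K)) = u - v * (Complex.I * (√(d : ℝ) : ℂ)) := by
    rw [hσx]; simp [sub_eq_add_neg]
  have hsq : ((√(d : ℝ) : ℝ) : ℂ) ^ 2 = d := by
    rw [← Complex.ofReal_pow, Real.sq_sqrt (Nat.cast_nonneg _)]; simp
  constructor
  · apply exists_int_of_isIntegral_ratCast
    have := h1.add h2
    rw [hcx, hσx] at this
    have e : (u + v * (Complex.I * (√(d : ℝ) : ℂ))) + (u - v * (Complex.I * (√(d : ℝ) : ℂ))) =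
        ((2 * u : ℚ) : ℂ) := by push_cast; ring
    rwa [e] at this
  · apply exists_int_of_isIntegral_ratCast
    have := h1.mul h2
    rw [hcx, hσx] at this
    have e : (u + v * (Complex.I * (√(d : ℝ) : ℂ))) * (u - v * (Complex.I * (√(d : ℝ) : ℂ))) =
        ((u ^ 2 + v ^ 2 * d : ℚ) : ℂ) := by
      push_cast
      rw [← hsq]
      linear_combination (-(v : ℂ) ^ 2 * (√(d : ℝ) : ℂ) ^ 2) * Complex.I_sq
    rwa [e] at this

lemma even_and_even_of_sq_add {t w d : ℤ} (hd : d % 4 = 1 ∨ d % 4 = 2)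
    (h : 4 ∣ t ^ 2 + w ^ 2 * d) : 2 ∣ t ∧ 2 ∣ w := by
  have h0 := Int.emod_eq_zero_of_dvd h
  rw [Int.add_emod, Int.mul_emod] at h0
  have hsq : ∀ x : ℤ, (2 ∣ x ∧ x ^ 2 % 4 = 0) ∨ x ^ 2 % 4 = 1 := by
    intro x
    rcases Int.even_or_odd x with hx | hx
    · refine Or.inl ⟨hx.two_dvd, ?_⟩
      obtain ⟨y, rfl⟩ := hx.two_dvd
      rw [mul_pow]; omega
    · exact Or.inr (Int.sq_mod_four_eq_one_of_odd hx)
  rcases hsq t with ⟨h1, h2⟩ | h2 <;> rcases hsq w with ⟨h3, h4⟩ | h4 <;>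
    rcases hd with h5 | h5 <;> rw [h2, h4, h5] at h0 <;> first | exact ⟨h1, h3⟩ | omega

lemma two_dvd_add_of_sq_add {t w d : ℤ} (hd : d % 4 = 3)
    (h : 4 ∣ t ^ 2 + w ^ 2 * d) : 2 ∣ t + w * d := by
  have h1 : Even (t ^ 2 + w ^ 2 * d) := even_iff_two_dvd.2 (dvd_trans (by norm_num) h)
  have h2 : ¬ Even d := by rw [Int.even_iff]; omega
  rw [Int.even_add, Int.even_mul, Int.even_pow' two_ne_zero, Int.even_pow' two_ne_zero] at h1
  rw [← even_iff_two_dvd, Int.even_add, Int.even_mul]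
  exact h1

/-- The ring of integers of `ℚ(√-d)`: twice an integer is `t + w √-d` with `4 ∣ t² + w² d`, and the
residue of `d` modulo four decides on the parities of `t` and `w`. -/
theorem nonempty_integerModel {K : Type*} [Field K] [NumberField K] {d : ℕ} (hd : Squarefree d)
    (hdeg : Module.finrank ℚ K = 2) (hsqrt : ∃ s : K, s ^ 2 = -(d : K)) :
    Nonempty (IntegerModel K (fieldDisc d).natAbs) := by
  have hd0 : d ≠ 0 := hd.ne_zero
  have h4 := mod_four_ne_zero_of_squarefree hd
  obtain ⟨σ, s, hs, hσ⟩ := exists_embedding_sqrt hsqrt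
  have hsint : IsIntegral ℤ s := by
    refine ⟨Polynomial.X ^ 2 + Polynomial.C (d : ℤ), by monicity!, ?_⟩
    simp [hs]
  let s' : 𝓞 K := ⟨s, hsint⟩
  have hs'K : ((s' : 𝓞 K) : K) = s := rfl
  have hs' : s' ^ 2 = -(d : 𝓞 K) := by
    apply RingOfIntegers.coe_injective
    push_cast [hs'K]
    rw [hs]
  let σ' : 𝓞 K →+* ℂ := (σ : K →+* ℂ).comp (algebraMap (𝓞 K) K)
  have hσ' : ∀ x : 𝓞 K, σ' x = σ (x : K) := fun x => rfl
  have hinj : Function.Injective σ' := (σ : K →+* ℂ).injective.comp RingOfIntegers.coe_injective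
  have hcoord : ∀ x : 𝓞 K, ∃ (t w' k : ℤ) (v : ℚ), 2 * (x : K) = t + (w' : K) * s ∧
      (w' : ℚ) = 2 * v ∧ t ^ 2 + w' ^ 2 * d = 4 * k := by
    intro x
    obtain ⟨u, v, hx⟩ := exists_rat_coords hd0 hdeg hσ (x : K)
    obtain ⟨⟨t, ht⟩, ⟨k, hk⟩⟩ := trace_norm_int hσ x hx
    obtain ⟨w, hw⟩ := exists_int_of_sq_mul_squarefree hd (q := 2 * v) (k := 4 * k - t ^ 2) (by
      push_cast; rw [← ht, ← hk]; ring)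
    refine ⟨t, w, k, v, ?_, hw.symm, ?_⟩
    · have h1 : ((2 * u : ℚ) : K) = ((t : ℚ) : K) := by rw [ht]
      have h2 : ((2 * v : ℚ) : K) = ((w : ℚ) : K) := by rw [hw]
      push_cast at h1 h2
      rw [hx, ← h1, ← h2]; ring
    · have : (t : ℚ) ^ 2 + (w : ℚ) ^ 2 * d = 4 * k := by rw [← ht, ← hw, ← hk]; ring
      exact_mod_cast this
  -- an element of `K` annihilated by `X² - bX + c` is an integer
  have hhalf : ∀ (b c : ℤ) (y : K), y ^ 2 - b * y + c = 0 → IsIntegral ℤ y := by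
    intro b c y hy
    refine ⟨Polynomial.X ^ 2 - Polynomial.C b * Polynomial.X + Polynomial.C c, by monicity!, ?_⟩
    simp only [Polynomial.eval₂_add, Polynomial.eval₂_sub, Polynomial.eval₂_mul,
      Polynomial.eval₂_C, Polynomial.eval₂_X, Polynomial.eval₂_pow]
    exact hy
  by_cases h3 : d % 4 = 3
  · have hN : (fieldDisc d).natAbs = d := by
      have := natAbs_fieldDisc d; rw [if_pos h3] at this; exact_mod_cast this
    rw [hN]
    refine ⟨⟨σ', s', hinj, hs', by rw [hσ', hs'K, hσ], fun x => ?_, fun b hb => ?_,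
      fun x => absNorm_span_eq_normSq hd0 hdeg hσ x⟩⟩
    · obtain ⟨t, w, k, v, h1, -, h2⟩ := hcoord x
      refine ⟨t, w, ?_, two_dvd_add_of_sq_add (by omega) ⟨k, h2⟩⟩
      apply RingOfIntegers.coe_injective
      simp only [map_add, map_mul, map_intCast, map_ofNat, hs'K]
      exact h1
    · have hc : 4 ∣ b ^ 2 + d := by
        obtain ⟨j, hj⟩ := hb
        have h1 : Odd b := by rw [Int.odd_iff]; omega
        have h2 := Int.sq_mod_four_eq_one_of_odd h1
        omega
      obtain ⟨c, hc⟩ := hc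
      have hc' : (b : K) ^ 2 + d = 4 * c := by exact_mod_cast congrArg (Int.cast : ℤ → K) hc
      refine ⟨⟨(b + s) / 2, hhalf b c _ ?_⟩, ?_⟩
      · linear_combination (1 / 4) * hs - (1 / 4) * hc'
      · apply RingOfIntegers.coe_injective
        simp only [map_add, map_intCast, hs'K]
        change 2 * ((b + s) / 2) = _
        ring
  · have hN : (fieldDisc d).natAbs = 4 * d := by
      have := natAbs_fieldDisc d; rw [if_neg h3] at this; exact_mod_cast this
    rw [hN]
    have hsqrt4 : √(((4 * d : ℕ) : ℝ)) = 2 * √(d : ℝ) := by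
      push_cast
      rw [Real.sqrt_mul (by norm_num), show (4 : ℝ) = 2 ^ 2 by norm_num,
        Real.sqrt_sq (by norm_num)]
    refine ⟨⟨σ', 2 * s', hinj, by push_cast; linear_combination 4 * hs', ?_, fun x => ?_,
      fun b hb => ?_, fun x => absNorm_span_eq_normSq hd0 hdeg hσ x⟩⟩
    · rw [map_mul, map_ofNat, hσ', hs'K, hσ, hsqrt4]; push_cast; ring
    · obtain ⟨t, w, k, v, h1, -, h2⟩ := hcoord x
      obtain ⟨h5, w', rfl⟩ := even_and_even_of_sq_add (t := t) (w := w) (d := d) (by omega) ⟨k, h2⟩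
      refine ⟨t, w', ?_, ?_⟩
      · apply RingOfIntegers.coe_injective
        simp only [map_add, map_mul, map_intCast, map_ofNat, hs'K]
        rw [h1]; push_cast; ring
      · push_cast; exact dvd_add h5 ⟨w' * 2 * d, by ring⟩
    · obtain ⟨j, hj⟩ : 2 ∣ b := by push_cast at hb; omega
      refine ⟨j + s', ?_⟩
      rw [hj]; push_cast; ring

/-! ### Coordinates and units -/

namespace IntegerModel

variable {K : Type*} [Field K] [NumberField K] {N : ℕ}

lemma coord_unique (E : IntegerModel K N) (hN : N ≠ 0) {t w t' w' : ℤ}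
    (h : (t : 𝓞 K) + w * E.δ = t' + w' * E.δ) : t = t' ∧ w = w' := by
  have h1 := congrArg E.σ h
  simp only [map_add, map_mul, map_intCast, E.σ_δ] at h1
  have hpos : √(N : ℝ) ≠ 0 := (Real.sqrt_pos.2 (Nat.cast_pos.2 (Nat.pos_of_ne_zero hN))).ne'
  have hre := congrArg Complex.re h1
  have him := congrArg Complex.im h1
  simp at hre him
  exact ⟨hre, him.resolve_right hN⟩

lemma normSq_add_mul (E : IntegerModel K N) (t w : ℤ) :
    Complex.normSq (t + w * E.σ E.δ) = t ^ 2 + w ^ 2 * N := by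
  rw [E.σ_δ, Complex.normSq_apply]
  have hsq : √(N : ℝ) * √(N : ℝ) = N := Real.mul_self_sqrt (Nat.cast_nonneg _)
  simp
  linear_combination (w : ℝ) ^ 2 * hsq

/-- For `N ≥ 7` the equation `t² + N w² = 4` has only the solutions with `w = 0`, so `±1` are the
only units. -/
lemma eq_one_or_neg_one_of_normSq (E : IntegerModel K N) (hN : 7 ≤ N) {x : 𝓞 K}
    (hx : Complex.normSq (E.σ x) = 1) :
    x = 1 ∨ x = -1 := by
  obtain ⟨t, w, h, -⟩ := E.exists_int x
  have h1 : Complex.normSq (E.σ (2 * x)) = t ^ 2 + w ^ 2 * N := by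
    rw [h]; simp only [map_add, map_mul, map_intCast]; exact E.normSq_add_mul t w
  rw [map_mul, map_mul, hx, map_ofNat] at h1
  have h2 : (t ^ 2 + w ^ 2 * N : ℤ) = 4 := by
    have : Complex.normSq 2 = 4 := by norm_num
    rw [this] at h1
    have : ((t ^ 2 + w ^ 2 * N : ℤ) : ℝ) = ((4 : ℤ) : ℝ) := by push_cast; linarith
    exact_mod_cast this
  have hw : w = 0 := by
    by_contra hw
    have : 0 < w ^ 2 := by positivity
    have h7 : (7 : ℤ) ≤ N := by exact_mod_cast hN
    nlinarith [sq_nonneg t]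
  subst hw
  have ht : (t - 2) * (t + 2) = 0 := by linear_combination h2
  have h2ne : (2 : 𝓞 K) ≠ 0 := two_ne_zero
  rcases mul_eq_zero.1 ht with ht | ht
  · left
    apply mul_left_cancel₀ h2ne
    rw [h, show t = 2 by omega]; push_cast; ring
  · right
    apply mul_left_cancel₀ h2ne
    rw [h, show t = -2 by omega]; push_cast; ring

lemma eq_or_eq_neg_of_span_eq (E : IntegerModel K N) (hN : 7 ≤ N) {x y : 𝓞 K}
    (h : Ideal.span {x} = Ideal.span {y}) : x = y ∨ x = -y := by
  obtain ⟨u, hu⟩ := Ideal.span_singleton_eq_span_singleton.1 h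
  have h1 : Ideal.span {((u : (𝓞 K)ˣ) : 𝓞 K)} = ⊤ := Ideal.span_singleton_eq_top.2 u.isUnit
  have h2 := E.absNorm_span (u : 𝓞 K)
  rw [h1, Ideal.absNorm_top, Nat.cast_one] at h2
  rcases E.eq_one_or_neg_one_of_normSq hN h2.symm with h3 | h3
  · left; rw [← hu, h3, mul_one]
  · right; rw [← hu, h3]; ring

lemma absNorm_span_natCast (E : IntegerModel K N) (p : ℕ) :
    Ideal.absNorm (Ideal.span {(p : 𝓞 K)}) = p ^ 2 := by
  have h := E.absNorm_span (p : 𝓞 K)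
  rw [map_natCast, Complex.normSq_natCast] at h
  rw [sq]; exact_mod_cast h

variable {b : ℤ} {ω : 𝓞 K}

lemma σ_omega (E : IntegerModel K N) (hω : 2 * ω = b + E.δ) : E.σ ω = omega b N := by
  have h := congrArg E.σ hω
  simp only [map_add, map_mul, map_ofNat, map_intCast, E.σ_δ] at h
  unfold omega
  linear_combination h / 2

lemma omega_sq_eq (E : IntegerModel K N) (hω : 2 * ω = b + E.δ) {k : ℤ}
    (hk : b ^ 2 + N = 4 * k) : ω ^ 2 = b * ω - k := by
  have h4 : (4 : 𝓞 K) ≠ 0 := by norm_num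
  apply mul_left_cancel₀ h4
  have hk' : (b : 𝓞 K) ^ 2 + N = 4 * k := by exact_mod_cast congrArg (Int.cast : ℤ → 𝓞 K) hk
  linear_combination (2 * ω - b + E.δ) * hω + E.δ_sq - hk'

lemma exists_coord (E : IntegerModel K N) (hω : 2 * ω = b + E.δ) (hb : 2 ∣ b + N)
    (x : 𝓞 K) : ∃ m n : ℤ, x = m + n * ω := by
  obtain ⟨t, w, h, h2⟩ := E.exists_int x
  obtain ⟨j, hj⟩ : 2 ∣ t - w * b := by
    have : t - w * b = (t + w * N) - w * (b + N) := by ring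
    rw [this]; exact dvd_sub h2 (dvd_mul_of_dvd_right hb _)
  refine ⟨j, w, ?_⟩
  have h2ne : (2 : 𝓞 K) ≠ 0 := two_ne_zero
  apply mul_left_cancel₀ h2ne
  have hj' : (t : 𝓞 K) - w * b = 2 * j := by exact_mod_cast congrArg (Int.cast : ℤ → 𝓞 K) hj
  linear_combination h - (w : 𝓞 K) * hω + hj'

lemma coord_omega_unique (E : IntegerModel K N) (hω : 2 * ω = b + E.δ) (hN : N ≠ 0) {m n m' n' : ℤ}
    (h : (m : 𝓞 K) + n * ω = m' + n' * ω) : m = m' ∧ n = n' := by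
  have h1 : ((2 * m + n * b : ℤ) : 𝓞 K) + n * E.δ = ((2 * m' + n' * b : ℤ) : 𝓞 K) + n' * E.δ := by
    push_cast
    linear_combination 2 * h - ((n : 𝓞 K) - n') * hω
  obtain ⟨h2, h3⟩ := E.coord_unique hN h1
  subst h3
  exact ⟨by linarith, rfl⟩

lemma dvd_coord (E : IntegerModel K N) (hω : 2 * ω = b + E.δ) (hN : N ≠ 0)
    (hb : 2 ∣ b + N) {p m n : ℤ} (h : (p : 𝓞 K) ∣ m + n * ω) :
    p ∣ m ∧ p ∣ n := by
  obtain ⟨y, hy⟩ := h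
  obtain ⟨m', n', rfl⟩ := E.exists_coord hω hb y
  have : (m : 𝓞 K) + n * ω = ((p * m' : ℤ) : 𝓞 K) + ((p * n' : ℤ) : 𝓞 K) * ω := by
    rw [hy]; push_cast; ring
  obtain ⟨h1, h2⟩ := E.coord_omega_unique hω hN this
  exact ⟨⟨_, h1⟩, ⟨_, h2⟩⟩

end IntegerModel

/-! ### Sums over the ideals of given norm -/

/-- The sum of the values of `ψ` at the ideals of norm `n`. -/
noncomputable def normSum {K : Type*} [Field K] [NumberField K] (ψ : Ideal (𝓞 K) → ℂ) (n : ℕ) : ℂ :=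
  ∑ I ∈ (Ideal.finite_setOfPred_absNorm_eq (S := 𝓞 K) n).toFinset, ψ I

section normSum

variable {K : Type*} [Field K] [NumberField K]

lemma mem_toFinset_absNorm {n : ℕ} {I : Ideal (𝓞 K)} :
    I ∈ (Ideal.finite_setOfPred_absNorm_eq (S := 𝓞 K) n).toFinset ↔ Ideal.absNorm I = n := by
  simp

lemma normSum_one (ψ : Ideal (𝓞 K) → ℂ) : normSum ψ 1 = ψ ⊤ := by
  have : (Ideal.finite_setOfPred_absNorm_eq (S := 𝓞 K) 1).toFinset = {⊤} := by
    ext I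
    rw [mem_toFinset_absNorm, Ideal.absNorm_eq_one_iff, Finset.mem_singleton]
  rw [normSum, this, Finset.sum_singleton]

lemma normSum_zero (ψ : Ideal (𝓞 K) → ℂ) : normSum ψ 0 = ψ ⊥ := by
  have : (Ideal.finite_setOfPred_absNorm_eq (S := 𝓞 K) 0).toFinset = {⊥} := by
    ext I
    rw [mem_toFinset_absNorm, Ideal.absNorm_eq_zero_iff, Finset.mem_singleton]
  rw [normSum, this, Finset.sum_singleton]

open Classical in
/-- The ideals of norm `n` divisible by `Q` are the products of `Q` with the ideals of norm
`n / N Q`. -/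
lemma sum_dvd_eq {ψ : Ideal (𝓞 K) → ℂ} (hψ : ∀ I J, ψ (I * J) = ψ I * ψ J) {Q : Ideal (𝓞 K)}
    {q : ℕ} (hq : Ideal.absNorm Q = q) (hq0 : q ≠ 0) (n : ℕ) :
    ∑ I ∈ (Ideal.finite_setOfPred_absNorm_eq (S := 𝓞 K) n).toFinset, (if Q ∣ I then ψ I else 0) =
      if q ∣ n then ψ Q * normSum ψ (n / q) else 0 := by
  have hQ : Q ≠ 0 := by
    rintro rfl
    exact hq0 (by rw [← hq]; simp)
  rw [← Finset.sum_filter]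
  split_ifs with h
  · obtain ⟨k, rfl⟩ := h
    rw [Nat.mul_div_cancel_left _ (Nat.pos_of_ne_zero hq0), normSum, Finset.mul_sum]
    symm
    refine Finset.sum_bij (fun J _ => Q * J) ?_ ?_ ?_ ?_
    · intro J hJ
      rw [mem_toFinset_absNorm] at hJ
      rw [Finset.mem_filter, mem_toFinset_absNorm, map_mul, hq, hJ]
      exact ⟨rfl, dvd_mul_right _ _⟩
    · intro J _ J' _ hJJ
      exact mul_left_cancel₀ hQ hJJ
    · intro I hI
      rw [Finset.mem_filter, mem_toFinset_absNorm] at hI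
      obtain ⟨h1, J, rfl⟩ := hI
      refine ⟨J, ?_, rfl⟩
      rw [mem_toFinset_absNorm]
      rw [map_mul, hq] at h1
      exact Nat.eq_of_mul_eq_mul_left (Nat.pos_of_ne_zero hq0) h1
    · intro J _
      exact (hψ Q J).symm
  · refine Finset.sum_eq_zero fun I hI => ?_
    rw [Finset.mem_filter, mem_toFinset_absNorm] at hI
    obtain ⟨h1, J, rfl⟩ := hI
    exact absurd ⟨_, by rw [← h1, map_mul, hq]⟩ h

end normSum

namespace IntegerModel

variable {K : Type*} [Field K] [NumberField K] {N : ℕ}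

/-- An ideal whose norm is divisible by `p` has a maximal divisor in common with `(p)`, which is
`(p)` itself or of norm `p`. -/
lemma exists_common_prime (E : IntegerModel K N) {p : ℕ} (hp : p.Prime) {I : Ideal (𝓞 K)}
    (hI : p ∣ Ideal.absNorm I) :
    ∃ P : Ideal (𝓞 K), P.IsMaximal ∧ P ∣ I ∧ P ∣ Ideal.span {(p : 𝓞 K)} ∧
      (P = Ideal.span {(p : 𝓞 K)} ∨ Ideal.absNorm P = p) := by
  obtain ⟨P, hP, hu, hPI⟩ := Ideal.exists_isMaximal_dvd_of_dvd_absNorm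
    (Nat.prime_iff_prime_int.1 hp) I (Int.natCast_dvd_natCast.2 hI)
  have hpP : (p : 𝓞 K) ∈ P := by
    have : (p : ℤ) ∈ Ideal.under ℤ P := by rw [hu]; exact Ideal.mem_span_singleton_self _
    rw [Ideal.mem_under] at this
    simpa using this
  have hdvd : P ∣ Ideal.span {(p : 𝓞 K)} := Ideal.dvd_span_singleton.2 hpP
  refine ⟨P, hP, hPI, hdvd, ?_⟩
  obtain ⟨Q, hQ⟩ := hdvd
  have hn := E.absNorm_span_natCast p
  rw [hQ, map_mul] at hn
  obtain ⟨j, hj, hPj⟩ := (Nat.dvd_prime_pow hp).1 ⟨_, hn.symm⟩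
  interval_cases j
  · rw [pow_zero, Ideal.absNorm_eq_one_iff] at hPj
    exact absurd hPj hP.ne_top
  · right; rw [hPj, pow_one]
  · left
    have : Ideal.absNorm Q = 1 := by
      rw [hPj] at hn
      exact Nat.eq_of_mul_eq_mul_left (pow_pos hp.pos 2) (by rw [hn, mul_one])
    rw [Ideal.absNorm_eq_one_iff] at this
    rw [hQ, this, Ideal.mul_top]

/-- The factorization `(p) = P Q` when there is an ideal `P` of norm `p`. -/
lemma exists_factorization (E : IntegerModel K N) {p : ℕ} (hp : p.Prime) {P : Ideal (𝓞 K)}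
    (hP : Ideal.absNorm P = p) :
    ∃ Q : Ideal (𝓞 K), Ideal.span {(p : 𝓞 K)} = P * Q ∧ Ideal.absNorm Q = p := by
  obtain ⟨Q, hQ⟩ : P ∣ Ideal.span {(p : 𝓞 K)} := by
    rw [Ideal.dvd_span_singleton, ← hP]
    exact Ideal.absNorm_mem P
  refine ⟨Q, hQ, ?_⟩
  have hn := E.absNorm_span_natCast p
  rw [hQ, map_mul, hP, sq] at hn
  exact Nat.eq_of_mul_eq_mul_left hp.pos hn

lemma prime_of_absNorm_prime {p : ℕ} (hp : p.Prime) {P : Ideal (𝓞 K)}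
    (hP : Ideal.absNorm P = p) : Prime P := by
  have h1 : P ≠ ⊥ := by
    rintro rfl
    rw [Ideal.absNorm_bot] at hP
    exact hp.ne_zero hP.symm
  exact Ideal.prime_of_isPrime h1 (Ideal.isPrime_of_irreducible_absNorm (by rw [hP]; exact hp))

lemma dvd_or_dvd_of_dvd_absNorm (E : IntegerModel K N) {p : ℕ} (hp : p.Prime)
    {P Q : Ideal (𝓞 K)} (hPQ : Ideal.span {(p : 𝓞 K)} = P * Q) (hP : Ideal.absNorm P = p)
    (hQ : Ideal.absNorm Q = p) {I : Ideal (𝓞 K)} (hI : p ∣ Ideal.absNorm I) : P ∣ I ∨ Q ∣ I := by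
  obtain ⟨R, hR, hRI, hRp, -⟩ := E.exists_common_prime hp hI
  have hR0 : R ≠ ⊥ := by
    rintro rfl
    have := hRp
    rw [← Ideal.zero_eq_bot, zero_dvd_iff, Ideal.zero_eq_bot, Ideal.span_singleton_eq_bot] at this
    exact hp.ne_zero (by exact_mod_cast this)
  have hRprime := Ideal.prime_of_isPrime hR0 hR.isPrime
  rw [hPQ] at hRp
  have key : ∀ {T : Ideal (𝓞 K)}, Ideal.absNorm T = p → R ∣ T → T ∣ I := fun hT hRT =>
    ((hRprime.dvd_prime_iff_associated (prime_of_absNorm_prime hp hT)).1 hRT).symm.dvd.trans hRI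
  rcases hRprime.dvd_or_dvd hRp with h | h
  · exact Or.inl (key hP h)
  · exact Or.inr (key hQ h)

variable {ψ : Ideal (𝓞 K) → ℂ}

/-- If there are no ideals of norm `p`, every ideal of norm divisible by `p` is divisible by
`(p)`. -/
lemma normSum_prime_mul_of_inert (E : IntegerModel K N) (hψ : ∀ I J, ψ (I * J) = ψ I * ψ J)
    {p : ℕ} (hp : p.Prime) (hψp : ψ (Ideal.span {(p : 𝓞 K)}) = (p : ℂ) ^ 2)
    (hno : ∀ P : Ideal (𝓞 K), Ideal.absNorm P ≠ p) (m : ℕ) :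
    normSum ψ (p * m) = if p ∣ m then (p : ℂ) ^ 2 * normSum ψ (m / p) else 0 := by
  classical
  have h := sum_dvd_eq hψ (E.absNorm_span_natCast p) (pow_ne_zero 2 hp.ne_zero) (p * m)
  have h1 : normSum ψ (p * m) =
      ∑ I ∈ (Ideal.finite_setOfPred_absNorm_eq (S := 𝓞 K) (p * m)).toFinset,
      (if Ideal.span {(p : 𝓞 K)} ∣ I then ψ I else 0) := by
    refine Finset.sum_congr rfl fun I hI => ?_
    rw [mem_toFinset_absNorm] at hI
    obtain ⟨P, -, hPI, -, hP⟩ := E.exists_common_prime hp (I := I) ⟨m, hI⟩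
    rw [if_pos]
    rcases hP with rfl | hP
    · exact hPI
    · exact absurd hP (hno P)
  rw [h1, h, hψp, sq p]
  by_cases hpm : p ∣ m
  · rw [if_pos hpm, if_pos (mul_dvd_mul_left p hpm), Nat.mul_div_mul_left _ _ hp.pos]
  · rw [if_neg hpm, if_neg fun h' => hpm (Nat.dvd_of_mul_dvd_mul_left hp.pos h')]

lemma normSum_prime_mul_of_ramified (E : IntegerModel K N) (hψ : ∀ I J, ψ (I * J) = ψ I * ψ J)
    {p : ℕ} (hp : p.Prime) {P : Ideal (𝓞 K)} (hPP : Ideal.span {(p : 𝓞 K)} = P * P)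
    (hP : Ideal.absNorm P = p) (m : ℕ) :
    normSum ψ (p * m) = ψ P * normSum ψ m := by
  classical
  have h := sum_dvd_eq hψ hP hp.ne_zero (p * m)
  rw [if_pos (dvd_mul_right p m), Nat.mul_div_cancel_left _ hp.pos] at h
  rw [← h]
  refine Finset.sum_congr rfl fun I hI => ?_
  rw [mem_toFinset_absNorm] at hI
  rw [if_pos ((E.dvd_or_dvd_of_dvd_absNorm hp hPP hP hP (I := I) ⟨m, hI⟩).elim id id)]

lemma normSum_prime_mul_of_split (E : IntegerModel K N) (hψ : ∀ I J, ψ (I * J) = ψ I * ψ J)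
    {p : ℕ} (hp : p.Prime) (hψp : ψ (Ideal.span {(p : 𝓞 K)}) = (p : ℂ) ^ 2) {P Q : Ideal (𝓞 K)}
    (hPQ : Ideal.span {(p : 𝓞 K)} = P * Q) (hP : Ideal.absNorm P = p) (hQ : Ideal.absNorm Q = p)
    (hne : P ≠ Q) (m : ℕ) :
    normSum ψ (p * m) + (if p ∣ m then (p : ℂ) ^ 2 * normSum ψ (m / p) else 0) =
      (ψ P + ψ Q) * normSum ψ m := by
  classical
  have h := sum_dvd_eq hψ (E.absNorm_span_natCast p) (pow_ne_zero 2 hp.ne_zero) (p * m)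
  have hp1 := sum_dvd_eq hψ hP hp.ne_zero (p * m)
  have hq1 := sum_dvd_eq hψ hQ hp.ne_zero (p * m)
  rw [if_pos (dvd_mul_right p m), Nat.mul_div_cancel_left _ hp.pos] at hp1 hq1
  have hpp : (if p ^ 2 ∣ p * m then
      ψ (Ideal.span {(p : 𝓞 K)}) * normSum ψ (p * m / p ^ 2) else 0) =
      (if p ∣ m then (p : ℂ) ^ 2 * normSum ψ (m / p) else 0) := by
    rw [hψp, sq p]
    by_cases hpm : p ∣ m
    · rw [if_pos hpm, if_pos (mul_dvd_mul_left p hpm), Nat.mul_div_mul_left _ _ hp.pos]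
    · rw [if_neg hpm, if_neg fun h' => hpm (Nat.dvd_of_mul_dvd_mul_left hp.pos h')]
  rw [hpp] at h
  rw [add_mul, ← hp1, ← hq1, ← h, normSum, ← Finset.sum_add_distrib, ← Finset.sum_add_distrib]
  have hPprime := prime_of_absNorm_prime hp hP
  have hQprime := prime_of_absNorm_prime hp hQ
  refine Finset.sum_congr rfl fun I hI => ?_
  rw [mem_toFinset_absNorm] at hI
  -- inclusion-exclusion for the two divisors
  have hiff : Ideal.span {(p : 𝓞 K)} ∣ I ↔ P ∣ I ∧ Q ∣ I := by
    rw [hPQ]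
    refine ⟨fun h => ⟨(dvd_mul_right P Q).trans h, (dvd_mul_left Q P).trans h⟩, fun h => ?_⟩
    obtain ⟨J, rfl⟩ := h.1
    rcases hQprime.dvd_or_dvd h.2 with h' | h'
    · exact absurd (associated_iff_eq.1
        ((hQprime.dvd_prime_iff_associated hPprime).1 h')).symm hne
    · exact mul_dvd_mul_left P h'
  have hor := E.dvd_or_dvd_of_dvd_absNorm hp hPQ hP hQ (I := I) ⟨m, hI⟩
  by_cases h1 : P ∣ I <;> by_cases h2 : Q ∣ I
  · rw [if_pos (hiff.2 ⟨h1, h2⟩), if_pos h1, if_pos h2]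
  · rw [if_neg (fun h => h2 (hiff.1 h).2), if_pos h1, if_neg h2]
  · rw [if_neg (fun h => h1 (hiff.1 h).1), if_neg h1, if_pos h2]; ring
  · exact absurd hor (by tauto)

end IntegerModel

/-! ### The decomposition of primes -/

namespace IntegerModel

variable {K : Type*} [Field K] [NumberField K] {N : ℕ}

/-- The residue field of an ideal of norm `p` consists of the classes of rational integers. -/
lemma exists_intCast_sub_mem {p : ℕ} (hp : p.Prime) {P : Ideal (𝓞 K)}
    (hP : Ideal.absNorm P = p) (x : 𝓞 K) : ∃ r : ℤ, x - r ∈ P := by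
  have : Fact p.Prime := ⟨hp⟩
  have hcard : Nat.card (𝓞 K ⧸ P) = p := by
    rw [← hP, Ideal.absNorm_apply, Submodule.cardQuot_apply]
  have hne : (1 : 𝓞 K ⧸ P) ≠ 0 := by
    intro h
    rw [← map_one (Ideal.Quotient.mk P), Ideal.Quotient.eq_zero_iff_mem,
      ← Ideal.eq_top_iff_one] at h
    rw [h, Ideal.absNorm_top] at hP
    exact hp.ne_one hP.symm
  obtain ⟨r, hr⟩ := AddSubgroup.mem_zmultiples_iff.1
    (mem_zmultiples_of_prime_card hcard hne (g' := Ideal.Quotient.mk P x))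
  refine ⟨r, ?_⟩
  rw [← Ideal.Quotient.eq_zero_iff_mem, map_sub, ← hr]
  simp

lemma dvd_of_intCast_mem {p : ℕ} (hp : p.Prime) {P : Ideal (𝓞 K)}
    (hP : Ideal.absNorm P = p) {k : ℤ} (hk : (k : 𝓞 K) ∈ P) : (p : ℤ) ∣ k := by
  by_contra h
  have hco : IsCoprime (p : ℤ) k := (Nat.prime_iff_prime_int.1 hp).coprime_iff_not_dvd.2 h
  obtain ⟨u, v, huv⟩ := hco
  have hpP : (p : 𝓞 K) ∈ P := by rw [← hP]; exact Ideal.absNorm_mem P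
  have h1 : (1 : 𝓞 K) ∈ P := by
    have : (u : 𝓞 K) * p + v * k = 1 := by exact_mod_cast congrArg (Int.cast : ℤ → 𝓞 K) huv
    rw [← this]
    exact P.add_mem (P.mul_mem_left _ hpP) (P.mul_mem_left _ hk)
  rw [(Ideal.eq_top_iff_one P).2 h1, Ideal.absNorm_top] at hP
  exact hp.ne_one hP.symm

/-- If `(p)` is not prime, it is a product of two ideals of norm `p`. -/
lemma exists_factorization_of_not_prime (E : IntegerModel K N) {p : ℕ} (hp : p.Prime)
    {x y : 𝓞 K} (hxy : (p : 𝓞 K) ∣ x * y) (hx : ¬ (p : 𝓞 K) ∣ x) (hy : ¬ (p : 𝓞 K) ∣ y) :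
    ∃ P Q : Ideal (𝓞 K), Ideal.span {(p : 𝓞 K)} = P * Q ∧ Ideal.absNorm P = p ∧
      Ideal.absNorm Q = p := by
  obtain ⟨P, hPmax, -, -, hP⟩ := E.exists_common_prime hp (I := Ideal.span {(p : 𝓞 K)})
    (by rw [E.absNorm_span_natCast]; exact dvd_pow_self p two_ne_zero)
  rcases hP with rfl | hP
  · rcases hPmax.isPrime.mem_or_mem (Ideal.mem_span_singleton.2 hxy) with h | h
    · exact absurd (Ideal.mem_span_singleton.1 h) hx
    · exact absurd (Ideal.mem_span_singleton.1 h) hy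
  · obtain ⟨Q, h1, h2⟩ := E.exists_factorization hp hP
    exact ⟨P, Q, h1, hP, h2⟩

/-- An element `t` not divisible by `p` whose square is divisible by `p` forces `p` to be ramified:
different prime factors of `(p)` would both divide `t`. -/
lemma ramified_of_sq (E : IntegerModel K N) {p : ℕ} (hp : p.Prime) {t : 𝓞 K}
    (ht2 : (p : 𝓞 K) ∣ t * t) (ht : ¬ (p : 𝓞 K) ∣ t) :
    ∃ P : Ideal (𝓞 K), Ideal.span {(p : 𝓞 K)} = P * P ∧ Ideal.absNorm P = p := by
  obtain ⟨P, Q, hPQ, hP, hQ⟩ := E.exists_factorization_of_not_prime hp ht2 ht ht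
  have hPprime := prime_of_absNorm_prime hp hP
  have hQprime := prime_of_absNorm_prime hp hQ
  have hdvd : P * Q ∣ Ideal.span {t} * Ideal.span {t} := by
    rw [← hPQ, Ideal.span_singleton_mul_span_singleton, Ideal.dvd_span_singleton,
      Ideal.mem_span_singleton]
    exact ht2
  have h1 : P ∣ Ideal.span {t} :=
    (hPprime.dvd_or_dvd ((dvd_mul_right P Q).trans hdvd)).elim id id
  have h2 : Q ∣ Ideal.span {t} :=
    (hQprime.dvd_or_dvd ((dvd_mul_left Q P).trans hdvd)).elim id id
  by_cases hne : P = Q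
  · subst hne; exact ⟨P, hPQ, hP⟩
  · exfalso
    obtain ⟨J, hJ⟩ := h1
    rw [hJ] at h2
    rcases hQprime.dvd_or_dvd h2 with h' | h'
    · exact hne (associated_iff_eq.1 ((hQprime.dvd_prime_iff_associated hPprime).1 h')).symm
    · have h3 : P * Q ∣ Ideal.span {t} := by rw [hJ]; exact mul_dvd_mul_left P h'
      rw [← hPQ, Ideal.dvd_span_singleton, Ideal.mem_span_singleton] at h3
      exact ht h3

/-- Elements `x`, `y` not divisible by `p` whose product is divisible by `p` force `p` to split, if
they do not have a common prime factor over `p`, which is guaranteed by their difference. -/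
lemma split_of_mul (E : IntegerModel K N) {p : ℕ} (hp : p.Prime) {x y : 𝓞 K} {k : ℤ}
    (hxy : (p : 𝓞 K) ∣ x * y) (hx : ¬ (p : 𝓞 K) ∣ x) (hy : ¬ (p : 𝓞 K) ∣ y)
    (hk : y - x = k) (hpk : ¬ (p : ℤ) ∣ k) :
    ∃ P Q : Ideal (𝓞 K), P ≠ Q ∧ Ideal.span {(p : 𝓞 K)} = P * Q ∧ Ideal.absNorm P = p ∧
      Ideal.absNorm Q = p := by
  obtain ⟨P, Q, hPQ, hP, hQ⟩ := E.exists_factorization_of_not_prime hp hxy hx hy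
  refine ⟨P, Q, ?_, hPQ, hP, hQ⟩
  rintro rfl
  have hPprime := prime_of_absNorm_prime hp hP
  have hdvd : P ^ 2 ∣ Ideal.span {x} * Ideal.span {y} := by
    rw [sq, ← hPQ, Ideal.span_singleton_mul_span_singleton, Ideal.dvd_span_singleton,
      Ideal.mem_span_singleton]
    exact hxy
  have hnot : ¬ (P ∣ Ideal.span {x} ∧ P ∣ Ideal.span {y}) := by
    rintro ⟨h1, h2⟩
    rw [Ideal.dvd_span_singleton] at h1 h2
    exact hpk (dvd_of_intCast_mem hp hP (by rw [← hk]; exact P.sub_mem h2 h1))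
  have back : ∀ {z : 𝓞 K}, P ^ 2 ∣ Ideal.span {z} → (p : 𝓞 K) ∣ z := by
    intro z hz
    rwa [sq, ← hPQ, Ideal.dvd_span_singleton, Ideal.mem_span_singleton] at hz
  by_cases h1 : P ∣ Ideal.span {x}
  · have h2 : ¬ P ∣ Ideal.span {y} := fun h2 => hnot ⟨h1, h2⟩
    exact hx (back (hPprime.pow_dvd_of_dvd_mul_right 2 h2 hdvd))
  · exact hy (back (hPprime.pow_dvd_of_dvd_mul_left 2 h1 hdvd))

lemma δ_sub_intCast_not_dvd (E : IntegerModel K N) (hN : N ≠ 0) {p : ℕ} (hp : p.Prime)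
    (hp2 : p ≠ 2) (r : ℤ) : ¬ (p : 𝓞 K) ∣ E.δ - r := by
  rintro ⟨z, hz⟩
  obtain ⟨t, w, h, -⟩ := E.exists_int z
  have h1 : ((p * t : ℤ) : 𝓞 K) + ((p * w : ℤ) : 𝓞 K) * E.δ =
      ((-2 * r : ℤ) : 𝓞 K) + ((2 : ℤ) : 𝓞 K) * E.δ := by
    push_cast
    linear_combination (-2 : 𝓞 K) * hz - (p : 𝓞 K) * h
  obtain ⟨-, h2⟩ := E.coord_unique hN h1
  have h3 : (p : ℤ) ∣ (2 : ℕ) := ⟨w, by push_cast; exact h2.symm⟩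
  exact hp2 ((Nat.prime_dvd_prime_iff_eq hp Nat.prime_two).1 (Int.natCast_dvd_natCast.1 h3))

/-- The decomposition law in an imaginary quadratic field. The congruences on `N` hold for the
discriminants of such fields. For odd `p` the law is read off from `δ² = -N`; for `p = 2` it is read
off from the quadratic equation of `(1 + δ) / 2` or from that of `δ / 2`. -/
theorem decomposition (E : IntegerModel K N) (hN : N ≠ 0)
    (hN2 : N % 4 = 3 ∨ N % 16 = 4 ∨ N % 16 = 8) {p : ℕ} (hp : p.Prime) :
    (kroneckerAtPrime (-N) p = -1 ∧ ∀ P : Ideal (𝓞 K), Ideal.absNorm P ≠ p) ∨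
    (kroneckerAtPrime (-N) p = 0 ∧ ∃ P : Ideal (𝓞 K), Ideal.span {(p : 𝓞 K)} = P * P ∧
      Ideal.absNorm P = p) ∨
    (kroneckerAtPrime (-N) p = 1 ∧ ∃ P Q : Ideal (𝓞 K), P ≠ Q ∧
      Ideal.span {(p : 𝓞 K)} = P * Q ∧ Ideal.absNorm P = p ∧ Ideal.absNorm Q = p) := by
  have hδ := E.δ_sq
  by_cases hp2 : p = 2
  · subst hp2
    simp only [kroneckerAtPrime, if_true]
    rcases hN2 with h | h
    · obtain ⟨ω, hω⟩ := E.exists_half 1 (by omega)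
      have hb : (2 : ℤ) ∣ 1 + N := by omega
      obtain ⟨k, hk⟩ : ∃ k : ℤ, (1 : ℤ) ^ 2 + N = 4 * k := ⟨(1 + N) / 4, by omega⟩
      have hsq := E.omega_sq_eq hω hk
      rw [Int.cast_one, one_mul] at hsq
      by_cases h8 : N % 8 = 7
      · right; right
        refine ⟨by rw [if_pos (by omega)], ?_⟩
        obtain ⟨j, hj⟩ : 2 ∣ k := by omega
        refine E.split_of_mul hp (x := ω - 1) (y := ω) (k := 1) ⟨-j, ?_⟩ ?_ ?_ (by simp)
          (by norm_num)
        · have hj' : (k : 𝓞 K) = 2 * j := by exact_mod_cast congrArg (Int.cast : ℤ → 𝓞 K) hj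
          push_cast; linear_combination hsq - hj'
        · intro hd
          have := (E.dvd_coord hω hN hb (p := 2) (m := -1) (n := 1)
            (by push_cast at hd ⊢; rwa [one_mul, neg_add_eq_sub])).1
          norm_num at this
        · intro hd
          have := (E.dvd_coord hω hN hb (p := 2) (m := 0) (n := 1)
            (by push_cast at hd ⊢; rwa [one_mul, zero_add])).2
          norm_num at this
      · left
        refine ⟨by rw [if_neg (by omega), if_pos (by omega)], fun P hP => ?_⟩
        obtain ⟨r, hr⟩ := exists_intCast_sub_mem hp hP ω
        have hmem : ((r ^ 2 - r + k : ℤ) : 𝓞 K) ∈ P := by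
          have : ((r ^ 2 - r + k : ℤ) : 𝓞 K) = (1 - ω - r) * (ω - r) := by
            push_cast; linear_combination hsq
          rw [this]; exact P.mul_mem_left _ hr
        have h2 := dvd_of_intCast_mem hp hP hmem
        have heven : 2 ∣ r ^ 2 - r := by
          rw [← even_iff_two_dvd, sq, show r * r - r = r * (r - 1) by ring]
          exact Int.even_mul_pred_self r
        push_cast at h2
        omega
    · right; left
      obtain ⟨s, hs⟩ := E.exists_half 0 (by omega)
      have hb : (2 : ℤ) ∣ 0 + N := by omega
      obtain ⟨k, hk⟩ : ∃ k : ℤ, (0 : ℤ) ^ 2 + N = 4 * k := ⟨N / 4, by omega⟩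
      have hsq := E.omega_sq_eq hs hk
      rw [Int.cast_zero, zero_mul, zero_sub] at hsq
      refine ⟨by rw [if_neg (by omega), if_neg (by omega)], ?_⟩
      rcases h with h | h
      · obtain ⟨j, hj⟩ : 2 ∣ 1 - k := by omega
        have hj' : (1 : 𝓞 K) - k = 2 * j := by exact_mod_cast congrArg (Int.cast : ℤ → 𝓞 K) hj
        refine E.ramified_of_sq hp (t := 1 + s) ⟨s + j, ?_⟩ ?_
        · push_cast; linear_combination hsq + hj'
        · intro hd
          have := (E.dvd_coord hs hN hb (p := 2) (m := 1) (n := 1)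
            (by push_cast at hd ⊢; rwa [one_mul])).1
          norm_num at this
      · obtain ⟨j, hj⟩ : 2 ∣ k := by omega
        have hj' : (k : 𝓞 K) = 2 * j := by exact_mod_cast congrArg (Int.cast : ℤ → 𝓞 K) hj
        refine E.ramified_of_sq hp (t := s) ⟨-j, ?_⟩ ?_
        · push_cast; linear_combination hsq - hj'
        · intro hd
          have := (E.dvd_coord hs hN hb (p := 2) (m := 0) (n := 1)
            (by push_cast at hd ⊢; rwa [one_mul, zero_add])).2
          norm_num at this
  · have : Fact p.Prime := ⟨hp⟩
    rw [kroneckerAtPrime_of_ne_two hp2]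
    rcases jacobiSym.trichotomy (-(N : ℤ)) p with h | h | h
    · right; left
      refine ⟨h, ?_⟩
      have hdvd : (p : ℤ) ∣ N := by
        rw [← jacobiSym.legendreSym.to_jacobiSym, legendreSym.eq_zero_iff,
          ZMod.intCast_zmod_eq_zero_iff_dvd] at h
        exact (dvd_neg.1 h)
      obtain ⟨j, hj⟩ := hdvd
      have hj' : (N : 𝓞 K) = p * j := by exact_mod_cast congrArg (Int.cast : ℤ → 𝓞 K) hj
      refine E.ramified_of_sq hp (t := E.δ) ⟨-j, ?_⟩ ?_
      · linear_combination hδ - hj'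
      · simpa using E.δ_sub_intCast_not_dvd hN hp hp2 0
    · right; right
      refine ⟨h, ?_⟩
      obtain ⟨r', hr'⟩ := ZMod.isSquare_of_jacobiSym_eq_one h
      obtain ⟨r, rfl⟩ := ZMod.intCast_surjective r'
      have hdvd : (p : ℤ) ∣ -N - r * r := by
        rw [← ZMod.intCast_zmod_eq_zero_iff_dvd]; push_cast at hr' ⊢; rw [hr', sub_self]
      obtain ⟨j, hj⟩ := hdvd
      have hj' : -(N : 𝓞 K) - r * r = p * j := by
        have := congrArg (Int.cast : ℤ → 𝓞 K) hj
        push_cast at this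
        exact this
      refine E.split_of_mul hp (x := E.δ - r) (y := E.δ + r) (k := 2 * r) ⟨j, ?_⟩
        (E.δ_sub_intCast_not_dvd hN hp hp2 r) ?_ (by push_cast; ring) ?_
      · linear_combination hδ + hj'
      · have := E.δ_sub_intCast_not_dvd hN hp hp2 (-r)
        push_cast at this
        rwa [sub_neg_eq_add] at this
      · intro h2
        rcases (Nat.prime_iff_prime_int.1 hp).dvd_or_dvd h2 with h3 | h3
        · have h3' : (p : ℤ) ∣ (2 : ℕ) := by exact_mod_cast h3
          exact hp2 ((Nat.prime_dvd_prime_iff_eq hp Nat.prime_two).1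
            (Int.natCast_dvd_natCast.1 h3'))
        · have h4 : (p : ℤ) ∣ -N := by
            have : -(N : ℤ) = (-N - r * r) + r * r := by ring
            rw [this]
            exact dvd_add ⟨j, hj⟩ (dvd_mul_of_dvd_left h3 r)
          rw [← ZMod.intCast_zmod_eq_zero_iff_dvd, ← legendreSym.eq_zero_iff,
            jacobiSym.legendreSym.to_jacobiSym, h] at h4
          exact one_ne_zero h4
    · left
      refine ⟨h, fun P hP => ?_⟩
      obtain ⟨r, hr⟩ := exists_intCast_sub_mem hp hP E.δ
      have hmem : ((-N - r * r : ℤ) : 𝓞 K) ∈ P := by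
        have : ((-N - r * r : ℤ) : 𝓞 K) = (E.δ + r) * (E.δ - r) := by
          push_cast; linear_combination -hδ
        rw [this]; exact P.mul_mem_left _ hr
      have h2 := dvd_of_intCast_mem hp hP hmem
      rw [← ZMod.intCast_zmod_eq_zero_iff_dvd] at h2
      refine ZMod.nonsquare_of_jacobiSym_eq_neg_one h ⟨(r : ZMod p), ?_⟩
      push_cast at h2 ⊢
      exact sub_eq_zero.1 h2

/-- The coefficients `∑_{N I = n} ψ(I)` obey the relation of the Hecke operators of prime index. -/
theorem normSum_hecke (E : IntegerModel K N) (hN : N ≠ 0)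
    (hN2 : N % 4 = 3 ∨ N % 16 = 4 ∨ N % 16 = 8) {ψ : Ideal (𝓞 K) → ℂ}
    (hψ : ∀ I J, ψ (I * J) = ψ I * ψ J) (hψ1 : ψ ⊤ = 1)
    (hψp : ∀ p : ℕ, p.Prime → ψ (Ideal.span {(p : 𝓞 K)}) = (p : ℂ) ^ 2) (p m : ℕ) (hp : p.Prime) :
    normSum ψ (p * m) +
        (if p ∣ m then (kroneckerAtPrime (-N) p : ℂ) * (p : ℂ) ^ 2 * normSum ψ (m / p) else 0) =
      normSum ψ p * normSum ψ m := by
  have hn1 : ¬ p ∣ 1 := fun h => hp.ne_one (Nat.dvd_one.1 h)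
  rcases E.decomposition hN hN2 hp with ⟨h, hno⟩ | ⟨h, P, hPP, hP⟩ | ⟨h, P, Q, hne, hPQ, hP, hQ⟩
  · have h1 := E.normSum_prime_mul_of_inert hψ hp (hψp p hp) hno
    have h2 := h1 1
    rw [mul_one, if_neg hn1] at h2
    rw [h2, h1 m, h]
    split_ifs <;> push_cast <;> ring
  · have h1 := E.normSum_prime_mul_of_ramified hψ hp hPP hP
    have h2 := h1 1
    rw [mul_one, normSum_one, hψ1, mul_one] at h2
    rw [h2, h1 m, h]
    simp
  · have h1 := E.normSum_prime_mul_of_split hψ hp (hψp p hp) hPQ hP hQ hne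
    have h2 := h1 1
    rw [mul_one, normSum_one, hψ1, mul_one, if_neg hn1, add_zero] at h2
    rw [h2, ← h1 m, h]
    simp

/-- There are no ideals of inert prime norm. -/
lemma normSum_eq_zero_of_inert (E : IntegerModel K N) (hN : N ≠ 0)
    (hN2 : N % 4 = 3 ∨ N % 16 = 4 ∨ N % 16 = 8) (ψ : Ideal (𝓞 K) → ℂ) {p : ℕ} (hp : p.Prime)
    (h : kroneckerAtPrime (-N) p = -1) : normSum ψ p = 0 := by
  rcases E.decomposition hN hN2 hp with ⟨-, hno⟩ | ⟨h', -⟩ | ⟨h', -⟩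
  · refine Finset.sum_eq_zero fun I hI => ?_
    exact absurd (mem_toFinset_absNorm.1 hI) (hno I)
  · rw [h'] at h; norm_num at h
  · rw [h'] at h; norm_num at h

end IntegerModel

/-! ### The Hecke character and sums of squares over ideals -/

namespace IntegerModel

variable {K : Type*} [Field K] [NumberField K] {N : ℕ}

open Classical in
/-- The square `σ(x)²` for a principal ideal `(x)`, independent of the generator when the units
are `±1`; zero for ideals that are not principal. -/
noncomputable def genSq (E : IntegerModel K N) (I : Ideal (𝓞 K)) : ℂ :=
  if h : ∃ x, I = Ideal.span {x} then E.σ h.choose ^ 2 else 0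

lemma genSq_span (E : IntegerModel K N) (hN : 7 ≤ N) (x : 𝓞 K) :
    E.genSq (Ideal.span {x}) = E.σ x ^ 2 := by
  have h : ∃ y, Ideal.span {x} = Ideal.span {y} := ⟨x, rfl⟩
  rw [genSq, dif_pos h]
  rcases E.eq_or_eq_neg_of_span_eq hN h.choose_spec with h1 | h1
  · rw [← h1]
  · nth_rw 2 [h1]; rw [map_neg, neg_sq]

open Classical in
/-- The Hecke character with `ψ((x)) = σ(x)²` when every ideal is principal or becomes so after
multiplication by `𝔞`, where `𝔞² = (β)`. -/
noncomputable def heckeChar (E : IntegerModel K N) (𝔞 : Ideal (𝓞 K)) (β : 𝓞 K) (I : Ideal (𝓞 K)) :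
    ℂ :=
  if ∃ x, I = Ideal.span {x} then E.genSq I else E.genSq (I * 𝔞) / E.σ β

lemma heckeChar_span (E : IntegerModel K N) (hN : 7 ≤ N) (𝔞 : Ideal (𝓞 K)) (β x : 𝓞 K) :
    E.heckeChar 𝔞 β (Ideal.span {x}) = E.σ x ^ 2 := by
  rw [heckeChar, if_pos ⟨x, rfl⟩, E.genSq_span hN]

lemma exists_generator_of_mul {x : 𝓞 K} (hx : x ≠ 0) {J : Ideal (𝓞 K)}
    (h : ∃ z, Ideal.span {x} * J = Ideal.span {z}) : ∃ y, J = Ideal.span {y} := by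
  obtain ⟨z, hz⟩ := h
  have hmem : Ideal.span {x} ∣ Ideal.span {z} := ⟨J, hz.symm⟩
  obtain ⟨y, rfl⟩ := Ideal.mem_span_singleton.1 (Ideal.dvd_span_singleton.1 hmem)
  refine ⟨y, ?_⟩
  rw [← Ideal.span_singleton_mul_span_singleton] at hz
  exact mul_left_cancel₀ (by simpa using hx) hz

lemma heckeChar_principal_mul (E : IntegerModel K N) (hN : 7 ≤ N) {𝔞 : Ideal (𝓞 K)} {β : 𝓞 K}
    (hcl : ∀ I : Ideal (𝓞 K), (∃ x, I = Ideal.span {x}) ∨ ∃ x, I * 𝔞 = Ideal.span {x})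
    (x : 𝓞 K) (J : Ideal (𝓞 K)) :
    E.heckeChar 𝔞 β (Ideal.span {x} * J) = E.σ x ^ 2 * E.heckeChar 𝔞 β J := by
  by_cases hJ : ∃ y, J = Ideal.span {y}
  · obtain ⟨y, rfl⟩ := hJ
    rw [Ideal.span_singleton_mul_span_singleton, E.heckeChar_span hN, E.heckeChar_span hN, map_mul,
      mul_pow]
  · by_cases hx : x = 0
    · subst hx
      have h0 : Ideal.span {(0 : 𝓞 K)} * J = Ideal.span {(0 : 𝓞 K)} := by simp
      rw [h0, E.heckeChar_span hN, map_zero]; ring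
    · have h1 : ¬ ∃ z, Ideal.span {x} * J = Ideal.span {z} := fun h =>
        hJ (exists_generator_of_mul hx h)
      obtain ⟨y, hy⟩ := (hcl J).resolve_left hJ
      rw [heckeChar, if_neg h1, heckeChar, if_neg hJ, mul_assoc, hy,
        Ideal.span_singleton_mul_span_singleton, E.genSq_span hN, E.genSq_span hN, map_mul]
      ring

/-- The product of two nonprincipal ideals is principal; its generator is found by clearing `𝔞²`. -/
lemma heckeChar_mul (E : IntegerModel K N) (hN : 7 ≤ N) {𝔞 : Ideal (𝓞 K)} {β : 𝓞 K}
    (hcl : ∀ I : Ideal (𝓞 K), (∃ x, I = Ideal.span {x}) ∨ ∃ x, I * 𝔞 = Ideal.span {x})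
    (hβ : 𝔞 * 𝔞 = Ideal.span {β}) (hβ0 : β ≠ 0) (I J : Ideal (𝓞 K)) :
    E.heckeChar 𝔞 β (I * J) = E.heckeChar 𝔞 β I * E.heckeChar 𝔞 β J := by
  by_cases hI : ∃ x, I = Ideal.span {x}
  · obtain ⟨x, rfl⟩ := hI
    rw [E.heckeChar_principal_mul hN hcl, E.heckeChar_span hN]
  by_cases hJ : ∃ x, J = Ideal.span {x}
  · obtain ⟨x, rfl⟩ := hJ
    rw [mul_comm, E.heckeChar_principal_mul hN hcl, E.heckeChar_span hN]; ring
  obtain ⟨x, hx⟩ := (hcl I).resolve_left hI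
  obtain ⟨y, hy⟩ := (hcl J).resolve_left hJ
  have hxy : Ideal.span {β} * (I * J) = Ideal.span {x * y} := by
    rw [← Ideal.span_singleton_mul_span_singleton, ← hx, ← hy, ← hβ]; ring
  obtain ⟨z, hz⟩ := exists_generator_of_mul hβ0 ⟨_, hxy⟩
  have hσβ : E.σ β ≠ 0 := by
    rw [Ne, ← map_zero E.σ]; exact fun h => hβ0 (E.injective h)
  have e1 : E.heckeChar 𝔞 β (I * J) = E.σ z ^ 2 := by rw [hz, E.heckeChar_span hN]
  have e2 : E.σ (x * y) ^ 2 = E.σ (β * z) ^ 2 := by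
    rw [← E.genSq_span hN, ← E.genSq_span hN, ← hxy, hz, Ideal.span_singleton_mul_span_singleton]
  rw [e1, heckeChar, if_neg hI, heckeChar, if_neg hJ, hx, hy, E.genSq_span hN, E.genSq_span hN]
  rw [map_mul, map_mul] at e2
  field_simp
  linear_combination -e2

open Classical in
/-- The sum of squares over the elements of `𝔟` of given norm, by the ideals `I` with
`(γ) = I 𝔟`: each of them comes from the two elements `±γ`. -/
lemma sum_sq_eq (E : IntegerModel K N) (hN : 7 ≤ N) {𝔟 : Ideal (𝓞 K)} {A n : ℕ}
    (hA : Ideal.absNorm 𝔟 = A) (hA0 : A ≠ 0) (hn : n ≠ 0) {T : Finset (𝓞 K)}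
    (hT : ∀ γ, γ ∈ T ↔ γ ∈ 𝔟 ∧ Ideal.absNorm (Ideal.span {γ}) = n * A) :
    ∑ γ ∈ T, E.σ γ ^ 2 =
      2 * ∑ I ∈ (Ideal.finite_setOfPred_absNorm_eq (S := 𝓞 K) n).toFinset,
        if ∃ x, I * 𝔟 = Ideal.span {x} then E.genSq (I * 𝔟) else 0 := by
  have h𝔟 : 𝔟 ≠ 0 := by
    rintro rfl
    exact hA0 (by rw [← hA]; simp)
  rw [← Finset.sum_filter]
  set S := (Ideal.finite_setOfPred_absNorm_eq (S := 𝓞 K) n).toFinset.filter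
    (fun I => ∃ x, I * 𝔟 = Ideal.span {x}) with hS
  have hinj : Set.InjOn (fun I : Ideal (𝓞 K) => I * 𝔟) S := fun I _ J _ h =>
    mul_right_cancel₀ h𝔟 h
  rw [← Finset.sum_image (f := fun J => E.genSq J) hinj]
  have hmaps : ∀ γ ∈ T, Ideal.span {γ} ∈ S.image (fun I => I * 𝔟) := by
    intro γ hγ
    obtain ⟨h1, h2⟩ := (hT γ).1 hγ
    obtain ⟨I, hI⟩ := Ideal.dvd_span_singleton.2 h1
    rw [mul_comm] at hI
    refine Finset.mem_image.2 ⟨I, ?_, hI.symm⟩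
    rw [hS, Finset.mem_filter, mem_toFinset_absNorm]
    refine ⟨?_, γ, hI.symm⟩
    rw [hI, map_mul, hA] at h2
    exact Nat.eq_of_mul_eq_mul_right (Nat.pos_of_ne_zero hA0) h2
  rw [← Finset.sum_fiberwise_of_maps_to hmaps, Finset.mul_sum]
  refine Finset.sum_congr rfl fun J hJ => ?_
  obtain ⟨I, hI, rfl⟩ := Finset.mem_image.1 hJ
  rw [hS, Finset.mem_filter, mem_toFinset_absNorm] at hI
  obtain ⟨hIn, x, hx⟩ := hI
  have hx0 : x ≠ 0 := by
    rintro rfl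
    have := congrArg Ideal.absNorm hx
    rw [map_mul, hIn, hA] at this
    simp [hn, hA0] at this
  have hfib : T.filter (fun γ => Ideal.span {γ} = I * 𝔟) = {x, -x} := by
    ext γ
    rw [Finset.mem_filter, Finset.mem_insert, Finset.mem_singleton, hx]
    constructor
    · rintro ⟨-, h⟩
      exact E.eq_or_eq_neg_of_span_eq hN h
    · intro h
      have hspan : Ideal.span {γ} = Ideal.span {x} := by
        rcases h with rfl | rfl
        · rfl
        · rw [Ideal.span_singleton_neg]
      refine ⟨(hT γ).2 ⟨?_, ?_⟩, hspan⟩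
      · have : γ ∈ Ideal.span {γ} := Ideal.mem_span_singleton_self γ
        rw [hspan, ← hx] at this
        have hle : I * 𝔟 ≤ 𝔟 := Ideal.mul_le_right
        exact hle this
      · rw [hspan, ← hx, map_mul, hIn, hA]
  have hne : x ≠ -x := by
    intro h
    have : (2 : 𝓞 K) * x = 0 := by linear_combination h
    exact hx0 ((mul_eq_zero.1 this).resolve_left two_ne_zero)
  rw [hfib, Finset.sum_pair hne, hx, E.genSq_span hN, map_neg]
  ring

end IntegerModel

/-! ### Coefficients of theta series -/

lemma finite_qf_eq {A B C : ℤ} (hA : 0 < A) (hD : B ^ 2 - 4 * A * C < 0) (n : ℕ) :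
    {v : ℤ × ℤ | qf A B C v = n}.Finite := by
  obtain ⟨δ, hδ, h⟩ := qf_lower_bound hA hD
  obtain ⟨M, hM⟩ := exists_nat_ge ((n : ℝ) / δ)
  have hb : ∀ x : ℤ, (x : ℝ) ^ 2 ≤ n / δ → x ∈ Set.Icc (-(M : ℤ)) M := by
    intro x hx
    have h1 : (x ^ 2 : ℤ) ≤ M := by exact_mod_cast hx.trans hM
    have h2 : |x| ≤ x ^ 2 := by rw [← sq_abs]; exact Int.le_self_sq |x|
    exact abs_le.1 (h2.trans h1)
  refine ((Set.finite_Icc (-(M : ℤ)) M).prod (Set.finite_Icc (-(M : ℤ)) M)).subset fun v hv => ?_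
  have h1 := h v
  have hv' : qf A B C v = n := hv
  rw [hv'] at h1
  push_cast at h1
  have h2 : (v.1 : ℝ) ^ 2 + (v.2 : ℝ) ^ 2 ≤ n / δ := by
    rw [le_div_iff₀ hδ]; linarith
  exact ⟨hb _ (by nlinarith [sq_nonneg (v.2 : ℝ)]), hb _ (by nlinarith [sq_nonneg (v.1 : ℝ)])⟩

/-- The sum of `z(v)²` over the representations of `n` by the form `(A, B, C)`. -/
noncomputable def reprSum (A B C : ℤ) (N n : ℕ) : ℂ :=
  ∑ᶠ v ∈ {v : ℤ × ℤ | qf A B C v = n}, zf A B N v ^ 2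

lemma reprSum_eq {A B C : ℤ} (hA : 0 < A) (hD : B ^ 2 - 4 * A * C < 0) (N n : ℕ) :
    reprSum A B C N n = ∑ v ∈ (finite_qf_eq hA hD n).toFinset, zf A B N v ^ 2 :=
  finsum_mem_eq_finite_toFinset_sum _ _

/-- The `q`-expansion of a theta series, by collecting the vectors with the same value of the
form. -/
lemma hasSum_thetaForm {A B C : ℤ} {N : ℕ} [NeZero N] (hA : 0 < A)
    (hN : B ^ 2 - 4 * A * C = -(N : ℤ)) {t : ℂ} (ht : 0 < t.im) :
    HasSum (fun n : ℕ => reprSum A B C N n * expi (n * t)) (thetaForm A B C N t) := by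
  have hD : B ^ 2 - 4 * A * C < 0 := disc_neg hN
  have h := (summable_thetaForm hA hN ht).hasSum.tsum_fiberwise (fun v => (qf A B C v).toNat)
  refine h.congr_fun fun n => ?_
  have hset : (fun v => (qf A B C v).toNat) ⁻¹' {n} = ↑(finite_qf_eq hA hD n).toFinset := by
    ext v
    have := qf_nonneg hA hD v
    simp only [Set.mem_preimage, Set.mem_singleton_iff, Set.Finite.coe_toFinset,
      Set.mem_ofPred_eq]
    omega
  rw [hset, Finset.tsum_subtype' (finite_qf_eq hA hD n).toFinset
    (fun v => zf A B N v ^ 2 * expi (qf A B C v * t)), reprSum_eq hA hD, Finset.sum_mul]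
  refine Finset.sum_congr rfl fun v hv => ?_
  have hv' : qf A B C v = n := by simpa using hv
  rw [hv']; push_cast; rfl

/-! ### The ideals of binary forms -/

namespace IntegerModel

variable {K : Type*} [Field K] [NumberField K] {N : ℕ} {a b c : ℤ} {ω : 𝓞 K}

lemma two_dvd_add_of_disc (hform : b ^ 2 - 4 * a * c = -(N : ℤ)) : 2 ∣ b + N := by
  have h1 : Even (b ^ 2 + N) := ⟨2 * (a * c), by linear_combination hform⟩
  rw [← even_iff_two_dvd]
  rw [Int.even_add, Int.even_pow' two_ne_zero] at h1
  rwa [Int.even_add]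

lemma σ_coord (E : IntegerModel K N) (hω : 2 * ω = b + E.δ) (v : ℤ × ℤ) :
    E.σ ((a : 𝓞 K) * v.1 + v.2 * ω) = zf a b N v := by
  simp only [map_add, map_mul, map_intCast, E.σ_omega hω, zf]
  ring

lemma absNorm_coord (E : IntegerModel K N) (hω : 2 * ω = b + E.δ)
    (hform : b ^ 2 - 4 * a * c = -(N : ℤ)) (v : ℤ × ℤ) :
    (Ideal.absNorm (Ideal.span {(a : 𝓞 K) * v.1 + v.2 * ω}) : ℤ) = a * qf a b c v := by
  have h := E.absNorm_span ((a : 𝓞 K) * v.1 + v.2 * ω)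
  rw [E.σ_coord hω, Complex.normSq_eq_norm_sq, norm_zf_sq hform] at h
  exact_mod_cast h

lemma coord_injective (E : IntegerModel K N) (hω : 2 * ω = b + E.δ) (hN : N ≠ 0) (ha : a ≠ 0) :
    Function.Injective (fun v : ℤ × ℤ => (a : 𝓞 K) * v.1 + v.2 * ω) := by
  intro v w h
  have h' : ((a * v.1 : ℤ) : 𝓞 K) + v.2 * ω = ((a * w.1 : ℤ) : 𝓞 K) + w.2 * ω := by
    push_cast; exact h
  obtain ⟨h1, h2⟩ := E.coord_omega_unique hω hN h'
  exact Prod.ext (mul_left_cancel₀ ha h1) h2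

open Classical in
/-- The coefficients of the theta series of a form, as sums over the ideals in the class inverse to
that of the ideal `𝔟 = ℤ a + ℤ ω` of the form. -/
lemma reprSum_eq_sum (E : IntegerModel K N) (hN : 7 ≤ N) (hω : 2 * ω = b + E.δ) (ha : 0 < a)
    (hform : b ^ 2 - 4 * a * c = -(N : ℤ)) {𝔟 : Ideal (𝓞 K)}
    (h𝔟 : ∀ x, x ∈ 𝔟 ↔ ∃ v : ℤ × ℤ, x = (a : 𝓞 K) * v.1 + v.2 * ω)
    (hnorm : (Ideal.absNorm 𝔟 : ℤ) = a) {n : ℕ} (hn : n ≠ 0) :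
    reprSum a b c N n = 2 * ∑ I ∈ (Ideal.finite_setOfPred_absNorm_eq (S := 𝓞 K) n).toFinset,
        if ∃ x, I * 𝔟 = Ideal.span {x} then E.genSq (I * 𝔟) else 0 := by
  have : NeZero N := ⟨by omega⟩
  have hD : b ^ 2 - 4 * a * c < 0 := disc_neg hform
  have hinj := E.coord_injective hω (by omega) ha.ne'
  rw [← E.sum_sq_eq hN rfl (A := Ideal.absNorm 𝔟) (by omega) hn
    (T := (finite_qf_eq ha hD n).toFinset.image (fun v => (a : 𝓞 K) * v.1 + v.2 * ω)),
    Finset.sum_image (fun v _ w _ h => hinj h), reprSum_eq ha hD]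
  · exact Finset.sum_congr rfl fun v _ => by rw [E.σ_coord hω]
  · have key : ∀ v : ℤ × ℤ, qf a b c v = n ↔
        Ideal.absNorm (Ideal.span {(a : 𝓞 K) * v.1 + v.2 * ω}) = n * Ideal.absNorm 𝔟 := by
      intro v
      have h1 := E.absNorm_coord hω hform v
      rw [← Int.natCast_inj, h1]
      push_cast
      rw [hnorm, mul_comm (n : ℤ), mul_right_inj' ha.ne']
    intro γ
    rw [Finset.mem_image, h𝔟]
    constructor
    · rintro ⟨v, hv, rfl⟩
      exact ⟨⟨v, rfl⟩, (key v).1 (by simpa using hv)⟩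
    · rintro ⟨⟨v, rfl⟩, h⟩
      exact ⟨v, by simpa using (key v).2 h, rfl⟩

lemma mem_top_iff (E : IntegerModel K N) (hω : 2 * ω = b + E.δ)
    (hb : 2 ∣ b + N) (x : 𝓞 K) :
    x ∈ (⊤ : Ideal (𝓞 K)) ↔ ∃ v : ℤ × ℤ, x = ((1 : ℤ) : 𝓞 K) * v.1 + v.2 * ω := by
  refine ⟨fun _ => ?_, fun _ => Submodule.mem_top⟩
  obtain ⟨m, n, h⟩ := E.exists_coord hω hb x
  exact ⟨(m, n), by rw [h]; simp⟩

/-- The ideal `(a, ω)` is the lattice `ℤ a + ℤ ω`. -/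
lemma mem_span_pair_iff (E : IntegerModel K N) (hω : 2 * ω = b + E.δ)
    (hform : b ^ 2 - 4 * a * c = -(N : ℤ)) (x : 𝓞 K) :
    x ∈ Ideal.span {(a : 𝓞 K), ω} ↔ ∃ v : ℤ × ℤ, x = (a : 𝓞 K) * v.1 + v.2 * ω := by
  have hb := two_dvd_add_of_disc hform
  have hsq := E.omega_sq_eq hω (k := a * c) (by linear_combination hform)
  push_cast at hsq
  rw [Ideal.mem_span_pair]
  constructor
  · rintro ⟨y, z, rfl⟩
    obtain ⟨p, q, rfl⟩ := E.exists_coord hω hb y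
    obtain ⟨r, s, rfl⟩ := E.exists_coord hω hb z
    refine ⟨(p - s * c, q * a + r + s * b), ?_⟩
    push_cast
    linear_combination (s : 𝓞 K) * hsq
  · rintro ⟨v, rfl⟩
    exact ⟨v.1, v.2, by ring⟩

/-- The integers `0, …, a - 1` represent the residue classes modulo `ℤ a + ℤ ω`. -/
lemma absNorm_span_pair (E : IntegerModel K N) (hN : N ≠ 0) (hω : 2 * ω = b + E.δ)
    (hform : b ^ 2 - 4 * a * c = -(N : ℤ)) (ha : 0 < a) :
    (Ideal.absNorm (Ideal.span {(a : 𝓞 K), ω}) : ℤ) = a := by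
  set 𝔞 := Ideal.span {(a : 𝓞 K), ω} with h𝔞
  have hmem := E.mem_span_pair_iff hω hform
  have hωmem : ω ∈ 𝔞 := Ideal.subset_span (by simp)
  have hamem : (a : 𝓞 K) ∈ 𝔞 := Ideal.subset_span (by simp)
  have hbij : Function.Bijective
      (fun i : Fin a.toNat => Ideal.Quotient.mk 𝔞 (((i : ℕ) : ℤ) : 𝓞 K)) := by
    constructor
    · intro i j hij
      rw [Ideal.Quotient.eq, hmem] at hij
      obtain ⟨v, hv⟩ := hij
      have h1 : ((((i : ℕ) : ℤ) - ((j : ℕ) : ℤ) : ℤ) : 𝓞 K) + ((0 : ℤ) : 𝓞 K) * ω =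
          ((a * v.1 : ℤ) : 𝓞 K) + v.2 * ω := by push_cast at hv ⊢; rw [← hv]; ring
      obtain ⟨h2, -⟩ := E.coord_omega_unique hω hN h1
      have hi := i.isLt
      have hj := j.isLt
      have h3 : v.1 = 0 := by
        by_contra h0
        rcases lt_or_gt_of_ne h0 with h0 | h0
        · nlinarith [Int.toNat_of_nonneg ha.le]
        · nlinarith [Int.toNat_of_nonneg ha.le]
      rw [h3] at h2
      exact Fin.ext (by omega)
    · intro x
      obtain ⟨x, rfl⟩ := Ideal.Quotient.mk_surjective x
      obtain ⟨m, n, rfl⟩ := E.exists_coord hω (two_dvd_add_of_disc hform) x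
      have h1 := Int.emod_nonneg m ha.ne'
      have h2 := Int.emod_lt_of_pos m ha
      refine ⟨⟨(m % a).toNat, by omega⟩, ?_⟩
      rw [Ideal.Quotient.eq]
      simp only [Int.toNat_of_nonneg h1]
      have h3 : ((m % a : ℤ) : 𝓞 K) = m - a * ((m / a : ℤ) : 𝓞 K) := by
        have := congrArg (Int.cast : ℤ → 𝓞 K) (Int.emod_add_mul_ediv m a)
        push_cast at this
        linear_combination this
      rw [h3]
      have h4 : (m : 𝓞 K) - a * ((m / a : ℤ) : 𝓞 K) - (m + n * ω) =
          -(((m / a : ℤ) : 𝓞 K) * a) - n * ω := by ring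
      rw [h4]
      exact 𝔞.sub_mem (𝔞.neg_mem (𝔞.mul_mem_left _ hamem)) (𝔞.mul_mem_left _ hωmem)
  have hcard := Nat.card_eq_of_bijective _ hbij
  rw [Nat.card_eq_fintype_card, Fintype.card_fin] at hcard
  rw [Ideal.absNorm_apply, Submodule.cardQuot_apply, ← hcard]
  exact Int.toNat_of_nonneg ha.le

end IntegerModel

/-! ### Eigenforms from theta series -/

lemma neg_natAbs_fieldDisc (d : ℕ) : -((fieldDisc d).natAbs : ℤ) = fieldDisc d := by
  unfold fieldDisc; split_ifs <;> omega

lemma seven_le_natAbs_fieldDisc {d : ℕ} (hd : Squarefree d) (hd1 : d ≠ 1) (hd3 : d ≠ 3) :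
    7 ≤ (fieldDisc d).natAbs := by
  have := hd.ne_zero
  unfold fieldDisc; split_ifs <;> omega

lemma natAbs_fieldDisc_mod {d : ℕ} (hd : Squarefree d) :
    (fieldDisc d).natAbs % 4 = 3 ∨ (fieldDisc d).natAbs % 16 = 4 ∨
      (fieldDisc d).natAbs % 16 = 8 := by
  have := mod_four_ne_zero_of_squarefree hd
  unfold fieldDisc; split_ifs <;> omega

section

variable {K : Type*} [Field K] [NumberField K] {d : ℕ}

/-- A theta series whose coefficients are the sums of a Hecke character over the ideals of given
norm is an eigenform with complex multiplication. -/
theorem isCMEigenform_of_hasSum_normSum (hd : Squarefree d) (hd1 : d ≠ 1) (hd3 : d ≠ 3)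
    (E : IntegerModel K (fieldDisc d).natAbs) {ψ : Ideal (𝓞 K) → ℂ}
    (hψ : ∀ I J, ψ (I * J) = ψ I * ψ J) (hψspan : ∀ x, ψ (Ideal.span {x}) = E.σ x ^ 2)
    {f : ℍ → ℂ}
    (hcusp : ∀ χ : DirichletCharacter ℂ (fieldDisc d).natAbs,
      (∀ p : ℕ, p.Prime → p ≠ 2 →
        χ (p : ZMod _) = (jacobiSym (-(fieldDisc d).natAbs) p : ℂ)) → χ (-1) = -1 →
      IsCuspFormWithCharacter 3 χ f)
    (hf : ∀ τ : ℍ, HasSum (fun m : ℕ => normSum ψ m * expi (m * τ)) (f τ)) :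
    IsCMEigenformOfWeightThree d f := by
  have hN7 := seven_le_natAbs_fieldDisc hd hd1 hd3
  have hN : (fieldDisc d).natAbs ≠ 0 := by omega
  have hN2 := natAbs_fieldDisc_mod hd
  obtain ⟨χ, hχ, hχ1⟩ := exists_kronecker_character hd
  have hcusp' : IsCuspFormWithCharacter 3 χ f := hcusp χ (fun p hp hp2 => by
    rw [hχ p hp, kroneckerAtPrime_of_ne_two hp2, neg_natAbs_fieldDisc]) hχ1
  have hψ1 : ψ ⊤ = 1 := by
    rw [← Ideal.span_singleton_one, hψspan, map_one, one_pow]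
  have hψp : ∀ p : ℕ, p.Prime → ψ (Ideal.span {(p : 𝓞 K)}) = (p : ℂ) ^ 2 := fun p _ => by
    rw [hψspan, map_natCast]
  refine ⟨χ, hχ, isNormalizedHeckeEigenform_of_hasSum hcusp' hf ?_ ?_, ?_, ?_⟩
  · rw [normSum_one, hψ1]
  · intro p m hp
    rw [hχ p hp, ← neg_natAbs_fieldDisc]
    exact E.normSum_hecke hN hN2 hψ hψ1 hψp p m hp
  · rintro rfl
    rw [MulChar.one_apply (isUnit_one.neg)] at hχ1
    norm_num at hχ1
  · intro p hp hpN
    rw [fourierCoeff_eq hcusp' hf, hχ p hp, ← neg_natAbs_fieldDisc]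
    rcases E.decomposition hN hN2 hp with ⟨h, -⟩ | ⟨h, -⟩ | ⟨h, -⟩
    · rw [E.normSum_eq_zero_of_inert hN hN2 ψ hp h, mul_zero]
    · exfalso
      have h1 : χ p = 0 := by
        rw [hχ p hp, ← neg_natAbs_fieldDisc, h, Int.cast_zero]
      have hu : IsUnit ((p : ℕ) : ZMod (fieldDisc d).natAbs) := by
        rw [ZMod.isUnit_iff_coprime]
        exact (Nat.Prime.coprime_iff_not_dvd hp).2 hpN
      exact (hu.map χ).ne_zero h1
    · rw [h]; simp

lemma reprSum_zero {A B C : ℤ} {N : ℕ} (hA : 0 < A) (hN : B ^ 2 - 4 * A * C < 0) :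
    reprSum A B C N 0 = 0 := by
  rw [reprSum_eq hA hN]
  refine Finset.sum_eq_zero fun v hv => ?_
  have hv' : qf A B C v = 0 := by simpa using hv
  have : v = 0 := by
    by_contra h
    exact (qf_pos hA hN h).ne' hv'
  rw [this]; simp [zf]

variable {b₀ c₀ : ℤ}

/-- The theta series of the ring of integers is an eigenform if all ideals are principal. -/
theorem isCMEigenform_of_principal (hd : Squarefree d) (hd1 : d ≠ 1) (hd3 : d ≠ 3)
    (E : IntegerModel K (fieldDisc d).natAbs) (hform₀ : b₀ ^ 2 - 4 * 1 * c₀ = fieldDisc d)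
    (hcl : ∀ I : Ideal (𝓞 K), ∃ x, I = Ideal.span {x}) :
    IsCMEigenformOfWeightThree d
      ((1 / 2 : ℂ) • thetaH 1 b₀ c₀ (fieldDisc d).natAbs) := by
  classical
  have hN7 := seven_le_natAbs_fieldDisc hd hd1 hd3
  have : NeZero (fieldDisc d).natAbs := ⟨by omega⟩
  rw [← neg_natAbs_fieldDisc] at hform₀
  obtain ⟨ω, hω⟩ := E.exists_half b₀ (IntegerModel.two_dvd_add_of_disc hform₀)
  have htop : (⊤ : Ideal (𝓞 K)) * ⊤ = Ideal.span {1} := by simp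
  refine isCMEigenform_of_hasSum_normSum hd hd1 hd3 E (ψ := E.heckeChar ⊤ 1)
    (E.heckeChar_mul hN7 (fun I => Or.inl (hcl I)) htop one_ne_zero)
    (E.heckeChar_span hN7 ⊤ 1) (fun χ hχ hχ1 =>
      (isCuspFormWithCharacter_thetaH one_pos hform₀ hχ hχ1).const_smul _) fun τ => ?_
  refine ((hasSum_thetaForm one_pos hform₀ τ.im_pos).mul_left (1 / 2 : ℂ)).congr_fun fun n => ?_
  rw [← mul_assoc]
  congr 1
  rcases Nat.eq_zero_or_pos n with rfl | hn
  · rw [reprSum_zero one_pos (disc_neg hform₀), normSum_zero,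
      ← Ideal.span_singleton_zero, E.heckeChar_span hN7]
    simp
  · rw [E.reprSum_eq_sum hN7 hω one_pos hform₀ (𝔟 := ⊤)
      (E.mem_top_iff hω (IntegerModel.two_dvd_add_of_disc hform₀)) (by simp) hn.ne', ← mul_assoc,
      show (1 / 2 : ℂ) * 2 = 1 by norm_num, one_mul, normSum]
    refine Finset.sum_congr rfl fun I _ => ?_
    rw [Ideal.mul_top, IntegerModel.heckeChar, if_pos (hcl I), if_pos (hcl I)]

/-- If there are two ideal classes, the eigenform is a combination of the theta series of the two
classes; the coefficient of the second is determined by a generator of the square of an ideal in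
the nonprincipal class. -/
theorem isCMEigenform_of_two_classes (hd : Squarefree d) (hd1 : d ≠ 1) (hd3 : d ≠ 3)
    (E : IntegerModel K (fieldDisc d).natAbs) (hform₀ : b₀ ^ 2 - 4 * 1 * c₀ = fieldDisc d)
    {a b c : ℤ} {ω β : 𝓞 K} (hω : 2 * ω = b + E.δ) (ha : 0 < a)
    (hform : b ^ 2 - 4 * a * c = fieldDisc d)
    (hcl : ∀ I : Ideal (𝓞 K), (∃ x, I = Ideal.span {x}) ∨
      ∃ x, I * Ideal.span {(a : 𝓞 K), ω} = Ideal.span {x})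
    (hnp : ¬ ∃ x, Ideal.span {(a : 𝓞 K), ω} = Ideal.span {x})
    (hβ : Ideal.span {(a : 𝓞 K), ω} * Ideal.span {(a : 𝓞 K), ω} = Ideal.span {β}) :
    IsCMEigenformOfWeightThree d
      ((1 / 2 : ℂ) • thetaH 1 b₀ c₀ (fieldDisc d).natAbs +
        (1 / (2 * E.σ β)) • thetaH a b c (fieldDisc d).natAbs) := by
  classical
  have hN7 := seven_le_natAbs_fieldDisc hd hd1 hd3
  have : NeZero (fieldDisc d).natAbs := ⟨by omega⟩
  rw [← neg_natAbs_fieldDisc] at hform₀ hform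
  obtain ⟨ω₀, hω₀⟩ := E.exists_half b₀ (IntegerModel.two_dvd_add_of_disc hform₀)
  set 𝔞 := Ideal.span {(a : 𝓞 K), ω} with h𝔞
  have hβ0 : β ≠ 0 := by
    rintro rfl
    rw [Ideal.span_singleton_zero, ← Ideal.zero_eq_bot, mul_self_eq_zero] at hβ
    exact hnp ⟨0, by rw [hβ, Ideal.span_singleton_zero, Ideal.zero_eq_bot]⟩
  have hσβ : E.σ β ≠ 0 := by
    rw [Ne, ← map_zero E.σ]; exact fun h => hβ0 (E.injective h)
  refine isCMEigenform_of_hasSum_normSum hd hd1 hd3 E (ψ := E.heckeChar 𝔞 β)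
    (E.heckeChar_mul hN7 hcl hβ hβ0)
    (E.heckeChar_span hN7 𝔞 β) (fun χ hχ hχ1 =>
      ((isCuspFormWithCharacter_thetaH one_pos hform₀ hχ hχ1).const_smul _).add
        ((isCuspFormWithCharacter_thetaH ha hform hχ hχ1).const_smul _)) fun τ => ?_
  refine (((hasSum_thetaForm one_pos hform₀ τ.im_pos).mul_left (1 / 2 : ℂ)).add
    ((hasSum_thetaForm ha hform τ.im_pos).mul_left (1 / (2 * E.σ β)))).congr_fun fun n => ?_
  rw [← mul_assoc, ← mul_assoc, ← add_mul]
  congr 1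
  rcases Nat.eq_zero_or_pos n with rfl | hn
  · rw [reprSum_zero one_pos (disc_neg hform₀), reprSum_zero ha (disc_neg hform), normSum_zero,
      ← Ideal.span_singleton_zero, E.heckeChar_span hN7]
    simp
  · rw [E.reprSum_eq_sum hN7 hω₀ one_pos hform₀ (𝔟 := ⊤)
      (E.mem_top_iff hω₀ (IntegerModel.two_dvd_add_of_disc hform₀)) (by simp) hn.ne', ← mul_assoc,
      show (1 / 2 : ℂ) * 2 = 1 by norm_num, one_mul, normSum,
      E.reprSum_eq_sum hN7 hω ha hform (𝔟 := 𝔞) (E.mem_span_pair_iff hω hform)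
      (E.absNorm_span_pair (by omega) hω hform ha) hn.ne', ← mul_assoc,
      show 1 / (2 * E.σ β) * 2 = 1 / E.σ β by field_simp, Finset.mul_sum,
      ← Finset.sum_add_distrib]
    refine Finset.sum_congr rfl fun I hI => ?_
    rw [mem_toFinset_absNorm] at hI
    rw [Ideal.mul_top, IntegerModel.heckeChar]
    by_cases hp : ∃ x, I = Ideal.span {x}
    · have hnot : ¬ ∃ x, I * 𝔞 = Ideal.span {x} := by
        rintro h
        obtain ⟨x, rfl⟩ := hp
        have hx : x ≠ 0 := by
          rintro rfl
          rw [Ideal.span_singleton_zero, Ideal.absNorm_bot] at hI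
          omega
        exact hnp (IntegerModel.exists_generator_of_mul hx h)
      rw [if_pos hp, if_neg hnot, if_pos hp]; ring
    · rw [if_neg hp, if_pos ((hcl I).resolve_left hp), if_neg hp]; ring

end

/-! ### Reduced forms and ideal classes -/

/-- A form of fundamental discriminant is primitive. -/
lemma not_prime_dvd_form {d : ℕ} (hd : Squarefree d) {a b c : ℤ}
    (hform : b ^ 2 - 4 * a * c = fieldDisc d) {p : ℕ} (hp : p.Prime) :
    ¬ ((p : ℤ) ∣ a ∧ (p : ℤ) ∣ b ∧ (p : ℤ) ∣ c) := by
  rintro ⟨⟨a', rfl⟩, ⟨b', rfl⟩, ⟨c', rfl⟩⟩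
  have h4 := mod_four_ne_zero_of_squarefree hd
  have hsqf : ¬ ((p : ℤ) ^ 2 ∣ d) := by
    intro h
    have h1 : p * p ∣ d := by rw [← sq]; exact_mod_cast h
    exact hp.one_lt.ne' (Nat.isUnit_iff.1 (hd p h1))
  have hD : (p : ℤ) ^ 2 * (b' ^ 2 - 4 * a' * c') = fieldDisc d := by rw [← hform]; ring
  unfold fieldDisc at hD
  split_ifs at hD with h3
  · exact hsqf (by rw [← dvd_neg]; exact ⟨_, hD.symm⟩)
  · by_cases hp2 : p = 2
    · subst hp2
      have hd' : b' ^ 2 - 4 * (a' * c') = -d := by push_cast at hD; linarith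
      rcases Int.even_or_odd b' with h | h
      · obtain ⟨k, rfl⟩ := h.two_dvd
        rw [mul_pow] at hd'
        omega
      · have := Int.sq_mod_four_eq_one_of_odd h
        omega
    · have hco : IsCoprime ((p : ℤ) ^ 2) 4 := by
        have h2 : Nat.Coprime (p ^ 2) (2 ^ 2) :=
          Nat.Coprime.pow _ _ ((Nat.coprime_primes hp Nat.prime_two).2 hp2)
        exact_mod_cast Nat.isCoprime_iff_coprime.2 h2
      refine hsqf (hco.dvd_of_dvd_mul_left (y := (4 : ℤ)) ?_)
      rw [← dvd_neg]
      exact ⟨_, by rw [hD]; ring⟩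

lemma isCoprime_of_primitive {a b c : ℤ}
    (h : ∀ p : ℕ, p.Prime → ¬ ((p : ℤ) ∣ a ∧ (p : ℤ) ∣ b ∧ (p : ℤ) ∣ c)) (hc : a ∣ c) :
    IsCoprime a b := by
  rw [Int.isCoprime_iff_gcd_eq_one]
  by_contra hne
  obtain ⟨p, hp, hpd⟩ := Nat.exists_prime_and_dvd hne
  have h1 : (p : ℤ) ∣ a := (Int.natCast_dvd_natCast.2 hpd).trans (Int.gcd_dvd_left a b)
  have h2 : (p : ℤ) ∣ b := (Int.natCast_dvd_natCast.2 hpd).trans (Int.gcd_dvd_right a b)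
  exact h p hp ⟨h1, h2, h1.trans hc⟩

/-- A reduced form takes values at least `c` off the first axis. -/
lemma le_qf_of_reduced {a b c : ℤ} (h : IsReducedForm a b c) {v : ℤ × ℤ} (hv : v.2 ≠ 0) :
    c ≤ qf a b c v := by
  obtain ⟨ha, hba, hac, -⟩ := h
  have h1 : 1 ≤ v.2 ^ 2 := Order.one_le_iff_pos.2 (by positivity)
  have h2 : -(a * (|v.1| * |v.2|)) ≤ b * v.1 * v.2 := by
    have h3 : |b * v.1 * v.2| ≤ a * (|v.1| * |v.2|) := by
      rw [mul_assoc, abs_mul, abs_mul]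
      exact mul_le_mul_of_nonneg_right hba (by positivity)
    exact (neg_le_neg h3).trans (neg_abs_le _)
  have h4 : 1 ≤ v.1 ^ 2 - |v.1| * |v.2| + v.2 ^ 2 := by
    rw [← sq_abs v.2] at h1
    rw [← sq_abs v.1, ← sq_abs v.2]
    have : 0 < |v.2| := abs_pos.2 hv
    nlinarith [sq_nonneg (2 * |v.1| - |v.2|)]
  simp only [qf]
  nlinarith

lemma le_qf_of_reduced_of_ne_zero {a b c : ℤ} (h : IsReducedForm a b c) {v : ℤ × ℤ} (hv : v ≠ 0) :
    a ≤ qf a b c v := by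
  by_cases h2 : v.2 = 0
  · have h1 : v.1 ≠ 0 := fun h1 => hv (Prod.ext h1 h2)
    have h3 : 0 < v.1 ^ 2 := by positivity
    simp only [qf, h2]
    nlinarith [h.1]
  · exact h.2.2.1.trans (le_qf_of_reduced h h2)

section

variable {K : Type*} [Field K] [NumberField K]

lemma exists_generator_of_classNumber_one (h : classNumber K = 1) (I : Ideal (𝓞 K)) :
    ∃ x, I = Ideal.span {x} := by
  have := classNumber_eq_one_iff.1 h
  obtain ⟨x, hx⟩ := (IsPrincipalIdealRing.principal I).principal
  exact ⟨x, hx⟩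

lemma exists_generator_or_of_classNumber_two (h : classNumber K = 2) {𝔞 : Ideal (𝓞 K)}
    (hnp : ¬ ∃ x, 𝔞 = Ideal.span {x}) (I : Ideal (𝓞 K)) :
    (∃ x, I = Ideal.span {x}) ∨ ∃ x, I * 𝔞 = Ideal.span {x} := by
  by_cases hI0 : I = 0
  · left; exact ⟨0, by rw [hI0, Ideal.span_singleton_zero, Ideal.zero_eq_bot]⟩
  have h𝔞0 : 𝔞 ≠ 0 := fun h0 => hnp ⟨0, by rw [h0, Ideal.span_singleton_zero, Ideal.zero_eq_bot]⟩
  by_cases hI : ∃ x, I = Ideal.span {x}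
  · exact Or.inl hI
  right
  have hone : ∀ {J : Ideal (𝓞 K)} (hJ : J ∈ nonZeroDivisors (Ideal (𝓞 K))),
      ClassGroup.mk0 ⟨J, hJ⟩ = 1 ↔ ∃ x, J = Ideal.span {x} := fun hJ =>
    (ClassGroup.mk0_eq_one_iff hJ).trans ⟨fun h => h.principal, fun h => ⟨h⟩⟩
  have hIm := mem_nonZeroDivisors_of_ne_zero hI0
  have h𝔞m := mem_nonZeroDivisors_of_ne_zero h𝔞0
  rw [← hone (mul_mem hIm h𝔞m)]
  have hmul : ClassGroup.mk0 ⟨I * 𝔞, mul_mem hIm h𝔞m⟩ =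
      ClassGroup.mk0 ⟨I, hIm⟩ * ClassGroup.mk0 ⟨𝔞, h𝔞m⟩ := by
    rw [← map_mul]; rfl
  rw [hmul]
  have h1 : ClassGroup.mk0 ⟨I, hIm⟩ ≠ 1 := fun h1 => hI ((hone hIm).1 h1)
  have h2 : ClassGroup.mk0 ⟨𝔞, h𝔞m⟩ ≠ 1 := fun h2 => hnp ((hone h𝔞m).1 h2)
  have hcard : Nat.card (ClassGroup (𝓞 K)) = 2 := by
    rw [Nat.card_eq_fintype_card]; exact h
  -- in a group of order two, all nontrivial elements agree and are of order two
  have hsq : ClassGroup.mk0 ⟨I, hIm⟩ ^ 2 = 1 := by rw [← hcard]; exact pow_card_eq_one'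
  have heq : ClassGroup.mk0 ⟨I, hIm⟩ = ClassGroup.mk0 ⟨𝔞, h𝔞m⟩ := by
    obtain ⟨x, hx⟩ := (Nat.card_eq_two_iff' (1 : ClassGroup (𝓞 K))).1 hcard
    rw [hx.2 _ h1, hx.2 _ h2]
  rw [← heq, ← sq, hsq]

variable {N : ℕ} {a b c : ℤ} {ω : 𝓞 K}

namespace IntegerModel

/-- The ideal of a reduced form with `a ≠ 1` is not principal, as the form does not represent
one. -/
lemma not_principal_of_reduced (E : IntegerModel K N) (hN : N ≠ 0) (hω : 2 * ω = b + E.δ)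
    (hform : b ^ 2 - 4 * a * c = -(N : ℤ)) (hred : IsReducedForm a b c) (ha1 : a ≠ 1) :
    ¬ ∃ x, Ideal.span {(a : 𝓞 K), ω} = Ideal.span {x} := by
  rintro ⟨x, hx⟩
  have ha := hred.1
  obtain ⟨v, rfl⟩ := (E.mem_span_pair_iff hω hform x).1 (by
    rw [hx]; exact Ideal.mem_span_singleton_self x)
  have h1 := E.absNorm_span_pair hN hω hform ha
  rw [hx, E.absNorm_coord hω hform] at h1
  have h2 : qf a b c v = 1 := mul_left_cancel₀ ha.ne' (by rw [h1, mul_one])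
  have hv : v ≠ 0 := by
    rintro rfl
    simp [qf] at h2
  have := le_qf_of_reduced_of_ne_zero hred hv
  omega

/-- The square of the ideal of a form with `a ∣ b` is `(a)`: it contains `a²` and
`a c = k a ω - ω²` for `b = k a`, and `a`, `c` are coprime. -/
lemma span_pair_sq_of_dvd (E : IntegerModel K N) (hω : 2 * ω = b + E.δ)
    (hform : b ^ 2 - 4 * a * c = -(N : ℤ)) (hab : a ∣ b) (hco : IsCoprime a c) :
    Ideal.span {(a : 𝓞 K), ω} * Ideal.span {(a : 𝓞 K), ω} = Ideal.span {(a : 𝓞 K)} := by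
  have hsq := E.omega_sq_eq hω (k := a * c) (by linear_combination hform)
  obtain ⟨k, rfl⟩ := hab
  obtain ⟨u, v, huv⟩ := hco
  have huv' : (u : 𝓞 K) * a + v * c = 1 := by exact_mod_cast congrArg (Int.cast : ℤ → 𝓞 K) huv
  push_cast at hsq
  have hωm : ω ∈ Ideal.span {(a : 𝓞 K), ω} := Ideal.subset_span (by simp)
  have ham : (a : 𝓞 K) ∈ Ideal.span {(a : 𝓞 K), ω} := Ideal.subset_span (by simp)
  apply le_antisymm
  · rw [Ideal.span_pair_mul_span_pair, Ideal.span_le]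
    intro x hx
    simp only [Set.mem_insert_iff, Set.mem_singleton_iff] at hx
    rw [SetLike.mem_coe, Ideal.mem_span_singleton]
    rcases hx with rfl | rfl | rfl | rfl
    · exact dvd_mul_right _ _
    · exact dvd_mul_right _ _
    · exact dvd_mul_left _ _
    · exact ⟨k * ω - c, by linear_combination hsq⟩
  · rw [Ideal.span_singleton_le_iff_mem]
    have : (a : 𝓞 K) = u * (a * a) + v * (k * (a * ω) - ω * ω) := by
      linear_combination (-(a : 𝓞 K)) * huv' + (v : 𝓞 K) * hsq
    have key := Ideal.add_mem _ (Ideal.mul_mem_left _ (u : 𝓞 K) (Ideal.mul_mem_mul ham ham))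
      (Ideal.mul_mem_left _ (v : 𝓞 K) (Ideal.sub_mem _
        (Ideal.mul_mem_left _ (k : 𝓞 K) (Ideal.mul_mem_mul ham hωm)) (Ideal.mul_mem_mul hωm hωm)))
    rwa [← this] at key

/-- The square of the ideal of a form with `a = c` is `(ω)`: it contains `a ω` and `b ω = ω² + a²`,
and `a`, `b` are coprime. -/
lemma span_pair_sq_of_eq (E : IntegerModel K N) (hω : 2 * ω = b + E.δ)
    (hform : b ^ 2 - 4 * a * a = -(N : ℤ)) (hco : IsCoprime a b) :
    Ideal.span {(a : 𝓞 K), ω} * Ideal.span {(a : 𝓞 K), ω} = Ideal.span {ω} := by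
  have hsq := E.omega_sq_eq hω (k := a * a) (by linear_combination hform)
  obtain ⟨u, v, huv⟩ := hco
  have huv' : (u : 𝓞 K) * a + v * b = 1 := by exact_mod_cast congrArg (Int.cast : ℤ → 𝓞 K) huv
  push_cast at hsq
  have hωm : ω ∈ Ideal.span {(a : 𝓞 K), ω} := Ideal.subset_span (by simp)
  have ham : (a : 𝓞 K) ∈ Ideal.span {(a : 𝓞 K), ω} := Ideal.subset_span (by simp)
  apply le_antisymm
  · rw [Ideal.span_pair_mul_span_pair, Ideal.span_le]
    intro x hx
    simp only [Set.mem_insert_iff, Set.mem_singleton_iff] at hx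
    rw [SetLike.mem_coe, Ideal.mem_span_singleton]
    rcases hx with rfl | rfl | rfl | rfl
    · exact ⟨b - ω, by linear_combination hsq⟩
    · exact dvd_mul_left _ _
    · exact dvd_mul_right _ _
    · exact dvd_mul_right _ _
  · rw [Ideal.span_singleton_le_iff_mem]
    have : ω = u * (a * ω) + v * (ω * ω + a * a) := by
      linear_combination (-ω) * huv' - (v : 𝓞 K) * hsq
    have key := Ideal.add_mem _ (Ideal.mul_mem_left _ (u : 𝓞 K) (Ideal.mul_mem_mul ham hωm))
      (Ideal.mul_mem_left _ (v : 𝓞 K) (Ideal.add_mem _ (Ideal.mul_mem_mul hωm hωm)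
        (Ideal.mul_mem_mul ham ham)))
    rwa [← this] at key

/-- If the square of the ideal of a reduced form is principal, the form is ambiguous: the generator
`β = a m + n ω` of the square has norm `a²`, so the form takes its minimum `a` at `(m, n)`. Either
`n ≠ 0` and `a = c`, or `β = ±a`, and then `a` divides `ω² = b ω - a c`. -/
lemma ambiguous_of_sq_principal (E : IntegerModel K N) (hN : N ≠ 0) (hω : 2 * ω = b + E.δ)
    (hform : b ^ 2 - 4 * a * c = -(N : ℤ)) (hred : IsReducedForm a b c) {β : 𝓞 K}
    (hβ : Ideal.span {(a : 𝓞 K), ω} * Ideal.span {(a : 𝓞 K), ω} = Ideal.span {β}) :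
    a = c ∨ a ∣ b := by
  have ha := hred.1
  have hβm : β ∈ Ideal.span {(a : 𝓞 K), ω} := by
    have h1 : β ∈ Ideal.span {(a : 𝓞 K), ω} * Ideal.span {(a : 𝓞 K), ω} := by
      rw [hβ]; exact Ideal.mem_span_singleton_self β
    have hle : Ideal.span {(a : 𝓞 K), ω} * Ideal.span {(a : 𝓞 K), ω} ≤
      Ideal.span {(a : 𝓞 K), ω} := Ideal.mul_le_right
    exact hle h1
  obtain ⟨v, rfl⟩ := (E.mem_span_pair_iff hω hform β).1 hβm
  have h1 := congrArg (fun n : ℕ => (n : ℤ)) (congrArg Ideal.absNorm hβ)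
  simp only [map_mul] at h1
  push_cast at h1
  rw [E.absNorm_span_pair hN hω hform ha, E.absNorm_coord hω hform] at h1
  have h2 : a = qf a b c v := mul_left_cancel₀ ha.ne' h1
  by_cases hv2 : v.2 = 0
  · right
    have hv1 : v.1 ^ 2 = 1 := by
      simp only [qf, hv2] at h2
      apply mul_left_cancel₀ ha.ne'
      linarith
    have hsq := E.omega_sq_eq hω (k := a * c) (by linear_combination hform)
    push_cast at hsq
    have hmem : ω * ω ∈ Ideal.span {(a : 𝓞 K), ω} * Ideal.span {(a : 𝓞 K), ω} :=
      Ideal.mul_mem_mul (Ideal.subset_span (by simp)) (Ideal.subset_span (by simp))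
    rw [hβ, Ideal.mem_span_singleton, hv2] at hmem
    obtain ⟨y, hy⟩ := hmem
    refine (E.dvd_coord hω hN (two_dvd_add_of_disc hform) (p := a) (m := 0) (n := b)
      ⟨v.1 * y + c, ?_⟩).2
    push_cast at hy ⊢
    linear_combination hy - hsq
  · left
    exact le_antisymm hred.2.2.1 (by rw [h2]; exact le_qf_of_reduced hred hv2)

end IntegerModel

end

/-! ### Theta series of lattices -/

/-- The theta series of a lattice with basis `p, q` as a sum over `ℤ²`, when the basis gives the
numbers `z(v) / √A`. -/
lemma thetaQ_span_pair {A B C : ℤ} {N : ℕ} [NeZero N] (hA : 0 < A)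
    (hN : B ^ 2 - 4 * A * C = -(N : ℤ)) {p q : EuclideanSpace ℝ (Fin 2)}
    (h0 : ∀ v : ℤ × ℤ, v.1 * p 0 + v.2 * q 0 = (√(A : ℝ))⁻¹ * (zf A B N v).re)
    (h1 : ∀ v : ℤ × ℤ, v.1 * p 1 + v.2 * q 1 = (√(A : ℝ))⁻¹ * (zf A B N v).im) (τ : ℍ) :
    thetaQ (Submodule.span ℤ {p, q}) P₂ τ =
      ∑' v : ℤ × ℤ, (((zf A B N v ^ 2).re / A : ℝ) : ℂ) * expi (qf A B C v * τ) := by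
  have hA' : (0 : ℝ) < A := Int.cast_pos.2 hA
  have hsq : (√(A : ℝ))⁻¹ ^ 2 = (A : ℝ)⁻¹ := by rw [inv_pow, Real.sq_sqrt hA'.le]
  have hmem : ∀ v : ℤ × ℤ, v.1 • p + v.2 • q ∈ Submodule.span ℤ {p, q} := fun v =>
    Submodule.mem_span_pair.2 ⟨v.1, v.2, rfl⟩
  let g : ℤ × ℤ → Submodule.span ℤ {p, q} := fun v => ⟨v.1 • p + v.2 • q, hmem v⟩
  have hg0 : ∀ v, ((g v : EuclideanSpace ℝ (Fin 2))) 0 = (√(A : ℝ))⁻¹ * (zf A B N v).re := by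
    intro v; rw [← h0 v]; simp [g]
  have hg1 : ∀ v, ((g v : EuclideanSpace ℝ (Fin 2))) 1 = (√(A : ℝ))⁻¹ * (zf A B N v).im := by
    intro v; rw [← h1 v]; simp [g]
  have hzf : ∀ v w, zf A B N v = zf A B N w → v = w := by
    intro v w h
    by_contra hne
    have h2 : zf A B N (v - w) = 0 := by
      have : zf A B N (v - w) = zf A B N v - zf A B N w := by
        simp only [zf, Prod.fst_sub, Prod.snd_sub]; push_cast; ring
      rw [this, h, sub_self]
    have h3 := norm_zf_sq hN (v - w)
    rw [h2, norm_zero] at h3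
    have h4 := qf_pos hA (disc_neg hN) (sub_ne_zero.2 hne)
    have h5 : (0 : ℝ) < A * qf A B C (v - w) := mul_pos hA' (Int.cast_pos.2 h4)
    rw [← h3] at h5
    norm_num at h5
  have hbij : Function.Bijective g := by
    constructor
    · intro v w h
      have e0 := hg0 v
      have e1 := hg1 v
      rw [h, hg0 w] at e0
      rw [h, hg1 w] at e1
      have hne : (√(A : ℝ))⁻¹ ≠ 0 := (inv_pos.2 (Real.sqrt_pos.2 hA')).ne'
      exact hzf v w (Complex.ext (mul_left_cancel₀ hne e0).symm (mul_left_cancel₀ hne e1).symm)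
    · rintro ⟨x, hx⟩
      obtain ⟨m, n, rfl⟩ := Submodule.mem_span_pair.1 hx
      exact ⟨(m, n), rfl⟩
  unfold thetaQ thetaSeries
  rw [← (Equiv.ofBijective g hbij).tsum_eq]
  refine tsum_congr fun v => ?_
  rw [Equiv.ofBijective_apply]
  congr 1
  · rw [Complex.ofReal_inj]
    simp only [P₂, map_sub, map_pow, MvPolynomial.eval_X, hg0, hg1]
    rw [mul_pow, mul_pow, hsq, sq (zf A B N v), Complex.mul_re]
    field_simp
  · have hin : inner ℝ (g v : EuclideanSpace ℝ (Fin 2)) (g v : EuclideanSpace ℝ (Fin 2)) =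
        (qf A B C v : ℝ) := by
      rw [PiLp.inner_apply, Fin.sum_univ_two]
      simp only [hg0, hg1, RCLike.inner_apply, conj_trivial]
      have h3 := norm_zf_sq hN v
      rw [← Complex.normSq_eq_norm_sq, Complex.normSq_apply] at h3
      have h4 : (√(A : ℝ))⁻¹ ^ 2 * (A * qf A B C v) = (qf A B C v : ℝ) := by
        rw [hsq]; field_simp
      rw [← h4, ← h3]; ring
    rw [hin, expi]
    congr 1
    push_cast; ring

lemma conj_omega (B : ℤ) (N : ℕ) : starRingEnd ℂ (omega B N) = B - omega B N := by
  simp only [omega, map_div₀, map_add, map_mul, map_intCast, Complex.conj_I, Complex.conj_ofReal,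
    map_ofNat]
  ring

/-- If complex conjugation acts on the numbers `z(v)` through a permutation of `ℤ²` that preserves
the form, up to a factor `u`, then the sum of the real parts of the squares is a multiple of the
sum of the squares. -/
lemma tsum_re_eq {A B C : ℤ} {N : ℕ} [NeZero N] (hA : 0 < A)
    (hN : B ^ 2 - 4 * A * C = -(N : ℤ)) {u : ℂ} (hu : u ≠ 0) {ι : ℤ × ℤ → ℤ × ℤ}
    (hι : Function.Involutive ι) (hqι : ∀ v, qf A B C (ι v) = qf A B C v)
    (hzι : ∀ v, zf A B N (ι v) = u * starRingEnd ℂ (zf A B N v)) {t : ℂ} (ht : 0 < t.im) :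
    ∑' v : ℤ × ℤ, (((zf A B N v ^ 2).re / A : ℝ) : ℂ) * expi (qf A B C v * t) =
      (1 + 1 / u ^ 2) / (2 * A) * thetaForm A B C N t := by
  have hs := summable_thetaForm hA hN ht
  let e : ℤ × ℤ ≃ ℤ × ℤ := hι.toPerm
  have hs' : Summable fun v => zf A B N (ι v) ^ 2 * expi (qf A B C (ι v) * t) :=
    (e.summable_iff (f := fun v => zf A B N v ^ 2 * expi (qf A B C v * t))).2 hs
  have ht' : ∑' v, zf A B N (ι v) ^ 2 * expi (qf A B C (ι v) * t) = thetaForm A B C N t :=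
    e.tsum_eq (fun v => zf A B N v ^ 2 * expi (qf A B C v * t))
  have hA' : (A : ℂ) ≠ 0 := Int.cast_ne_zero.2 hA.ne'
  have hterm : ∀ v, (((zf A B N v ^ 2).re / A : ℝ) : ℂ) * expi (qf A B C v * t) =
      1 / (2 * A) * (zf A B N v ^ 2 * expi (qf A B C v * t)) +
        1 / (2 * A * u ^ 2) * (zf A B N (ι v) ^ 2 * expi (qf A B C (ι v) * t)) := by
    intro v
    have h1 : ((zf A B N v ^ 2).re : ℂ) =
        (zf A B N v ^ 2 + starRingEnd ℂ (zf A B N v) ^ 2) / 2 := by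
      rw [← map_pow, Complex.re_eq_add_conj]
    rw [hqι, hzι]
    push_cast
    rw [h1]
    field_simp
  simp_rw [hterm]
  rw [(hs.mul_left _).tsum_add (hs'.mul_left _), tsum_mul_left, tsum_mul_left, ht']
  change _ * thetaForm A B C N t + _ = _
  field_simp

/-- A form with `A ∣ B` is symmetric under `(m, n) ↦ (m + n B / A, -n)`, which acts as complex
conjugation. -/
lemma tsum_re_of_dvd {A B C : ℤ} {N : ℕ} [NeZero N] (hA : 0 < A)
    (hN : B ^ 2 - 4 * A * C = -(N : ℤ)) (hAB : A ∣ B) {t : ℂ} (ht : 0 < t.im) :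
    ∑' v : ℤ × ℤ, (((zf A B N v ^ 2).re / A : ℝ) : ℂ) * expi (qf A B C v * t) =
      1 / A * thetaForm A B C N t := by
  obtain ⟨k, rfl⟩ := hAB
  rw [tsum_re_eq hA hN one_ne_zero (ι := fun v => (v.1 + k * v.2, -v.2))
    (fun v => by ext <;> simp) (fun v => by simp only [qf]; ring) (fun v => ?_) ht]
  · have hA' : (A : ℂ) ≠ 0 := Int.cast_ne_zero.2 hA.ne'
    field_simp
    norm_num
  · simp only [zf, map_add, map_mul, map_intCast, conj_omega]
    push_cast; ring

/-- A form with equal outer coefficients is symmetric under exchange of the variables, which acts as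
complex conjugation followed by multiplication by `ω / A`. -/
lemma tsum_re_of_eq {A B : ℤ} {N : ℕ} [NeZero N] (hA : 0 < A)
    (hN : B ^ 2 - 4 * A * A = -(N : ℤ)) {t : ℂ} (ht : 0 < t.im) :
    ∑' v : ℤ × ℤ, (((zf A B N v ^ 2).re / A : ℝ) : ℂ) * expi (qf A B A v * t) =
      B / (2 * A * omega B N) * thetaForm A B A N t := by
  have hA' : (A : ℂ) ≠ 0 := Int.cast_ne_zero.2 hA.ne'
  have hsq : omega B N ^ 2 = B * omega B N - A * A := omega_sq hN
  have hω0 : omega B N ≠ 0 := by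
    intro h
    rw [h] at hsq
    have : (A : ℂ) * A = 0 := by linear_combination hsq
    exact hA' (mul_self_eq_zero.1 this)
  rw [tsum_re_eq hA hN (u := omega B N / A) (div_ne_zero hω0 hA') (ι := Prod.swap)
    (fun v => by ext <;> simp) (fun v => by simp only [qf, Prod.fst_swap, Prod.snd_swap]; ring)
    (fun v => ?_) ht]
  · congr 1
    field_simp
    linear_combination hsq
  · simp only [zf, map_add, map_mul, map_intCast, conj_omega, Prod.fst_swap, Prod.snd_swap]
    field_simp
    linear_combination (v.2 : ℂ) * hsq

lemma thetaQ_P₁ (Λ : Submodule ℤ (EuclideanSpace ℝ (Fin 2))) :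
    thetaQ Λ P₁ = (1 / 2 : ℂ) • thetaQ Λ P₂ := by
  funext τ
  simp only [thetaQ, thetaSeries, Pi.smul_apply, smul_eq_mul]
  rw [← tsum_mul_left]
  refine tsum_congr fun x => ?_
  rw [show P₁ = MvPolynomial.C (1 / 2) * P₂ from rfl, map_mul, MvPolynomial.eval_C]
  push_cast; ring

/-- The theta series of the ring of integers is that of the principal form, where the weight `Re z²`
may be replaced by `z²`. -/
lemma exists_principal_form {d : ℕ} (hd : Squarefree d) (hd1 : d ≠ 1) (hd3 : d ≠ 3) :
    ∃ b₀ c₀ : ℤ, b₀ ^ 2 - 4 * 1 * c₀ = fieldDisc d ∧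
      thetaQ (principalLattice d) P₂ = thetaH 1 b₀ c₀ (fieldDisc d).natAbs := by
  have hN7 := seven_le_natAbs_fieldDisc hd hd1 hd3
  have : NeZero (fieldDisc d).natAbs := ⟨by omega⟩
  have hneg := neg_natAbs_fieldDisc d
  have hN := natAbs_fieldDisc d
  have key : ∀ (b₀ c₀ : ℤ) (s : ℝ), b₀ ^ 2 - 4 * 1 * c₀ = fieldDisc d →
      s = √((fieldDisc d).natAbs : ℝ) / 2 → ∀ τ : ℍ,
      thetaQ (Submodule.span ℤ {!₂[(1 : ℝ), 0], !₂[(b₀ : ℝ) / 2, s]}) P₂ τ =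
        thetaH 1 b₀ c₀ (fieldDisc d).natAbs τ := by
    intro b₀ c₀ s hform hs τ
    rw [← hneg] at hform
    rw [thetaQ_span_pair (A := 1) (B := b₀) (C := c₀) one_pos hform (fun v => ?_) (fun v => ?_),
      tsum_re_of_dvd one_pos hform (one_dvd _) τ.im_pos]
    · simp [thetaH]
    · simp [zf, omega]; ring
    · simp [zf, omega, hs]; ring
  by_cases h3 : d % 4 = 3
  · rw [if_pos h3] at hN
    refine ⟨-1, (1 + d) / 4, ?_, funext fun τ => ?_⟩
    · unfold fieldDisc; rw [if_pos h3]; omega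
    · rw [principalLattice, if_pos h3]
      have hN' : ((fieldDisc d).natAbs : ℝ) = d := by exact_mod_cast hN
      have := key (-1) ((1 + d) / 4) (√(d : ℝ) / 2)
        (by unfold fieldDisc; rw [if_pos h3]; omega) (by rw [hN']) τ
      rw [← this]
      push_cast; rfl
  · rw [if_neg h3] at hN
    have hD : (0 : ℤ) ^ 2 - 4 * 1 * (d : ℤ) = fieldDisc d := by
      unfold fieldDisc; rw [if_neg h3]; ring
    refine ⟨0, d, hD, funext fun τ => ?_⟩
    rw [principalLattice, if_neg h3]
    have hN' : ((fieldDisc d).natAbs : ℝ) = 2 ^ 2 * d := by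
      have : ((fieldDisc d).natAbs : ℝ) = 4 * d := by exact_mod_cast hN
      rw [this]; norm_num
    have := key 0 d (√(d : ℝ)) hD (by
      rw [hN', Real.sqrt_mul (by norm_num), Real.sqrt_sq (by norm_num)]; ring) τ
    rw [← this]
    simp

lemma thetaQ_formLattice {d : ℕ} [NeZero (fieldDisc d).natAbs] {a b c : ℤ} (ha : 0 < a)
    (hform : b ^ 2 - 4 * a * c = fieldDisc d) (τ : ℍ) :
    thetaQ (formLattice (fieldDisc d) a b) P₂ τ =
      ∑' v : ℤ × ℤ, (((zf a b (fieldDisc d).natAbs v ^ 2).re / a : ℝ) : ℂ) *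
        expi (qf a b c v * τ) := by
  have hneg := neg_natAbs_fieldDisc d
  have hs : -(fieldDisc d : ℝ) = ((fieldDisc d).natAbs : ℝ) := by
    have := congrArg (Int.cast : ℤ → ℝ) hneg
    rw [Int.cast_neg, Int.cast_natCast] at this
    rw [← this, neg_neg]
  rw [← hneg] at hform
  refine thetaQ_span_pair ha hform (fun v => ?_) (fun v => ?_) τ
  · simp [zf, omega]; ring
  · rw [hs]; simp [zf, omega]; ring

/-! ### Class numbers one and two -/

section

variable {K : Type*} [Field K] [NumberField K] {d : ℕ}

theorem isCMEigenform_classNumber_one (hd : Squarefree d) (hd1 : d ≠ 1) (hd3 : d ≠ 3)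
    (hdeg : Module.finrank ℚ K = 2) (hsqrt : ∃ s : K, s ^ 2 = -(d : K))
    (h : classNumber K = 1) :
    IsCMEigenformOfWeightThree d (thetaQ (principalLattice d) P₁) := by
  obtain ⟨E⟩ := nonempty_integerModel hd hdeg hsqrt
  obtain ⟨b₀, c₀, hform₀, hθ⟩ := exists_principal_form hd hd1 hd3
  rw [thetaQ_P₁, hθ]
  exact isCMEigenform_of_principal hd hd1 hd3 E hform₀ (exists_generator_of_classNumber_one h)

/-- The two shapes of the reduced form correspond to the two generators `ω` and `a` of `𝔞²`. The
factor by which `Re z²` differs from `z²` in the theta series turns `1 / (2β)` into `coeffTwo`. -/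
theorem isCMEigenform_classNumber_two (hd : Squarefree d) (hd1 : d ≠ 1) (hd3 : d ≠ 3)
    (hdeg : Module.finrank ℚ K = 2) (hsqrt : ∃ s : K, s ^ 2 = -(d : K))
    (h : classNumber K = 2) {a b c : ℤ} (hred : IsReducedForm a b c)
    (hform : b ^ 2 - 4 * a * c = fieldDisc d) (ha1 : a ≠ 1) :
    IsCMEigenformOfWeightThree d
      ((1 / 2 : ℂ) • thetaQ (principalLattice d) P₂ +
        (coeffTwo a b c : ℂ) • thetaQ (formLattice (fieldDisc d) a b) P₂) := by
  obtain ⟨E⟩ := nonempty_integerModel hd hdeg hsqrt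
  obtain ⟨b₀, c₀, hform₀, hθ⟩ := exists_principal_form hd hd1 hd3
  have hN7 := seven_le_natAbs_fieldDisc hd hd1 hd3
  have hN : (fieldDisc d).natAbs ≠ 0 := by omega
  have : NeZero (fieldDisc d).natAbs := ⟨hN⟩
  have ha := hred.1
  have ha' : (a : ℂ) ≠ 0 := Int.cast_ne_zero.2 ha.ne'
  have hformN : b ^ 2 - 4 * a * c = -((fieldDisc d).natAbs : ℤ) := by
    rw [hform, neg_natAbs_fieldDisc]
  obtain ⟨ω, hω⟩ := E.exists_half b (IntegerModel.two_dvd_add_of_disc hformN)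
  have hnp := E.not_principal_of_reduced hN hω hformN hred ha1
  have hcl := exists_generator_or_of_classNumber_two h hnp
  have hprim := fun p hp => not_prime_dvd_form hd hform (p := p) hp
  rw [hθ]
  by_cases hac : a = c
  · subst hac
    -- `b = 0` would make `a` a unit, so `coeffTwo` is not a division by zero
    have hco : IsCoprime a b := isCoprime_of_primitive hprim dvd_rfl
    have hb0 : b ≠ 0 := by
      rintro rfl
      rw [isCoprime_zero_right, Int.isUnit_iff] at hco
      omega
    have hb' : (b : ℂ) ≠ 0 := Int.cast_ne_zero.2 hb0
    have hβ := E.span_pair_sq_of_eq hω hformN hco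
    convert isCMEigenform_of_two_classes hd hd1 hd3 E hform₀ hω ha hform hcl hnp hβ using 2
    funext τ
    rw [Pi.smul_apply, Pi.smul_apply, thetaQ_formLattice ha hform,
      tsum_re_of_eq ha hformN τ.im_pos, E.σ_omega hω, coeffTwo, if_pos rfl, thetaH, smul_eq_mul,
      smul_eq_mul, ← mul_assoc]
    congr 1
    push_cast
    field_simp
  · obtain ⟨β, hβ⟩ := (hcl (Ideal.span {(a : 𝓞 K), ω})).resolve_left hnp
    have hab := (E.ambiguous_of_sq_principal hN hω hformN hred hβ).resolve_left hac
    have hco : IsCoprime a c := isCoprime_of_primitive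
      (fun p hp hd => hprim p hp ⟨hd.1, hd.2.2, hd.2.1⟩) hab
    have hβ' := E.span_pair_sq_of_dvd hω hformN hab hco
    convert isCMEigenform_of_two_classes hd hd1 hd3 E hform₀ hω ha hform hcl hnp hβ' using 2
    funext τ
    rw [Pi.smul_apply, Pi.smul_apply, thetaQ_formLattice ha hform,
      tsum_re_of_dvd ha hformN hab τ.im_pos, map_intCast, coeffTwo, if_neg hac, thetaH, smul_eq_mul,
      smul_eq_mul, ← mul_assoc]
    congr 1
    push_cast
    field_simp

/-- The entries of the table are reduced forms of the right discriminant. -/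
lemma exists_form_of_mem_table {a b : ℤ} {c₂ : ℚ} (h : (d, a, b, c₂) ∈ classNumberTwoTable) :
    ∃ c : ℤ, IsReducedForm a b c ∧ b ^ 2 - 4 * a * c = fieldDisc d ∧ a ≠ 1 ∧
      coeffTwo a b c = c₂ := by
  refine ⟨(b ^ 2 - fieldDisc d) / (4 * a), ?_⟩
  simp only [classNumberTwoTable, List.mem_cons, List.not_mem_nil, or_false, Prod.mk.injEq] at h
  rcases h with h | h | h | h | h | h | h | h | h | h | h | h | h | h | h | h | h | h <;>
    obtain ⟨rfl, rfl, rfl, rfl⟩ := h <;>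
    norm_num [IsReducedForm, fieldDisc, coeffTwo]

end

end ToyLehmer

theorem corollary3p1 {K : Type*} [Field K] [NumberField K] (d : ℕ) (hd : Squarefree d)
    (hd1 : d ≠ 1) (hd3 : d ≠ 3) (hdeg : Module.finrank ℚ K = 2)
    (hsqrt : ∃ s : K, s ^ 2 = -(d : K)) :
    (NumberField.classNumber K = 1 →
      ToyLehmer.IsCMEigenformOfWeightThree d
        (ToyLehmer.thetaQ (ToyLehmer.principalLattice d) ToyLehmer.P₁)) ∧
    (NumberField.classNumber K = 2 →
      (∀ a b c : ℤ, ToyLehmer.IsReducedForm a b c →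
        b ^ 2 - 4 * a * c = ToyLehmer.fieldDisc d → a ≠ 1 →
        ToyLehmer.IsCMEigenformOfWeightThree d
          ((1 / 2 : ℂ) • ToyLehmer.thetaQ (ToyLehmer.principalLattice d) ToyLehmer.P₂ +
            (ToyLehmer.coeffTwo a b c : ℂ) •
              ToyLehmer.thetaQ (ToyLehmer.formLattice (ToyLehmer.fieldDisc d) a b)
                ToyLehmer.P₂)) ∧
      (∀ (a b : ℤ) (c₂ : ℚ), (d, a, b, c₂) ∈ ToyLehmer.classNumberTwoTable →
        ToyLehmer.IsCMEigenformOfWeightThree d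
          ((1 / 2 : ℂ) • ToyLehmer.thetaQ (ToyLehmer.principalLattice d) ToyLehmer.P₂ +
            (c₂ : ℂ) •
              ToyLehmer.thetaQ (ToyLehmer.formLattice (ToyLehmer.fieldDisc d) a b)
                ToyLehmer.P₂))) := by
  refine ⟨ToyLehmer.isCMEigenform_classNumber_one hd hd1 hd3 hdeg hsqrt, fun h =>
    ⟨fun a b c hred hform ha1 =>
      ToyLehmer.isCMEigenform_classNumber_two hd hd1 hd3 hdeg hsqrt h hred hform ha1,
      fun a b c₂ hmem => ?_⟩⟩
  obtain ⟨c, hred, hform, ha1, rfl⟩ := ToyLehmer.exists_form_of_mem_table hmem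
  exact ToyLehmer.isCMEigenform_classNumber_two hd hd1 hd3 hdeg hsqrt h hred hform ha1
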